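/- Let $\gamma>0$, $d\in[0,1)$, $\alpha>0$, and let $G_0$ be a probability distribution on a measurable trait space $\Psi$. For a measure $\nu$ on $(0,\infty)$, $\mathrm{CRM}(\nu)$ is the law of $\Theta=\sum_k\theta_k\delta_{\psi_k}$, where the points $(\theta_k,\psi_k)$ form a Poisson process with rate $\nu\times G_0$. The gamma process $\Gamma\mathrm P(\gamma,\lambda,d)$ and the beta prime process $\mathrm{BPP}(\gamma,\alpha,d)$ are the CRMs with rates on $(0,\infty)$ $$\gamma\frac{\lambda^{1-d}}{\Gamma(1-d)}\theta^{-1-d}e^{-\lambda\theta}\,d\theta\qquad\text{and}\qquad \gamma\frac{\Gamma(\alpha+1)}{\Gamma(1-d)\Gamma(\alpha+d)}\theta^{-1-d}(1+\theta)^{-\alpha}\,d\theta .$$ The power-law representation $\mathrm{PLRep}(c,a,d,g)$ is $$\Theta=\sum_{k\ge1}\sum_{i=1}^{C_k}\theta_{ki}\,\delta_{\psi_{ki}},\qquad \theta_{ki}=V_{ki}U_{kik}\prod_{\ell=1}^{k-1}(1-U_{ki\ell}),$$ with independent $C_k\sim\mathrm{Poisson}(c)$, $V_{ki}\sim g$,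 $U_{ki\ell}\sim\mathrm{Beta}(1-d,a+\ell d)$, $\psi_{ki}\sim G_0$; its truncation $\Theta_K$ keeps the rounds $k\le K$. (1) If $\Theta=\sum_k\theta_k\delta_{\psi_k}\sim\Gamma\mathrm P(\gamma\alpha,1,d)$ and the $G_k\sim\mathrm{Gam}(\alpha+d,1)$ are i.i.d. and independent of the atoms of $\Theta$, then $\sum_k(\theta_k/G_k)\,\delta_{\psi_k}\sim\mathrm{BPP}(\gamma,\alpha,d)$. The transition kernel of the mapping $\theta\mapsto u=\theta/G$ is $\kappa(\theta,du)=\mathrm{Gam}(\theta/u;\alpha+d,1)\,\frac{\theta}{u^2}\,du$ on $u>0$. (2) If $\Theta$ is given by $\mathrm{PLRep}(\gamma\alpha,1,d,\mathrm{BetaPrime}(1,\alpha+d))$, then $\Theta\sim\mathrm{BPP}(\gamma,\alpha,d)$. Here $\mathrm{BetaPrime}(1,b)$ has density $b(1+v)^{-1-b}$ on $(0,\infty)$. (3) Let $N\ge0$ and let $X_1,\dots,X_N$ be conditionally i.i.d. given the $\Theta$ of (2), $X_n=\sum_{k,i}x_{nki}\delta_{\psi_{ki}}$ with independent $x_{nki}\sim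 h(\cdot\mid\theta_{ki})$, where $h(x\mid\theta)=\mathbf 1[x\le1]\,\theta^x(1+\theta)^{-1}$ is the odds Bernoulli likelihood; let $Y_n\sim f(\cdot\mid X_n)$ independently, for an arbitrary Markov kernel $f$. Put $\pi(\theta)=h(0\mid\theta)=(1+\theta)^{-1}$ and $B_{N,K}=\int(1-\pi(\theta)^N)\,\nu_K^+(d\theta)$, where $\nu_K^+$ is the mean measure of the weights $\theta_{ki}$ with $k>K$, $i\le C_k$. If $\alpha>1$, then for all $N,K\ge0$ $$B_{N,K}\le \frac{N\gamma\alpha}{\alpha-1}\prod_{k=1}^K\frac{1+kd}{2+kd-d};$$ the probability that some observation has a nonzero count at an atom of a round $k>K$ equals $1-e^{-B_{N,K}}$; and the total variation distance between the marginal laws of $(Y_1,\dots,Y_N)$ under $\Theta$ and under $\Theta_K$ in place of $\Theta$ is at most this probability. Moreover, for every fixed $N$, as $K\to\infty$, $$\frac{N\gamma\alpha}{\alpha-1}\prod_{k=1}^K\frac{1+kd}{2+kd-d}\ \sim\ \frac{\gamma N\alpha}{\alpha-1}\begin{cases}2^{-K}& d=0,\\[2pt] \dfrac{\Gamma(2/d)}{\Gamma((1+d)/d)}\,K^{1-1/d}&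 0<d<1.\end{cases}$$ -/

import Mathlib

open MeasureTheory ProbabilityTheory Filter Asymptotics
open scoped ENNReal NNReal

noncomputable section

/-! ### Poisson processes and completely random measures -/

/-- The Poisson distribution with mean `m ∈ [0, ∞]`; for `m = ∞` it is the point mass at `∞`. -/
def extendedPoisson (m : ℝ≥0∞) : Measure ℝ≥0∞ :=
  if m = ∞ then Measure.dirac ∞
  else (poissonMeasure m.toNNReal).map (fun n : ℕ => (n : ℝ≥0∞))

/-- `Q`, a law on (counting) measures on `E`, is the law of a Poisson process with rate measure
`μ`: the number of points in a measurable set `A` is Poisson with mean `μ A`, and the numbers of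
points in disjoint measurable sets are independent. -/
structure IsPoissonProcessLaw {E : Type*} [MeasurableSpace E]
    (Q : Measure (Measure E)) (μ : Measure E) : Prop where
  isProbabilityMeasure : IsProbabilityMeasure Q
  count : ∀ A : Set E, MeasurableSet A → Q.map (fun M => M A) = extendedPoisson (μ A)
  indep : ∀ (n : ℕ) (A : Fin n → Set E), (∀ i, MeasurableSet (A i)) →
    Pairwise (fun i j => Disjoint (A i) (A j)) → iIndepFun (fun i (M : Measure E) => M (A i)) Q

/-- The counting measure `∑ i, δ_(θ i, ψ i)` of the weighted atoms. -/
def atomCount {ι Ψ : Type*} [MeasurableSpace Ψ] (θ : ι → ℝ) (ψ : ι → Ψ) : Measure (ℝ × Ψ) :=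
  Measure.sum fun i => Measure.dirac (θ i, ψ i)

/-- The measure `∑ i, θ i • δ_(ψ i)` on the trait space `Ψ`. -/
def weightedAtoms {ι Ψ : Type*} [MeasurableSpace Ψ] (θ : ι → ℝ) (ψ : ι → Ψ) : Measure Ψ :=
  Measure.sum fun i => ENNReal.ofReal (θ i) • Measure.dirac (ψ i)

/-- The measure `∑ θ • δ_ψ` over the points `(θ, ψ)` of a counting measure `M`. -/
def traitsOfPoints {Ψ : Type*} [MeasurableSpace Ψ] (M : Measure (ℝ × Ψ)) : Measure Ψ :=
  (M.withDensity fun p => ENNReal.ofReal p.1).map Prod.snd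

/-- `∑ i, θ i • δ_(ψ i)` is a completely random measure `CRM(ν)` with trait distribution `G`, given
through its atoms: the points `(θ i, ψ i)` form a Poisson process with rate `ν × G`. -/
def IsCRMAtoms {Ω Ψ ι : Type*} [MeasurableSpace Ω] [MeasurableSpace Ψ] (P : Measure Ω)
    (θ : ι → Ω → ℝ) (ψ : ι → Ω → Ψ) (ν : Measure ℝ) (G : Measure Ψ) : Prop :=
  IsPoissonProcessLaw (P.map fun ω => atomCount (fun i => θ i ω) (fun i => ψ i ω)) (ν.prod G)

/-- The random measure `Θ` has the distribution `CRM(ν)` with trait distribution `G`: its law is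
that of `∑ θ • δ_ψ` over the points `(θ, ψ)` of a Poisson process with rate `ν × G`. -/
def IsCRM {Ω Ψ : Type*} [MeasurableSpace Ω] [MeasurableSpace Ψ] (P : Measure Ω)
    (Θ : Ω → Measure Ψ) (ν : Measure ℝ) (G : Measure Ψ) : Prop :=
  ∃ Q : Measure (Measure (ℝ × Ψ)), IsPoissonProcessLaw Q (ν.prod G) ∧
    P.map Θ = Q.map traitsOfPoints

/-- The rate measure of the gamma process `ΓP(γ, lam, d)`, i.e.
`γ lam^(1-d) / Γ(1-d) θ^(-1-d) exp (-lam θ) dθ` on `(0, ∞)`. -/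
def gammaProcessRate (γ lam d : ℝ) : Measure ℝ :=
  (volume.restrict (Set.Ioi 0)).withDensity fun θ => ENNReal.ofReal
    (γ * lam ^ (1 - d) / Real.Gamma (1 - d) * θ ^ (-1 - d) * Real.exp (-(lam * θ)))

/-- The rate measure of the beta prime process `BPP(γ, α, d)`, i.e.
`γ Γ(α+1) / (Γ(1-d) Γ(α+d)) θ^(-1-d) (1+θ)^(-α) dθ` on `(0, ∞)`. -/
def betaPrimeProcessRate (γ α d : ℝ) : Measure ℝ :=
  (volume.restrict (Set.Ioi 0)).withDensity fun θ => ENNReal.ofReal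
    (γ * Real.Gamma (α + 1) / (Real.Gamma (1 - d) * Real.Gamma (α + d))
      * θ ^ (-1 - d) * (1 + θ) ^ (-α))

/-! ### Power-law representations -/

/-- The beta prime distribution, with density `v^(a-1) (1+v)^(-a-b) / B(a,b)` on `(0, ∞)`. -/
def betaPrimeMeasure (a b : ℝ) : Measure ℝ :=
  (volume.restrict (Set.Ioi 0)).withDensity fun v => ENNReal.ofReal
    (v ^ (a - 1) * (1 + v) ^ (-a - b) / beta a b)

/-- The random ingredients of the power-law representation `PLRep(γ, α, d, g)`, all independent:
`C k ~ Poisson(γ)`, `V (k, i) ~ g`, `U ((k, i), l) ~ Beta(1 - d, α + l d)` and traits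
`ψ (k, i) ~ G`. Rounds `k` and sticks `l` are counted from `0` here, and from `1` in the usual
notation, whence the `l + 1`. -/
structure IsPowerLawRep {Ω Ψ : Type*} [MeasurableSpace Ω] [MeasurableSpace Ψ] (P : Measure Ω)
    (C : ℕ → Ω → ℕ) (V : ℕ × ℕ → Ω → ℝ) (U : (ℕ × ℕ) × ℕ → Ω → ℝ) (ψ : ℕ × ℕ → Ω → Ψ)
    (γ α d : ℝ) (g : Measure ℝ) (G : Measure Ψ) : Prop where
  measurable_C : ∀ k, Measurable (C k)
  measurable_V : ∀ p, Measurable (V p)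
  measurable_U : ∀ q, Measurable (U q)
  measurable_ψ : ∀ p, Measurable (ψ p)
  law_C : ∀ k, P.map (C k) = poissonMeasure γ.toNNReal
  law_V : ∀ p, P.map (V p) = g
  law_U : ∀ q, P.map (U q) = betaMeasure (1 - d) (α + ((q.2 : ℝ) + 1) * d)
  law_ψ : ∀ p, P.map (ψ p) = G
  indep_C : iIndepFun C P
  indep_V : iIndepFun V P
  indep_U : iIndepFun U P
  indep_ψ : iIndepFun ψ P
  /- the next three fields: the four families are mutually independent -/
  indep_C_VUψ : IndepFun (fun ω k => C k ω)
    (fun ω => (fun p => V p ω, fun q => U q ω, fun p => ψ p ω)) P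
  indep_V_Uψ : IndepFun (fun ω p => V p ω) (fun ω => (fun q => U q ω, fun p => ψ p ω)) P
  indep_U_ψ : IndepFun (fun ω q => U q ω) (fun ω p => ψ p ω) P

/-- The weight `θ_{ki} = V_{ki} U_{kik} ∏_{l < k} (1 - U_{kil})` of the atom `p = (k, i)` if that
atom is present, i.e. `i < C k`, and `0` otherwise. -/
def plWeight {Ω : Type*} (C : ℕ → Ω → ℕ) (V : ℕ × ℕ → Ω → ℝ) (U : (ℕ × ℕ) × ℕ → Ω → ℝ)
    (p : ℕ × ℕ) (ω : Ω) : ℝ :=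
  if p.2 < C p.1 ω then
    V p ω * U (p, p.1) ω * ∏ l ∈ Finset.range p.1, (1 - U (p, l) ω)
  else 0

/-- The weights of the truncation of a representation to its first `K` rounds. -/
def truncatedWeight {Ω : Type*} (K : ℕ) (w : ℕ × ℕ → Ω → ℝ) (p : ℕ × ℕ) (ω : Ω) : ℝ :=
  if p.1 < K then w p ω else 0

/-! ### Observations with the odds Bernoulli likelihood -/

/-- The odds Bernoulli likelihood `h(x | θ) = 1[x ≤ 1] θ^x (1 + θ)⁻¹`, `x ∈ ℕ`. -/
def oddsBernoulliPMF (θ : ℝ≥0) (x : ℕ) : ℝ≥0 := if x ≤ 1 then θ ^ x * (1 + θ)⁻¹ else 0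

/-- The odds Bernoulli distribution on `ℕ`. -/
def oddsBernoulli (θ : ℝ≥0) : Measure ℕ :=
  Measure.sum fun x => (oddsBernoulliPMF θ x : ℝ≥0∞) • Measure.dirac x

instance (θ : ℝ≥0) : IsProbabilityMeasure (oddsBernoulli θ) where
  measure_univ := by
    have h : ∀ x ∉ Finset.range 2, (oddsBernoulliPMF θ x : ℝ≥0∞) = 0 := by
      intro x hx
      have : ¬ x ≤ 1 := by simpa using hx
      simp [oddsBernoulliPMF, this]
    simp only [oddsBernoulli, Measure.sum_apply _ MeasurableSet.univ, Measure.smul_apply,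
      measure_univ, smul_eq_mul, mul_one]
    rw [tsum_eq_sum h, Finset.sum_range_succ, Finset.sum_range_one]
    norm_cast
    have : (1 + θ) ≠ 0 := by positivity
    simp [oddsBernoulliPMF]
    field_simp

/-- Given the weights `w`, the law of the independent trait counts `x i ~ h(· | w i)` of one
observation. -/
def countLaw {ι : Type*} (w : ι → ℝ) : Measure (ι → ℕ) :=
  Measure.infinitePi fun i => oddsBernoulli (w i).toNNReal

/-- The likelihood process: given `∑ w i • δ_(ψ i)`, the law of the observation
`X = ∑ x i • δ_(ψ i)`, with independent `x i ~ h(· | w i)`. -/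
def likelihoodProcess {ι Ψ : Type*} [MeasurableSpace Ψ] (w : ι → ℝ) (ψ : ι → Ψ) :
    Measure (Measure Ψ) :=
  (countLaw w).map fun x => Measure.sum fun i => (x i : ℝ≥0∞) • Measure.dirac (ψ i)

/-- The marginal law of the data `Y_1, …, Y_N` in the model in which, given
`Θ = ∑ w i • δ_(ψ i)`, the `X_1, …, X_N` are i.i.d. from the likelihood process of `Θ` and, given
these, the `Y_n ~ f(· | X_n)` are independent. -/
def dataLaw {Ω ι Ψ Y : Type*} [MeasurableSpace Ω] [MeasurableSpace Ψ] [MeasurableSpace Y]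
    (P : Measure Ω) (w : ι → Ω → ℝ) (ψ : ι → Ω → Ψ) (f : Kernel (Measure Ψ) Y) (N : ℕ) :
    Measure (Fin N → Y) :=
  P.bind fun ω => Measure.pi fun _ : Fin N =>
    (likelihoodProcess (fun i => w i ω) (fun i => ψ i ω)).bind f

/-- The probability that one of `N` observations has a nonzero count at an atom of round `K` or
later, i.e. at an atom that the truncation to the first `K` rounds discards. -/
def missProbability {Ω : Type*} [MeasurableSpace Ω] (P : Measure Ω) (w : ℕ × ℕ → Ω → ℝ)
    (N K : ℕ) : ℝ≥0∞ :=
  (P.bind fun ω => Measure.pi fun _ : Fin N => countLaw fun p => w p ω)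
    {x | ∃ n p, K ≤ p.1 ∧ x n p ≠ 0}

/-- The rate measure `ν_K⁺` of the atoms that the truncation discards: the expected number of
discarded atoms with weight in a given set. -/
def tailRate {Ω : Type*} [MeasurableSpace Ω] (P : Measure Ω) (C : ℕ → Ω → ℕ)
    (w : ℕ × ℕ → Ω → ℝ) (K : ℕ) : Measure ℝ :=
  P.bind fun ω => Measure.sum fun p : ℕ × ℕ =>
    if K ≤ p.1 ∧ p.2 < C p.1 ω then Measure.dirac (w p ω) else 0

/-- `B_{N,K} = ∫ (1 - π(θ)^N) ν_K⁺(dθ)`, where `π(θ) = h(0 | θ)`. -/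
def truncationB {Ω : Type*} [MeasurableSpace Ω] (P : Measure Ω) (C : ℕ → Ω → ℕ)
    (w : ℕ × ℕ → Ω → ℝ) (N K : ℕ) : ℝ≥0∞ :=
  ∫⁻ θ, (1 - (oddsBernoulliPMF θ.toNNReal 0 : ℝ≥0∞) ^ N) ∂(tailRate P C w K)

/-- The explicit bound `N γ α / (α - 1) ∏_{k=1}^K (1 + k d) / (2 + k d - d)`. -/
def plTruncationBound (γ α d : ℝ) (N K : ℕ) : ℝ :=
  N * (γ * α / (α - 1)) * ∏ k ∈ Finset.Icc 1 K, (1 + (k : ℝ) * d) / (2 + (k : ℝ) * d - d)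

end

open Topology

/-! On the Poisson side everything goes through the Laplace functional: a law of `M` is that of a
Poisson process with rate `μ` exactly when `E exp (-∫ f dM) = exp (-∫ (1 - exp (-f)) dμ)` for all
measurable `f ≥ 0` (`IsPoissonProcessLaw.lintegral_nexp` and
`isPoissonProcessLaw_of_lintegral_nexp`). Working with `[0, ∞]`-valued functions avoids finiteness
conditions, which matters because the rates have infinite mass near weight `0`.

Stochastic mapping: by the marking theorem the quotients `θ / s` are again Poisson points. In the
variables `u = θ / s` and `s`, the joint density of gamma rate and mark is the beta prime rate at
`u` times the `Gam(α, 1 + u)` density at `s`; integrating out `s` leaves the beta prime rate.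

Power-law representation: superposed rounds of Poisson many i.i.d. atoms form a Poisson process
whose rate is the sum of the rates of the rounds. The weights `U_k ∏_{l<k} (1 - U_l)` have mean
measure `w⁻¹ Beta(w; 1 - d, 1 + d) dw` (`sum_map_sticks`). Indeed, splitting off the first stick
reproduces the same measure with `a + d` in place of `a`, and the remainder after many sticks is
negligible because the expected remaining stick tends to `0`. Scaling by `V` turns this measure into
the beta prime rate (`lintegral_betaPrime_stickIntensity`).

Truncation: the Laplace functional of the rounds, with `f = -N log π` on the discarded ones and `0`
elsewhere, gives the miss probability `1 - exp (-B)`. The bound on `B` combines `1 - π(θ)^N ≤ N θ`,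
the mean of `V`, and the fact that the expected stick mass of the discarded rounds is at most the
expected remaining stick `stickProd d K`. For total variation the two models are coupled: truncating
the weights amounts to erasing the counts of the discarded rounds, so the data can differ only where
something is erased (`pi_bind_le_add_missSet`). For `d > 0` the asymptotics come from writing the
product as a ratio of Euler's sequences for `Γ`. -/

noncomputable section

/-! ### The exponential `exp (-x)` and its inverse on `[0, ∞]`; Poisson transforms. -/

/-- The function `x ↦ exp (-x)` on `[0, ∞]`, with `exp (-∞) = 0`. -/
def nexp (x : ℝ≥0∞) : ℝ≥0∞ := EReal.exp (-(x : EReal))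

/-- The function `y ↦ - log y` on `[0, 1]`, with `- log 0 = ∞`. -/
def nlog (y : ℝ≥0∞) : ℝ≥0∞ := (-ENNReal.log y).toENNReal

lemma continuous_nexp : Continuous nexp :=
  ENNReal.continuous_exp.comp (continuous_neg.comp continuous_coe_ennreal_ereal)

@[fun_prop]
lemma measurable_nexp : Measurable nexp := continuous_nexp.measurable

@[fun_prop]
lemma measurable_nlog : Measurable nlog := by
  unfold nlog
  exact (continuous_neg.measurable.comp ENNReal.measurable_log).ereal_toENNReal

@[simp] lemma nexp_zero : nexp 0 = 1 := by simp [nexp]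

lemma nexp_le_one (x : ℝ≥0∞) : nexp x ≤ 1 := by
  unfold nexp
  rw [EReal.exp_le_one_iff, EReal.neg_le, neg_zero]
  exact EReal.coe_ennreal_nonneg x

lemma nexp_ne_top (x : ℝ≥0∞) : nexp x ≠ ∞ := ((nexp_le_one x).trans_lt ENNReal.one_lt_top).ne

lemma nexp_strictAnti : StrictAnti nexp := fun x y h => by
  unfold nexp
  rw [EReal.exp_lt_exp_iff]
  simpa using h

lemma nexp_lt_one {x : ℝ≥0∞} (hx : x ≠ 0) : nexp x < 1 := by
  simpa using nexp_strictAnti (pos_iff_ne_zero.2 hx)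

lemma nexp_add (x y : ℝ≥0∞) : nexp (x + y) = nexp x * nexp y := by
  unfold nexp
  rw [← EReal.exp_add]
  congr 1
  push_cast
  rw [EReal.neg_add (by simp) (by simp), sub_eq_add_neg]

lemma nexp_sum {ι : Type*} (s : Finset ι) (x : ι → ℝ≥0∞) :
    nexp (∑ i ∈ s, x i) = ∏ i ∈ s, nexp (x i) := by
  classical
  induction s using Finset.induction_on with
  | empty => simp
  | insert a s ha ih => rw [Finset.sum_insert ha, Finset.prod_insert ha, nexp_add, ih]

lemma nexp_nat_mul (n : ℕ) (x : ℝ≥0∞) : nexp (n * x) = nexp x ^ n := by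
  simpa using nexp_sum (Finset.range n) (fun _ => x)

lemma nexp_ofReal {x : ℝ} (hx : 0 ≤ x) : nexp (ENNReal.ofReal x) = ENNReal.ofReal (Real.exp (-x)) := by
  unfold nexp
  rw [EReal.coe_ennreal_ofReal, max_eq_left hx, ← EReal.coe_neg, EReal.exp_coe]

lemma toReal_nexp {x : ℝ≥0∞} (hx : x ≠ ∞) : (nexp x).toReal = Real.exp (-x.toReal) := by
  rw [← ENNReal.ofReal_toReal hx, nexp_ofReal ENNReal.toReal_nonneg,
    ENNReal.toReal_ofReal (Real.exp_pos _).le, ENNReal.toReal_ofReal ENNReal.toReal_nonneg]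

lemma nexp_nlog {y : ℝ≥0∞} (hy : y ≤ 1) : nexp (nlog y) = y := by
  unfold nexp nlog
  rw [EReal.coe_toENNReal, neg_neg, ENNReal.exp_log]
  rw [EReal.le_neg, neg_zero]
  simpa using hy

lemma nlog_nexp (x : ℝ≥0∞) : nlog (nexp x) = x :=
  nexp_strictAnti.injective (nexp_nlog (nexp_le_one x))

@[simp] lemma nlog_one : nlog 1 = 0 := by simp [nlog]

/-- Continuity of `nexp` up to and including `∞` lets infinite products in `[0, 1]` be handled as
unconditional sums, with no separate case for divergence to `0`. -/
lemma tendsto_prod_nexp {ι : Type*} (x : ι → ℝ≥0∞) :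
    Tendsto (fun s : Finset ι => ∏ i ∈ s, nexp (x i)) atTop (𝓝 (nexp (∑' i, x i))) := by
  simp_rw [← nexp_sum]
  exact (continuous_nexp.tendsto _).comp ENNReal.summable.hasSum

lemma one_sub_nexp_mono : Monotone fun x => 1 - nexp x :=
  fun _ _ h => tsub_le_tsub_left (nexp_strictAnti.antitone h) _

/-- For independent `X i`, `E exp (-∑ X i) = ∏ E exp (-X i)`. -/
lemma lintegral_nexp_tsum {Ω ι : Type*} [Countable ι] [MeasurableSpace Ω] {P : Measure Ω}
    {X : ι → Ω → ℝ≥0∞} (hX : iIndepFun X P) (hm : ∀ i, Measurable (X i)) :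
    ∫⁻ ω, nexp (∑' i, X i ω) ∂P = nexp (∑' i, nlog (∫⁻ ω, nexp (X i ω) ∂P)) := by
  have := hX.isProbabilityMeasure
  have hle : ∀ i, ∫⁻ ω, nexp (X i ω) ∂P ≤ 1 := fun i =>
    (lintegral_mono fun ω => nexp_le_one _).trans (by simp)
  have h1 := tendsto_prod_nexp fun i => nlog (∫⁻ ω, nexp (X i ω) ∂P)
  simp_rw [nexp_nlog (hle _)] at h1
  have h2 : Tendsto (fun s : Finset ι => ∫⁻ ω, ∏ i ∈ s, nexp (X i ω) ∂P) atTop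
      (𝓝 (∫⁻ ω, nexp (∑' i, X i ω) ∂P)) := by
    refine tendsto_lintegral_filter_of_dominated_convergence (fun _ => 1)
      (Eventually.of_forall fun s => by fun_prop)
      (Eventually.of_forall fun s => ae_of_all _ fun ω =>
        Finset.prod_le_one' fun i _ => nexp_le_one _) (by simp)
      (ae_of_all _ fun ω => tendsto_prod_nexp _)
  refine tendsto_nhds_unique h2 (h1.congr fun s => ?_)
  exact (lintegral_prod_eq_prod_lintegral_of_indepFun s (fun i ω => nexp (X i ω))
    (hX.comp (fun _ => nexp) fun _ => measurable_nexp) fun i => by fun_prop).symm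

/-- The generating function of the Poisson law, from the exponential series. The hypothesis `z ≤ 1`
makes the truncated subtraction `1 - z` exact. -/
lemma lintegral_pow_poissonMeasure (r : ℝ≥0) {z : ℝ≥0∞} (hz : z ≤ 1) :
    ∫⁻ n, z ^ n ∂(poissonMeasure r) = nexp (r * (1 - z)) := by
  lift z to ℝ≥0 using (hz.trans_lt ENNReal.one_lt_top).ne
  have hz' : (z : ℝ) ≤ 1 := by exact_mod_cast hz
  have e1 : (r : ℝ≥0∞) * (1 - z) = ENNReal.ofReal (r * (1 - z)) := by
    rw [ENNReal.ofReal_mul (by positivity), ENNReal.ofReal_sub _ (by positivity)]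
    simp
  rw [e1, nexp_ofReal (mul_nonneg (by positivity) (by linarith)), poissonMeasure,
    lintegral_sum_measure]
  simp_rw [lintegral_smul_measure, lintegral_dirac, smul_eq_mul]
  have e2 : ∀ n : ℕ, ENNReal.ofReal (Real.exp (-r) * r ^ n / n.factorial) * (z : ℝ≥0∞) ^ n =
      ENNReal.ofReal (Real.exp (-r) * ((r * z : ℝ) ^ n / n.factorial)) := by
    intro n
    rw [← ENNReal.ofReal_coe_nnreal, ← ENNReal.ofReal_pow (by positivity),
      ← ENNReal.ofReal_mul (by positivity)]
    congr 1
    ring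
  simp_rw [e2]
  have hs : HasSum (fun n : ℕ => Real.exp (-r) * ((r * z : ℝ) ^ n / n.factorial))
      (Real.exp (-r) * Real.exp (r * z)) := by
    rw [Real.exp_eq_exp_ℝ]
    exact (NormedSpace.expSeries_div_hasSum_exp (r * z : ℝ)).mul_left _
  rw [← ENNReal.ofReal_tsum_of_nonneg (fun n => by positivity) hs.summable, hs.tsum_eq,
    ← Real.exp_add]
  congr 2
  ring

instance (m : ℝ≥0∞) : IsProbabilityMeasure (extendedPoisson m) := by
  unfold extendedPoisson
  split_ifs
  · infer_instance
  · exact Measure.isProbabilityMeasure_map (Measurable.of_discrete).aemeasurable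

lemma lintegral_nexp_extendedPoisson (m t : ℝ≥0∞) :
    ∫⁻ x, nexp (t * x) ∂(extendedPoisson m) = nexp ((1 - nexp t) * m) := by
  unfold extendedPoisson
  split_ifs with hm
  · subst hm
    rw [lintegral_dirac]
    -- With infinite mean, `t = 0` is covered by `0 * ∞ = 0`; for `t ≠ 0` both exponents are `∞`.
    by_cases ht : t = 0
    · simp [ht]
    · rw [ENNReal.mul_top ht, ENNReal.mul_top (tsub_pos_of_lt (nexp_lt_one ht)).ne']
  · rw [lintegral_map (by fun_prop) Measurable.of_discrete]
    simp_rw [mul_comm t, nexp_nat_mul]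
    rw [lintegral_pow_poissonMeasure _ (nexp_le_one t), ENNReal.coe_toNNReal hm, mul_comm]

/-! ### Poisson processes and their Laplace functionals. -/

section Laplace
variable {E : Type*} [MeasurableSpace E]

/-- The level sets of `f` are disjoint, so the integral of `f` is a finite sum of multiples of
independent Poisson counts, whose Laplace transforms multiply. -/
lemma IsPoissonProcessLaw.lintegral_nexp_simpleFunc {Q : Measure (Measure E)} {μ : Measure E}
    (hQ : IsPoissonProcessLaw Q μ) (f : SimpleFunc E ℝ≥0∞) :
    ∫⁻ M, nexp (∫⁻ x, f x ∂M) ∂Q = nexp (∫⁻ x, (1 - nexp (f x)) ∂μ) := by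
  let e := f.range.equivFin.symm
  have hind := hQ.indep f.range.card (fun i => f ⁻¹' {(e i : ℝ≥0∞)})
    (fun i => f.measurableSet_preimage _) (fun i j hij => by
      refine Disjoint.preimage _ ?_
      rw [Set.disjoint_singleton]
      exact fun h => hij (e.injective (Subtype.ext h)))
  have h1 : ∀ M : Measure E, nexp (∫⁻ x, f x ∂M) =
      ∏ i, nexp ((e i : ℝ≥0∞) * M (f ⁻¹' {(e i : ℝ≥0∞)})) := by
    intro M
    rw [← nexp_sum, SimpleFunc.lintegral_eq_lintegral, SimpleFunc.lintegral,
      Equiv.sum_comp e (fun x => (x : ℝ≥0∞) * M (f ⁻¹' {(x : ℝ≥0∞)})),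
      Finset.sum_coe_sort f.range (fun x => x * M (f ⁻¹' {x}))]
  simp_rw [h1]
  rw [lintegral_prod_eq_prod_lintegral_of_indepFun Finset.univ
    (fun i (M : Measure E) => nexp ((e i : ℝ≥0∞) * M (f ⁻¹' {(e i : ℝ≥0∞)})))]
  · have h2 : ∀ i, ∫⁻ M, nexp ((e i : ℝ≥0∞) * M (f ⁻¹' {(e i : ℝ≥0∞)})) ∂Q =
        nexp ((1 - nexp (e i : ℝ≥0∞)) * μ (f ⁻¹' {(e i : ℝ≥0∞)})) := by
      intro i
      rw [← lintegral_nexp_extendedPoisson, ← hQ.count _ (f.measurableSet_preimage _),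
        lintegral_map (by fun_prop) (Measure.measurable_coe (f.measurableSet_preimage _))]
    simp_rw [h2]
    rw [← nexp_sum, Equiv.sum_comp e (fun x => (1 - nexp x) * μ (f ⁻¹' {(x : ℝ≥0∞)})),
      Finset.sum_coe_sort f.range (fun x => (1 - nexp x) * μ (f ⁻¹' {x})),
      ← SimpleFunc.map_lintegral (fun x => 1 - nexp x), ← SimpleFunc.lintegral_eq_lintegral]
    rfl
  · exact hind.comp (fun i x => nexp ((e i : ℝ≥0∞) * x)) fun i => by fun_prop
  · intro i
    exact measurable_nexp.comp
      ((Measure.measurable_coe (f.measurableSet_preimage _)).const_mul _)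

/-- The Laplace functional of a Poisson process. -/
lemma IsPoissonProcessLaw.lintegral_nexp {Q : Measure (Measure E)} {μ : Measure E}
    (hQ : IsPoissonProcessLaw Q μ) {f : E → ℝ≥0∞} (hf : Measurable f) :
    ∫⁻ M, nexp (∫⁻ x, f x ∂M) ∂Q = nexp (∫⁻ x, (1 - nexp (f x)) ∂μ) := by
  have := hQ.isProbabilityMeasure
  have hlim : ∀ x, Tendsto (fun n => SimpleFunc.eapprox f n x) atTop (𝓝 (f x)) := fun x =>
    SimpleFunc.tendsto_eapprox hf x
  have hmono : ∀ x, Monotone fun n => SimpleFunc.eapprox f n x := fun x i j h =>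
    SimpleFunc.monotone_eapprox f h x
  have h1 : Tendsto (fun n => ∫⁻ M, nexp (∫⁻ x, SimpleFunc.eapprox f n x ∂M) ∂Q) atTop
      (𝓝 (∫⁻ M, nexp (∫⁻ x, f x ∂M) ∂Q)) := by
    refine tendsto_lintegral_of_dominated_convergence (fun _ => 1) (fun n => ?_)
      (fun n => ae_of_all _ fun M => nexp_le_one _) (by simp) (ae_of_all _ fun M => ?_)
    · exact measurable_nexp.comp (Measure.measurable_lintegral (SimpleFunc.measurable _))
    · exact (continuous_nexp.tendsto _).comp (lintegral_tendsto_of_tendsto_of_monotone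
        (fun n => (SimpleFunc.measurable _).aemeasurable) (ae_of_all _ hmono) (ae_of_all _ hlim))
  -- On this side convergence is monotone, not dominated: `μ` may be infinite, but `1 - nexp`
  -- increases along the approximations.
  have h2 : Tendsto (fun n => nexp (∫⁻ x, (1 - nexp (SimpleFunc.eapprox f n x)) ∂μ)) atTop
      (𝓝 (nexp (∫⁻ x, (1 - nexp (f x)) ∂μ))) := by
    refine (continuous_nexp.tendsto _).comp (lintegral_tendsto_of_tendsto_of_monotone
        (fun n => ?_) (ae_of_all _ fun x => one_sub_nexp_mono.comp (hmono x))
        (ae_of_all _ fun x => ?_))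
    · exact (measurable_const.sub
        (measurable_nexp.comp (SimpleFunc.measurable _))).aemeasurable
    · exact ENNReal.Tendsto.sub tendsto_const_nhds ((continuous_nexp.tendsto _).comp (hlim x))
        (Or.inl (by simp))
  exact tendsto_nhds_unique h1 (h2.congr fun n => (hQ.lintegral_nexp_simpleFunc _).symm)

/-- A law on `[0, ∞]ⁿ` is determined by its Laplace transform. -/
lemma ext_of_lintegral_nexp {n : ℕ} {P P' : Measure (Fin n → ℝ≥0∞)} [IsFiniteMeasure P]
    [IsFiniteMeasure P'] (h : ∀ t : Fin n → ℕ, ∫⁻ x, nexp (∑ i, t i * x i) ∂P =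
      ∫⁻ x, nexp (∑ i, t i * x i) ∂P') : P = P' := by
  have hc : ∀ t : Fin n → ℕ, Continuous fun x : Fin n → ℝ≥0∞ => (nexp (∑ i, t i * x i)).toReal := by
    intro t
    refine ENNReal.continuousOn_toReal.comp_continuous (continuous_nexp.comp ?_)
      fun x => nexp_ne_top _
    exact continuous_finsetSum _ fun i _ =>
      (ENNReal.continuous_const_mul (by simp)).comp (continuous_apply i)
  let e : (Fin n → ℕ) → BoundedContinuousFunction (Fin n → ℝ≥0∞) ℝ := fun t =>
    BoundedContinuousFunction.mkOfCompact ⟨_, hc t⟩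
  have he : ∀ t x, e t x = (nexp (∑ i, t i * x i)).toReal := fun _ _ => rfl
  let A : StarSubalgebra ℝ (BoundedContinuousFunction (Fin n → ℝ≥0∞) ℝ) :=
    { Algebra.adjoin ℝ (Set.range e) with
      star_mem' := fun {a} ha => by
        have : star a = a := by ext; simp
        rwa [this] }
  -- Since `e s * e t = e (s + t)`, the generated algebra is just the linear span of the `e t`,
  -- where the two integrals agree by hypothesis. It remains that the algebra separates points, for
  -- which single coordinates suffice.
  have hspan : ∀ g ∈ A, g ∈ Submodule.span ℝ (Set.range e) := by
    intro g hg
    have hg' : g ∈ Algebra.adjoin ℝ (Set.range e) := hg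
    rw [← Subalgebra.mem_toSubmodule, Algebra.adjoin_eq_span] at hg'
    refine Submodule.span_mono (fun a ha => ?_) hg'
    induction ha using Submonoid.closure_induction with
    | mem x hx => exact hx
    | one => exact ⟨0, by ext x; simp [he]⟩
    | mul x y _ _ hx hy =>
      obtain ⟨s, rfl⟩ := hx
      obtain ⟨t, rfl⟩ := hy
      refine ⟨s + t, ?_⟩
      ext x
      simp [he, add_mul, Finset.sum_add_distrib, nexp_add]
  refine ext_of_forall_mem_subalgebra_integral_eq_of_polish (𝕜 := ℝ) (A := A) ?_ fun g hg => ?_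
  · intro x y hxy
    obtain ⟨i, hi⟩ := Function.ne_iff.1 hxy
    refine ⟨_, ⟨_, ⟨e (Pi.single i 1), Algebra.subset_adjoin ⟨_, rfl⟩, rfl⟩, rfl⟩, ?_⟩
    have h1 : ∀ z : Fin n → ℝ≥0∞, e (Pi.single i 1) z = (nexp (z i)).toReal := by
      intro z
      rw [he, Finset.sum_eq_single i (by simp +contextual) (by simp)]
      simp
    change e (Pi.single i 1) x ≠ e (Pi.single i 1) y
    rw [h1, h1, Ne, ENNReal.toReal_eq_toReal_iff' (nexp_ne_top _) (nexp_ne_top _)]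
    exact fun h => hi (nexp_strictAnti.injective h)
  · have hg' := hspan g hg
    clear hg
    induction hg' using Submodule.span_induction with
    | mem x hx =>
      obtain ⟨t, rfl⟩ := hx
      have hm : Measurable fun x : Fin n → ℝ≥0∞ => nexp (∑ i, t i * x i) := by fun_prop
      simp_rw [he]
      rw [integral_toReal hm.aemeasurable (ae_of_all _ fun x => (nexp_ne_top _).lt_top),
        integral_toReal hm.aemeasurable (ae_of_all _ fun x => (nexp_ne_top _).lt_top), h]
    | zero => simp
    | add x y _ _ hx hy =>
      simp only [BoundedContinuousFunction.coe_add, Pi.add_apply]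
      rw [integral_add (x.integrable _) (y.integrable _),
        integral_add (x.integrable _) (y.integrable _), hx, hy]
    | smul a x _ hx =>
      simp only [BoundedContinuousFunction.coe_smul, integral_smul, hx]

/-- Testing on finite combinations of indicators of disjoint sets gives the joint Laplace transform
of the counts, which factors into Poisson transforms. The counts therefore have a product law, and
both the marginals (case `n = 1`) and the independence follow. -/
lemma isPoissonProcessLaw_of_lintegral_nexp {Q : Measure (Measure E)} [IsProbabilityMeasure Q]
    {μ : Measure E} (h : ∀ f : E → ℝ≥0∞, Measurable f →
      ∫⁻ M, nexp (∫⁻ x, f x ∂M) ∂Q = nexp (∫⁻ x, (1 - nexp (f x)) ∂μ)) :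
    IsPoissonProcessLaw Q μ := by
  have key : ∀ (n : ℕ) (A : Fin n → Set E), (∀ i, MeasurableSet (A i)) →
      Pairwise (fun i j => Disjoint (A i) (A j)) →
      Q.map (fun M i => M (A i)) = Measure.pi fun i => extendedPoisson (μ (A i)) := by
    intro n A hA hd
    have hm : Measurable fun (M : Measure E) i => M (A i) :=
      measurable_pi_lambda _ fun i => Measure.measurable_coe (hA i)
    have := Measure.isProbabilityMeasure_map (μ := Q) hm.aemeasurable
    refine ext_of_lintegral_nexp fun t => ?_
    rw [lintegral_map (by fun_prop) hm]
    have h1 : ∀ M : Measure E, ∑ i, (t i : ℝ≥0∞) * M (A i) =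
        ∫⁻ x, ∑ i, (A i).indicator (fun _ => (t i : ℝ≥0∞)) x ∂M := by
      intro M
      rw [lintegral_finsetSum _ fun i _ => measurable_const.indicator (hA i)]
      simp [lintegral_indicator_const (hA _)]
    simp_rw [h1]
    rw [h _ (Finset.measurable_sum _ fun i _ => measurable_const.indicator (hA i))]
    -- By disjointness at most one summand is nonzero at `x`, so `1 - nexp` passes inside the sum.
    have h2 : ∀ x, 1 - nexp (∑ i, (A i).indicator (fun _ => (t i : ℝ≥0∞)) x) =
        ∑ i, (A i).indicator (fun _ => 1 - nexp (t i)) x := by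
      intro x
      by_cases hx : ∃ i, x ∈ A i
      · obtain ⟨i, hi⟩ := hx
        have hj : ∀ j, j ≠ i → x ∉ A j := fun j hj hxj =>
          Set.disjoint_left.1 (hd hj) hxj hi
        rw [Finset.sum_eq_single i (by simp +contextual [hj]) (by simp),
          Finset.sum_eq_single i (by simp +contextual [hj]) (by simp)]
        simp [hi]
      · push Not at hx
        simp [hx]
    simp_rw [h2]
    rw [lintegral_finsetSum _ fun i _ => measurable_const.indicator (hA i), nexp_sum]
    simp_rw [lintegral_indicator_const (hA _), ← lintegral_nexp_extendedPoisson, nexp_sum]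
    have hind : iIndepFun (fun i (x : Fin n → ℝ≥0∞) => nexp (t i * x i))
        (Measure.pi fun i => extendedPoisson (μ (A i))) :=
      iIndepFun_pi (X := fun i x => nexp (t i * x)) fun i => by fun_prop
    rw [lintegral_prod_eq_prod_lintegral_of_indepFun _ _ hind fun i => by fun_prop]
    refine Finset.prod_congr rfl fun i _ => ?_
    rw [← (measurePreserving_eval (fun i => extendedPoisson (μ (A i))) i).map_eq,
      lintegral_map (by fun_prop) (by fun_prop)]
  have hcount : ∀ A : Set E, MeasurableSet A →
      Q.map (fun M => M A) = extendedPoisson (μ A) := by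
    intro A hA
    have := congrArg (fun P => P.map fun x : Fin 1 → ℝ≥0∞ => x 0)
      (key 1 (fun _ => A) (fun _ => hA) (fun i j hij => (hij (Subsingleton.elim i j)).elim))
    rw [Measure.map_map (by fun_prop)
      (measurable_pi_lambda _ fun i => Measure.measurable_coe hA)] at this
    refine this.trans ?_
    exact (measurePreserving_eval (fun _ : Fin 1 => extendedPoisson (μ A)) 0).map_eq
  refine ⟨inferInstance, hcount, fun n A hA hd => ?_⟩
  rw [iIndepFun_iff_map_fun_eq_pi_map fun i => (Measure.measurable_coe (hA i)).aemeasurable,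
    key n A hA hd]
  simp_rw [hcount _ (hA _)]

end Laplace

/-! ### Marking and superposition. -/

section Marking
variable {Ω E F S ι : Type*} [MeasurableSpace Ω] [MeasurableSpace E] [MeasurableSpace F]
  [MeasurableSpace S] [Countable ι]

lemma measurable_measure_sum {μ : ι → Ω → Measure E} (h : ∀ i, Measurable (μ i)) :
    Measurable fun ω => Measure.sum fun i => μ i ω := by
  refine Measure.measurable_of_measurable_coe _ fun s hs => ?_
  simp_rw [Measure.sum_apply _ hs]
  exact Measurable.tsum fun i => (Measure.measurable_coe hs).comp (h i)

/-- Integrating out one of two independent random variables. -/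
lemma IndepFun.lintegral_comp {P : Measure Ω} [IsFiniteMeasure P] {X : Ω → E} {Y : Ω → F}
    (hXY : IndepFun X Y P) (hX : Measurable X) (hY : Measurable Y) {h : E → F → ℝ≥0∞}
    (hm : Measurable (Function.uncurry h)) :
    ∫⁻ ω, h (X ω) (Y ω) ∂P = ∫⁻ ω, ∫⁻ ω', h (X ω) (Y ω') ∂P ∂P := by
  have e1 : ∫⁻ ω, h (X ω) (Y ω) ∂P = ∫⁻ z, Function.uncurry h z ∂(P.map fun ω => (X ω, Y ω)) := by
    rw [lintegral_map hm (by fun_prop)]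
    rfl
  rw [e1, (indepFun_iff_map_prod_eq_prod_map_map hX.aemeasurable hY.aemeasurable).1 hXY,
    lintegral_prod _ hm.aemeasurable, lintegral_map hm.lintegral_prod_right' hX]
  refine lintegral_congr fun ω => ?_
  rw [lintegral_map (f := fun y => Function.uncurry h (X ω, y)) (hm.comp measurable_prodMk_left) hY]
  rfl

omit [Countable ι] in
lemma lintegral_sum_dirac {f : E → ℝ≥0∞} (hf : Measurable f) (x : ι → E) :
    ∫⁻ y, f y ∂(Measure.sum fun i => Measure.dirac (x i)) = ∑' i, f (x i) := by
  rw [lintegral_sum_measure]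
  simp_rw [lintegral_dirac' _ hf]

/-- The marking theorem: if the points `X i` form a Poisson process with rate `μ` and the marks
`T i ~ κ` are i.i.d. and independent of the points, the points `φ (X i, T i)` form a Poisson
process. -/
lemma isPoissonProcessLaw_marking {P : Measure Ω} [IsProbabilityMeasure P] {X : ι → Ω → E}
    {T : ι → Ω → S} {μ : Measure E} {κ : Measure S} [IsProbabilityMeasure κ] {φ : E × S → F}
    (hφ : Measurable φ) (hX : ∀ i, Measurable (X i)) (hT : ∀ i, Measurable (T i))
    (hQ : IsPoissonProcessLaw (P.map fun ω => Measure.sum fun i => Measure.dirac (X i ω)) μ)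
    (hlaw : ∀ i, P.map (T i) = κ) (hind : iIndepFun T P)
    (hXT : IndepFun (fun ω i => X i ω) (fun ω i => T i ω) P) :
    IsPoissonProcessLaw (P.map fun ω => Measure.sum fun i => Measure.dirac (φ (X i ω, T i ω)))
      ((μ.prod κ).map φ) := by
  have hmX : Measurable fun ω => Measure.sum fun i => Measure.dirac (X i ω) :=
    measurable_measure_sum fun i => Measure.measurable_dirac.comp (hX i)
  have hmφ : Measurable fun ω => Measure.sum fun i => Measure.dirac (φ (X i ω, T i ω)) :=
    measurable_measure_sum fun i => Measure.measurable_dirac.comp (by fun_prop)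
  have := Measure.isProbabilityMeasure_map (μ := P) hmφ.aemeasurable
  refine isPoissonProcessLaw_of_lintegral_nexp fun f hf => ?_
  rw [lintegral_map (by fun_prop) hmφ]
  simp_rw [lintegral_sum_dirac hf]
  rw [IndepFun.lintegral_comp (h := fun x t => nexp (∑' i, f (φ (x i, t i)))) hXT (by fun_prop)
    (by fun_prop)
    (measurable_nexp.comp (Measurable.tsum fun i => hf.comp (hφ.comp (by fun_prop))))]
  -- Given the points, averaging over the marks replaces `f ∘ φ` by the `g` for which `exp (-g x)`
  -- is the mean of `exp (-f (φ (x, s)))` over `s ~ κ`. The Laplace functional of the points is then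
  -- applied to `g`.
  let g : E → ℝ≥0∞ := fun x => nlog (∫⁻ s, nexp (f (φ (x, s))) ∂κ)
  have hg : Measurable g := measurable_nlog.comp
    (measurable_nexp.comp (hf.comp hφ)).lintegral_prod_right'
  have h1 : ∀ ω, ∫⁻ ω', nexp (∑' i, f (φ (X i ω, T i ω'))) ∂P = nexp (∑' i, g (X i ω)) := by
    intro ω
    rw [lintegral_nexp_tsum (X := fun i ω' => f (φ (X i ω, T i ω')))
      (hind.comp (fun i t => f (φ (X i ω, t))) fun i => hf.comp (hφ.comp (by fun_prop)))
      fun i => hf.comp (hφ.comp (by fun_prop))]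
    congr 2 with i
    change _ = nlog (∫⁻ s, nexp (f (φ (X i ω, s))) ∂κ)
    rw [← hlaw i, lintegral_map (by fun_prop) (hT i)]
  simp_rw [h1]
  have h2 := hQ.lintegral_nexp hg
  rw [lintegral_map (by fun_prop) hmX] at h2
  simp_rw [lintegral_sum_dirac hg] at h2
  rw [h2, lintegral_map (by fun_prop) hφ, lintegral_prod _
    (by fun_prop)]
  congr 2 with x
  have hle : ∫⁻ s, nexp (f (φ (x, s))) ∂κ ≤ 1 :=
    (lintegral_mono fun _ => nexp_le_one _).trans (by simp)
  rw [nexp_nlog hle, lintegral_sub (by fun_prop)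
    (hle.trans_lt ENNReal.one_lt_top).ne (ae_of_all _ fun _ => nexp_le_one _)]
  simp

/-- The Laplace functional of a superposition of rounds with Poisson numbers of i.i.d. points. -/
lemma lintegral_nexp_rounds {P : Measure Ω} [IsProbabilityMeasure P] {C : ℕ → Ω → ℕ}
    {X : ℕ × ℕ → Ω → E} {c : ℝ≥0} {τ : ℕ → Measure E} [∀ k, IsProbabilityMeasure (τ k)]
    (hC : ∀ k, Measurable (C k)) (hX : ∀ p, Measurable (X p))
    (hlC : ∀ k, P.map (C k) = poissonMeasure c) (hlX : ∀ p, P.map (X p) = τ p.1)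
    (hiC : iIndepFun C P) (hiX : iIndepFun X P)
    (hCX : IndepFun (fun ω k => C k ω) (fun ω p => X p ω) P)
    {F : ℕ → E → ℝ≥0∞} (hF : ∀ k, Measurable (F k)) :
    ∫⁻ ω, nexp (∑' p : ℕ × ℕ, if p.2 < C p.1 ω then F p.1 (X p ω) else 0) ∂P =
      nexp (∑' k, c * ∫⁻ x, (1 - nexp (F k x)) ∂(τ k)) := by
  rw [IndepFun.lintegral_comp (h := fun (c : ℕ → ℕ) (x : ℕ × ℕ → E) =>
    nexp (∑' p : ℕ × ℕ, if p.2 < c p.1 then F p.1 (x p) else 0)) hCX (by fun_prop) (by fun_prop) ?_]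
  swap
  · refine measurable_nexp.comp (Measurable.tsum fun p => Measurable.ite ?_ ?_ measurable_const)
    · exact measurableSet_lt measurable_const (by fun_prop)
    · exact (hF p.1).comp (by fun_prop)
  -- Given `C`, the points of round `k` contribute `a k ^ C k`; averaging over `C k` evaluates the
  -- Poisson generating function at `a k`.
  let a : ℕ → ℝ≥0∞ := fun k => ∫⁻ x, nexp (F k x) ∂(τ k)
  have ha : ∀ k, a k ≤ 1 := fun k => (lintegral_mono fun _ => nexp_le_one _).trans (by simp)
  have h1 : ∀ ω, ∫⁻ ω', nexp (∑' p : ℕ × ℕ, if p.2 < C p.1 ω then F p.1 (X p ω') else 0) ∂P =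
      nexp (∑' k, C k ω * nlog (a k)) := by
    intro ω
    have hm : ∀ p : ℕ × ℕ, Measurable fun x => if p.2 < C p.1 ω then F p.1 x else 0 := by
      intro p
      split_ifs
      · exact hF p.1
      · exact measurable_const
    rw [lintegral_nexp_tsum
      (X := fun (p : ℕ × ℕ) ω' => if p.2 < C p.1 ω then F p.1 (X p ω') else 0)
      (hiX.comp (fun p x => if p.2 < C p.1 ω then F p.1 x else 0) hm)
      fun p => (hm p).comp (hX p), ENNReal.tsum_prod']
    congr 2 with k
    have h3 : ∀ i, nlog (∫⁻ ω', nexp (if i < C k ω then F k (X (k, i) ω') else 0) ∂P) =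
        if i ∈ Finset.range (C k ω) then nlog (a k) else 0 := by
      intro i
      simp only [Finset.mem_range]
      split_ifs with h
      · rw [← lintegral_map (f := fun x => nexp (F k x)) (by fun_prop) (hX (k, i)),
          hlX]
      · simp
    simp_rw [h3]
    rw [tsum_eq_sum (s := Finset.range (C k ω)) (by simp +contextual)]
    simp +contextual
  simp_rw [h1]
  rw [lintegral_nexp_tsum (X := fun k ω => C k ω * nlog (a k))
    (hiC.comp (fun k n => (n : ℝ≥0∞) * nlog (a k)) fun k => Measurable.of_discrete)
    fun k => (Measurable.of_discrete (f := fun n : ℕ => (n : ℝ≥0∞) * nlog (a k))).comp (hC k)]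
  congr 2 with k
  simp_rw [nexp_nat_mul, nexp_nlog (ha k)]
  rw [← lintegral_map (f := fun n => a k ^ n) Measurable.of_discrete (hC k), hlC,
    lintegral_pow_poissonMeasure _ (ha k), nlog_nexp, lintegral_sub (by fun_prop)
    ((ha k).trans_lt ENNReal.one_lt_top).ne (ae_of_all _ fun _ => nexp_le_one _)]
  simp [a]

end Marking

/-! ### Changes of variables, and the gamma process divided by gamma marks. -/

lemma lintegral_comp_mul_left {f : ℝ → ℝ≥0∞} (hf : Measurable f) {c : ℝ} (hc : 0 < c) :
    ∫⁻ x, f x = ENNReal.ofReal c * ∫⁻ x, f (c * x) := by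
  rw [← lintegral_map hf (measurable_const_mul c), Real.map_volume_mul_left hc.ne',
    lintegral_smul_measure, smul_eq_mul, ← mul_assoc, abs_of_pos (inv_pos.2 hc),
    ← ENNReal.ofReal_mul hc.le, mul_inv_cancel₀ hc.ne', ENNReal.ofReal_one, one_mul]

lemma setLIntegral_Ioi_comp_mul_left {f : ℝ → ℝ≥0∞} (hf : Measurable f) {c : ℝ} (hc : 0 < c) :
    ∫⁻ x in Set.Ioi 0, f x = ENNReal.ofReal c * ∫⁻ x in Set.Ioi 0, f (c * x) := by
  rw [← lintegral_indicator measurableSet_Ioi, ← lintegral_indicator measurableSet_Ioi,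
    lintegral_comp_mul_left (hf.indicator measurableSet_Ioi) hc]
  congr 2 with x
  simp [Set.indicator_apply, hc]

lemma setLIntegral_Ioi_comp_div (f : ℝ → ℝ≥0∞) {t : ℝ} (ht : 0 < t) :
    ∫⁻ x in Set.Ioi 0, f x = ∫⁻ u in Set.Ioi 0, ENNReal.ofReal (t / u ^ 2) * f (t / u) := by
  have himg : (fun u => t / u) '' Set.Ioi 0 = Set.Ioi 0 := by
    ext x
    constructor
    · rintro ⟨u, hu, rfl⟩
      exact div_pos ht hu
    · intro hx
      exact ⟨t / x, div_pos ht hx, div_div_cancel₀ ht.ne'⟩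
  conv_lhs => rw [← himg]
  have hder : ∀ u ∈ Set.Ioi (0 : ℝ),
      HasDerivWithinAt (fun u => t / u) (-t / u ^ 2) (Set.Ioi 0) u := by
    intro u hu
    have := ((hasDerivAt_const u t).div (hasDerivAt_id u) (Set.mem_Ioi.1 hu).ne').hasDerivWithinAt
      (s := Set.Ioi 0)
    simp only [id, zero_mul, mul_one, zero_sub] at this
    exact this
  have hinj : Set.InjOn (fun u => t / u) (Set.Ioi 0) := by
    intro x hx y hy h
    have hx' : x ≠ 0 := (Set.mem_Ioi.1 hx).ne'
    have hy' : y ≠ 0 := (Set.mem_Ioi.1 hy).ne'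
    simp only at h
    field_simp at h
    exact h.symm
  rw [lintegral_image_eq_lintegral_abs_deriv_mul measurableSet_Ioi hder hinj]
  refine setLIntegral_congr_fun measurableSet_Ioi fun u hu => ?_
  rw [neg_div, abs_neg, abs_of_pos (div_pos ht (pow_pos hu 2))]

lemma lintegral_gammaMeasure {a r : ℝ} {f : ℝ → ℝ≥0∞} (hf : Measurable f) :
    ∫⁻ x, f x ∂(gammaMeasure a r) = ∫⁻ x in Set.Ioi 0, gammaPDF a r x * f x := by
  have hm : Measurable (gammaPDF a r) := (measurable_gammaPDFReal a r).ennreal_ofReal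
  rw [gammaMeasure, lintegral_withDensity_eq_lintegral_mul _ hm hf]
  rw [Measure.restrict_congr_set (μ := volume) (Ioi_ae_eq_Ici (a := (0 : ℝ)))]
  refine (setLIntegral_eq_of_support_subset fun x hx => ?_).symm
  by_contra h
  exact hx (by simp [gammaPDF_of_neg (not_le.1 h)])

lemma map_div_gammaMeasure {a t : ℝ} (ht : 0 < t) :
    (gammaMeasure a 1).map (fun x => t / x) = volume.withDensity fun u =>
      ENNReal.ofReal (gammaPDFReal a 1 (t / u) * (t / u ^ 2)) := by
  have hm : Measurable fun u : ℝ => ENNReal.ofReal (gammaPDFReal a 1 (t / u) * (t / u ^ 2)) := by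
    fun_prop
  refine Measure.ext_of_lintegral _ fun f hf => ?_
  rw [lintegral_map hf (by fun_prop), lintegral_gammaMeasure (by fun_prop),
    setLIntegral_Ioi_comp_div _ ht, lintegral_withDensity_eq_lintegral_mul _ hm hf]
  -- The density vanishes off `(0, ∞)`: for `u < 0` because `t / u < 0`, and at `u = 0` because
  -- division by zero makes `t / u ^ 2` equal to `0`.
  have h0 : ∫⁻ u, ((fun u : ℝ => ENNReal.ofReal (gammaPDFReal a 1 (t / u) * (t / u ^ 2))) * f) u =
      ∫⁻ u in Set.Ioi 0,
        ((fun u : ℝ => ENNReal.ofReal (gammaPDFReal a 1 (t / u) * (t / u ^ 2))) * f) u := by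
    refine (setLIntegral_eq_of_support_subset ?_).symm
    intro u hu
    by_contra h
    refine hu ?_
    rcases (not_lt.1 (Set.mem_Ioi.not.1 h)).eq_or_lt with h | h
    · simp [h]
    · have : ¬ 0 ≤ t / u := not_le.2 (div_neg_of_pos_of_neg ht h)
      simp [gammaPDFReal, this]
  rw [h0]
  refine setLIntegral_congr_fun measurableSet_Ioi fun u hu => ?_
  have hu' : (0 : ℝ) < u := hu
  simp only [Pi.mul_apply]
  rw [div_div_cancel₀ ht.ne', ENNReal.ofReal_mul' (by positivity), gammaPDF]
  ring

section rates
variable {γ α d : ℝ}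

/-- Substituting `θ = s * u` for fixed `s`, the joint density of mark and quotient is `s c(s u)
b(s)`. If it factors as `k u * q u s` with `q u` of total mass `1`, integrating out the mark leaves
the rate `k`. -/
lemma setLIntegral_Ioi_div_eq {c b k : ℝ → ℝ≥0∞} {q : ℝ → ℝ → ℝ≥0∞} {H : ℝ → ℝ≥0∞}
    (hc : Measurable c) (hb : Measurable b) (hq : Measurable (Function.uncurry q))
    (hk : Measurable k) (hH : Measurable H)
    (h : ∀ s u, 0 < s → 0 < u → ENNReal.ofReal s * (c (s * u) * b s) = k u * q u s)
    (h1 : ∀ u, 0 < u → ∫⁻ s in Set.Ioi 0, q u s = 1) :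
    ∫⁻ θ in Set.Ioi 0, c θ * ∫⁻ s in Set.Ioi 0, b s * H (θ / s) =
      ∫⁻ u in Set.Ioi 0, k u * H u := by
  have h0 : ∀ θ, c θ * ∫⁻ s in Set.Ioi 0, b s * H (θ / s) =
      ∫⁻ s in Set.Ioi 0, c θ * (b s * H (θ / s)) := fun θ =>
    (lintegral_const_mul _ (by fun_prop)).symm
  simp_rw [h0]
  rw [lintegral_lintegral_swap (by fun_prop)]
  have h2 : ∀ s ∈ Set.Ioi (0:ℝ), ∫⁻ θ in Set.Ioi 0, c θ * (b s * H (θ / s)) =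
      ∫⁻ u in Set.Ioi 0, k u * H u * q u s := by
    intro s hs
    have hs' : 0 < s := hs
    rw [setLIntegral_Ioi_comp_mul_left (by fun_prop) hs', ← lintegral_const_mul _ (by fun_prop)]
    refine setLIntegral_congr_fun measurableSet_Ioi fun u hu => ?_
    rw [mul_div_cancel_left₀ _ hs'.ne', mul_right_comm _ (H u), ← h s u hs' hu]
    ring
  rw [setLIntegral_congr_fun measurableSet_Ioi h2, lintegral_lintegral_swap ?_]
  · refine setLIntegral_congr_fun measurableSet_Ioi fun u hu => ?_
    rw [lintegral_const_mul _ (f := q u) (hq.comp measurable_prodMk_left), h1 u hu, mul_one]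
  · exact (Measurable.mul (by fun_prop) (hq.comp measurable_swap)).aemeasurable

lemma lintegral_gammaProcessRate {lam : ℝ} {f : ℝ → ℝ≥0∞} (hf : Measurable f) :
    ∫⁻ θ, f θ ∂(gammaProcessRate γ lam d) = ∫⁻ θ in Set.Ioi 0, ENNReal.ofReal
      (γ * lam ^ (1 - d) / Real.Gamma (1 - d) * θ ^ (-1 - d) * Real.exp (-(lam * θ))) * f θ := by
  rw [gammaProcessRate, lintegral_withDensity_eq_lintegral_mul _ (by fun_prop) hf]
  rfl

lemma lintegral_betaPrimeProcessRate {f : ℝ → ℝ≥0∞} (hf : Measurable f) :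
    ∫⁻ θ, f θ ∂(betaPrimeProcessRate γ α d) = ∫⁻ θ in Set.Ioi 0, ENNReal.ofReal
      (γ * Real.Gamma (α + 1) / (Real.Gamma (1 - d) * Real.Gamma (α + d))
        * θ ^ (-1 - d) * (1 + θ) ^ (-α)) * f θ := by
  rw [betaPrimeProcessRate, lintegral_withDensity_eq_lintegral_mul _ (by fun_prop) hf]
  rfl

lemma measurable_gammaPDF_uncurry (a : ℝ) :
    Measurable (Function.uncurry fun u s : ℝ => gammaPDF a (1 + u) s) := by
  change Measurable fun p : ℝ × ℝ => ENNReal.ofReal (gammaPDFReal a (1 + p.1) p.2)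
  refine Measurable.ennreal_ofReal (Measurable.ite ?_ (by fun_prop) measurable_const)
  exact measurableSet_le measurable_const measurable_snd

/-- The powers of `s` collect to `s ^ (α - 1)` and the exponentials to `exp (-(1 + u) s)`, so the
conditional density of the mark is `Gam(α, 1 + u)`. Its normalising constant supplies `(1 + u) ^
(-α)`, and `α Γ(α) = Γ(α + 1)` supplies the constant of the rate. -/
lemma gamma_mixture_identity (hγ : 0 < γ) (hα : 0 < α) (hd0 : 0 ≤ d) (hd1 : d < 1) {s u : ℝ}
    (hs : 0 < s) (hu : 0 < u) :
    s * (γ * α * 1 ^ (1 - d) / Real.Gamma (1 - d) * (s * u) ^ (-1 - d) *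
      Real.exp (-(1 * (s * u))) *
      (1 ^ (α + d) / Real.Gamma (α + d) * s ^ (α + d - 1) * Real.exp (-(1 * s)))) =
    γ * Real.Gamma (α + 1) / (Real.Gamma (1 - d) * Real.Gamma (α + d))
      * u ^ (-1 - d) * (1 + u) ^ (-α) *
      ((1 + u) ^ α / Real.Gamma α * s ^ (α - 1) * Real.exp (-((1 + u) * s))) := by
  have hgΓ : 0 < Real.Gamma (1 - d) := Real.Gamma_pos_of_pos (by linarith)
  have hgΓ2 : 0 < Real.Gamma (α + d) := Real.Gamma_pos_of_pos (by linarith)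
  have hgΓ3 : 0 < Real.Gamma α := Real.Gamma_pos_of_pos (by linarith)
  rw [Real.Gamma_add_one hα.ne', Real.mul_rpow hs.le hu.le, Real.one_rpow, Real.one_rpow,
    Real.rpow_neg (by positivity)]
  have e1 : s * s ^ (-1 - d) * s ^ (α + d - 1) = s ^ (α - 1) := by
    nth_rw 1 [← Real.rpow_one s]
    rw [← Real.rpow_add hs, ← Real.rpow_add hs]
    congr 1
    ring
  have e2 : Real.exp (-(1 * (s * u))) * Real.exp (-(1 * s)) = Real.exp (-((1 + u) * s)) := by
    rw [← Real.exp_add]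
    congr 1
    ring
  rw [← e1, ← e2]
  have : (1 + u) ^ α ≠ 0 := by positivity
  generalize s ^ (-1 - d) = x1
  generalize s ^ (α + d - 1) = x2
  generalize u ^ (-1 - d) = x3
  generalize Real.exp (-(1 * (s * u))) = x4
  generalize Real.exp (-(1 * s)) = x5
  field_simp

lemma map_div_gammaProcessRate_prod (hγ : 0 < γ) (hα : 0 < α) (hd0 : 0 ≤ d) (hd1 : d < 1)
    {H : ℝ → ℝ≥0∞} (hH : Measurable H) :
    ∫⁻ θ, ∫⁻ s, H (θ / s) ∂(gammaMeasure (α + d) 1) ∂(gammaProcessRate (γ * α) 1 d) =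
      ∫⁻ u, H u ∂(betaPrimeProcessRate γ α d) := by
  have hm3 : Measurable (gammaPDF (α + d) 1) := (measurable_gammaPDFReal _ _).ennreal_ofReal
  have hgm := fun θ : ℝ => lintegral_gammaMeasure (a := α + d) (r := 1) (f := fun s => H (θ / s))
    (by fun_prop)
  simp_rw [hgm]
  have hm5 : Measurable fun θ => ∫⁻ s in Set.Ioi 0, gammaPDF (α + d) 1 s * H (θ / s) := by
    have hm6 : Measurable fun p : ℝ × ℝ => gammaPDF (α + d) 1 p.2 * H (p.1 / p.2) :=
      (hm3.comp measurable_snd).mul (hH.comp (measurable_fst.div measurable_snd))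
    exact hm6.lintegral_prod_right'
  rw [lintegral_gammaProcessRate hm5, lintegral_betaPrimeProcessRate hH]
  refine setLIntegral_Ioi_div_eq (by fun_prop) hm3 (measurable_gammaPDF_uncurry α) (by fun_prop) hH
    (fun s u hs hu => ?_) fun u hu => ?_
  · have hgΓ : 0 < Real.Gamma (1 - d) := Real.Gamma_pos_of_pos (by linarith)
    have hgΓ2 : 0 < Real.Gamma (α + d) := Real.Gamma_pos_of_pos (by linarith)
    have hgΓ3 : 0 < Real.Gamma (α + 1) := Real.Gamma_pos_of_pos (by linarith)
    rw [gammaPDF_of_nonneg hs.le, gammaPDF_of_nonneg hs.le, ← ENNReal.ofReal_mul (by positivity),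
      ← ENNReal.ofReal_mul hs.le, ← ENNReal.ofReal_mul (by positivity),
      gamma_mixture_identity hγ hα hd0 hd1 hs hu]
  · have h := lintegral_gammaMeasure (a := α) (r := 1 + u) (f := fun _ => 1) measurable_const
    have := isProbabilityMeasure_gammaMeasure hα (by linarith : 0 < 1 + u)
    simpa using h.symm

lemma map_gammaProcessRate_prod_prod {Ψ : Type*} [MeasurableSpace Ψ] (G : Measure Ψ) [SFinite G]
    (hγ : 0 < γ) (hα : 0 < α) (hd0 : 0 ≤ d) (hd1 : d < 1) :
    (((gammaProcessRate (γ * α) 1 d).prod G).prod (gammaMeasure (α + d) 1)).map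
      (fun p : (ℝ × Ψ) × ℝ => (p.1.1 / p.2, p.1.2)) = (betaPrimeProcessRate γ α d).prod G := by
  have := isProbabilityMeasure_gammaMeasure (by linarith : 0 < α + d) one_pos
  refine Measure.ext_of_lintegral _ fun f hf => ?_
  rw [lintegral_map hf (by fun_prop), lintegral_prod _ (by fun_prop), lintegral_prod _ ?_,
    lintegral_prod _ (by fun_prop)]
  swap
  · exact (Measurable.lintegral_prod_right'
      (f := fun p : (ℝ × Ψ) × ℝ => f (p.1.1 / p.2, p.1.2)) (by fun_prop)).aemeasurable
  rw [← map_div_gammaProcessRate_prod hγ hα hd0 hd1 hf.lintegral_prod_right']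
  refine lintegral_congr fun θ => ?_
  rw [lintegral_lintegral_swap]
  fun_prop

end rates

/-! ### From weighted points to the random measure on traits. -/

lemma measurable_traitsOfPoints {Ψ : Type*} [MeasurableSpace Ψ] :
    Measurable (traitsOfPoints : Measure (ℝ × Ψ) → Measure Ψ) := by
  refine (Measure.measurable_map _ measurable_snd).comp ?_
  refine Measure.measurable_of_measurable_coe _ fun s hs => ?_
  simp_rw [withDensity_apply _ hs, ← lintegral_indicator hs]
  exact Measure.measurable_lintegral (Measurable.indicator (by fun_prop) hs)

lemma traitsOfPoints_sum_dirac {ι Ψ : Type*} [MeasurableSpace Ψ] (θ : ι → ℝ) (ψ : ι → Ψ) :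
    traitsOfPoints (Measure.sum fun i => Measure.dirac (θ i, ψ i)) = weightedAtoms θ ψ := by
  ext s hs
  rw [traitsOfPoints, Measure.map_apply measurable_snd hs,
    withDensity_apply _ (measurable_snd hs), ← lintegral_indicator (measurable_snd hs),
    lintegral_sum_dirac (Measurable.indicator (by fun_prop) (measurable_snd hs)), weightedAtoms,
    Measure.sum_apply _ hs]
  refine tsum_congr fun i => ?_
  by_cases h : ψ i ∈ s <;> simp [h, hs]

/-- The gamma process is mapped to the beta prime process when its weights are divided by
independent gamma variables. -/
theorem isCRMAtoms_div {Ω Ψ : Type*} [MeasurableSpace Ω] [MeasurableSpace Ψ]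
    (P : Measure Ω) [IsProbabilityMeasure P] (G : Measure Ψ) [IsProbabilityMeasure G]
    {γ α d : ℝ} (hγ : 0 < γ) (hα : 0 < α) (hd0 : 0 ≤ d) (hd1 : d < 1)
    {θ : ℕ → Ω → ℝ} {ψ : ℕ → Ω → Ψ} {S : ℕ → Ω → ℝ}
    (hθ : ∀ k, Measurable (θ k)) (hψ : ∀ k, Measurable (ψ k)) (hS : ∀ k, Measurable (S k))
    (h : IsCRMAtoms P θ ψ (gammaProcessRate (γ * α) 1 d) G)
    (hlaw : ∀ k, P.map (S k) = gammaMeasure (α + d) 1) (hind : iIndepFun S P)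
    (hindep : IndepFun (fun ω k => (θ k ω, ψ k ω)) (fun ω k => S k ω) P) :
    IsCRMAtoms P (fun k ω => θ k ω / S k ω) ψ (betaPrimeProcessRate γ α d) G := by
  have := isProbabilityMeasure_gammaMeasure (by linarith : 0 < α + d) one_pos
  rw [IsCRMAtoms, ← map_gammaProcessRate_prod_prod G hγ hα hd0 hd1]
  exact isPoissonProcessLaw_marking (X := fun k ω => (θ k ω, ψ k ω)) (T := S)
    (φ := fun p : (ℝ × Ψ) × ℝ => (p.1.1 / p.2, p.1.2)) (by fun_prop) (by fun_prop) hS h hlaw hind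
    hindep

lemma IsCRMAtoms.isCRM {Ω Ψ ι : Type*} [Countable ι] [MeasurableSpace Ω] [MeasurableSpace Ψ]
    {P : Measure Ω} {θ : ι → Ω → ℝ} {ψ : ι → Ω → Ψ} {ν : Measure ℝ} {G : Measure Ψ}
    (hθ : ∀ k, Measurable (θ k)) (hψ : ∀ k, Measurable (ψ k)) (h : IsCRMAtoms P θ ψ ν G) :
    IsCRM P (fun ω => weightedAtoms (fun k => θ k ω) (fun k => ψ k ω)) ν G := by
  refine ⟨_, h, ?_⟩
  rw [Measure.map_map measurable_traitsOfPoints]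
  · congr 1 with ω : 1
    exact (traitsOfPoints_sum_dirac _ _).symm
  · exact measurable_measure_sum fun i => Measure.measurable_dirac.comp (by fun_prop)

/-! ### The mean measure of stick-breaking weights. -/

lemma measurable_betaPDF (a b : ℝ) : Measurable (betaPDF a b) :=
  (measurable_betaPDFReal a b).ennreal_ofReal

lemma lintegral_betaMeasure {a b : ℝ} {f : ℝ → ℝ≥0∞} (hf : Measurable f) :
    ∫⁻ x, f x ∂(betaMeasure a b) = ∫⁻ x, betaPDF a b x * f x := by
  rw [betaMeasure, lintegral_withDensity_eq_lintegral_mul _ (measurable_betaPDF a b) hf]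
  rfl

/-- The density `w⁻¹ Beta(w; 1 - d, a + d)` of the mean measure of the stick-breaking weights
with sticks `Beta(1 - d, a + (l + 1) d)`, `l = 0, 1, …`. -/
def stickPDF (a d w : ℝ) : ℝ≥0∞ :=
  ENNReal.ofReal (if 0 < w ∧ w < 1 then
    1 / beta (1 - d) (a + d) * w ^ (-1 - d) * (1 - w) ^ (a + d - 1) else 0)

@[fun_prop]
lemma measurable_stickPDF (a d : ℝ) : Measurable (stickPDF a d) :=
  (Measurable.ite measurableSet_Ioo (by fun_prop) (by fun_prop)).ennreal_ofReal

/-- The mean measure of the stick-breaking weights. -/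
def stickIntensity (a d : ℝ) : Measure ℝ := volume.withDensity (stickPDF a d)

instance (a d : ℝ) : SFinite (stickIntensity a d) := by unfold stickIntensity; infer_instance

lemma lintegral_stickIntensity {a d : ℝ} {f : ℝ → ℝ≥0∞} (hf : Measurable f) :
    ∫⁻ x, f x ∂(stickIntensity a d) = ∫⁻ x, stickPDF a d x * f x := by
  rw [stickIntensity, lintegral_withDensity_eq_lintegral_mul _ (measurable_stickPDF a d) hf]
  rfl

lemma stickPDF_of_notMem {a d w : ℝ} (h : ¬ (0 < w ∧ w < 1)) : stickPDF a d w = 0 := by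
  simp [stickPDF, h]

lemma betaPDF_of_notMem {a b w : ℝ} (h : ¬ (0 < w ∧ w < 1)) : betaPDF a b w = 0 := by
  simp [betaPDF_eq, h]

lemma stickPDF_of_mem {a d w : ℝ} (h : 0 < w ∧ w < 1) : stickPDF a d w =
    ENNReal.ofReal (1 / beta (1 - d) (a + d) * w ^ (-1 - d) * (1 - w) ^ (a + d - 1)) := by
  simp [stickPDF, h]

/-- For `d ≥ 0` the intensity has infinite mass near `0`; its version weighted by `w` is a
probability density, and serves wherever a finite measure is needed. -/
lemma ofReal_mul_stickPDF {a d : ℝ} (w : ℝ) :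
    stickPDF a d w * ENNReal.ofReal w = betaPDF (1 - d) (a + d) w := by
  by_cases h : 0 < w ∧ w < 1
  · rw [stickPDF_of_mem h, betaPDF_of_pos_lt_one h.1 h.2, ← ENNReal.ofReal_mul' h.1.le]
    congr 1
    have : w ^ (1 - d - 1) = w ^ (-1 - d) * w := by
      nth_rw 3 [← Real.rpow_one w]
      rw [← Real.rpow_add h.1]
      congr 1
      ring
    rw [this]
    ring
  · rw [stickPDF_of_notMem h, betaPDF_of_notMem h, zero_mul]

lemma lintegral_ofReal_stickIntensity {a d : ℝ} (hd1 : d < 1) (ha : 0 < a + d) :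
    ∫⁻ w, ENNReal.ofReal w ∂(stickIntensity a d) = 1 := by
  rw [lintegral_stickIntensity (by fun_prop)]
  simp_rw [ofReal_mul_stickPDF]
  exact lintegral_betaPDF_eq_one (by linarith) ha

/-- This is the integrand of the convolution below after `u = (1 - w) x`. The complement of `w / (1
- u)` becomes `(1 - w) (1 - x) / (1 - (1 - w) x)`, the powers of `1 - (1 - w) x` cancel, and a
`Beta(1 - d, a + 2 d)` density in `x` remains. -/
lemma stick_identity {a d w x : ℝ} (hw : 0 < w ∧ w < 1) (hx : 0 < x ∧ x < 1) :
    (1 - w) * (1 / beta (1 - d) (a + d) * ((1 - w) * x) ^ (1 - d - 1) *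
      (1 - (1 - w) * x) ^ (a + d - 1) * (1 / (1 - (1 - w) * x) *
      (1 / beta (1 - d) (a + d + d) * (w / (1 - (1 - w) * x)) ^ (-1 - d) *
        (1 - w / (1 - (1 - w) * x)) ^ (a + d + d - 1)))) =
    1 / beta (1 - d) (a + d) * w ^ (-1 - d) * (1 - w) ^ (a + d) *
      (1 / beta (1 - d) (a + d + d) * x ^ (1 - d - 1) * (1 - x) ^ (a + d + d - 1)) := by
  obtain ⟨hw0, hw1⟩ := hw
  obtain ⟨hx0, hx1⟩ := hx
  have hT : 0 < 1 - (1 - w) * x := by nlinarith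
  have hv : 0 < 1 - w := by linarith
  have hy : 0 < 1 - x := by linarith
  have e : 1 - w / (1 - (1 - w) * x) = (1 - w) * (1 - x) / (1 - (1 - w) * x) := by
    field_simp
    ring
  rw [e]
  generalize 1 - (1 - w) * x = T at *
  generalize 1 - w = v at *
  generalize 1 - x = y at *
  rw [Real.div_rpow (by positivity) hT.le, Real.div_rpow (by positivity) hT.le,
    Real.mul_rpow hv.le hx0.le, Real.mul_rpow hv.le hy.le]
  have e1 : v * v ^ (1 - d - 1) * v ^ (a + d + d - 1) = v ^ (a + d) := by
    nth_rw 1 [← Real.rpow_one v]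
    rw [← Real.rpow_add hv, ← Real.rpow_add hv]
    congr 1
    ring
  have e2 : T ^ (a + d - 1) = T * T ^ (-1 - d) * T ^ (a + d + d - 1) := by
    nth_rw 2 [← Real.rpow_one T]
    rw [← Real.rpow_add hT, ← Real.rpow_add hT]
    congr 1
    ring
  rw [← e1, e2]
  have h1 : T ^ (-1 - d) ≠ 0 := by positivity
  have h2 : T ^ (a + d + d - 1) ≠ 0 := by positivity
  generalize T ^ (-1 - d) = t1 at *
  generalize T ^ (a + d + d - 1) = t2 at *
  generalize v ^ (1 - d - 1) = t3
  generalize v ^ (a + d + d - 1) = t4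
  generalize x ^ (1 - d - 1) = t5
  generalize y ^ (a + d + d - 1) = t6
  generalize w ^ (-1 - d) = t7
  generalize 1 / beta (1 - d) (a + d) = t8
  generalize 1 / beta (1 - d) (a + d + d) = t9
  field_simp

/-- A weight is either the first stick `u`, or `1 - u` times a weight of the same kind with `a + d`
for `a`. The first case contributes the fraction `w` of the density on the right, the second the
fraction `1 - w`. -/
lemma stickPDF_convolution {a d : ℝ} (hd1 : d < 1) (hd0 : 0 ≤ d) (ha : 0 < a) (w : ℝ) :
    betaPDF (1 - d) (a + d) w + ∫⁻ u, betaPDF (1 - d) (a + d) u *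
      (ENNReal.ofReal (1 / (1 - u)) * stickPDF (a + d) d (w / (1 - u))) = stickPDF a d w := by
  by_cases hw : 0 < w ∧ w < 1
  · have hv : 0 < 1 - w := by linarith
    have hB : 0 < beta (1 - d) (a + d) := beta_pos (by linarith) (by linarith)
    have hB2 : 0 < beta (1 - d) (a + d + d) := beta_pos (by linarith) (by linarith)
    have key : ∀ x, ENNReal.ofReal (1 - w) * (betaPDF (1 - d) (a + d) ((1 - w) * x) *
        (ENNReal.ofReal (1 / (1 - (1 - w) * x)) * stickPDF (a + d) d (w / (1 - (1 - w) * x)))) =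
        ENNReal.ofReal (1 / beta (1 - d) (a + d) * w ^ (-1 - d) * (1 - w) ^ (a + d)) *
          betaPDF (1 - d) (a + d + d) x := by
      intro x
      by_cases hx : 0 < x ∧ x < 1
      · have hT : 0 < 1 - (1 - w) * x := by nlinarith
        have h1 : 0 < (1 - w) * x := mul_pos hv hx.1
        have h2 : w / (1 - (1 - w) * x) < 1 := by
          rw [div_lt_one hT]
          nlinarith
        have h3 : 0 < 1 - w / (1 - (1 - w) * x) := by linarith
        have h4 : 0 < 1 - x := by linarith
        rw [betaPDF_of_pos_lt_one h1 (by linarith), betaPDF_of_pos_lt_one hx.1 hx.2,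
          stickPDF_of_mem ⟨div_pos hw.1 hT, h2⟩, ← ENNReal.ofReal_mul (by positivity),
          ← ENNReal.ofReal_mul (by have := hw.1; positivity),
          ← ENNReal.ofReal_mul hv.le, ← ENNReal.ofReal_mul (by have := hw.1; positivity),
          stick_identity hw hx]
      · rw [betaPDF_of_notMem hx, mul_zero]
        -- For `x ≤ 0` the density of the first stick vanishes; for `x ≥ 1` either the rescaled
        -- weight is at least `1`, or the first stick is.
        rcases not_and_or.1 hx with h | h
        · rw [betaPDF_eq_zero_of_nonpos (by nlinarith)]
          simp
        · by_cases h5 : (1 - w) * x < 1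
          · have : 1 ≤ w / (1 - (1 - w) * x) := by
              rw [one_le_div (by linarith)]
              nlinarith
            rw [stickPDF_of_notMem (by simp [this])]
            simp
          · rw [betaPDF_eq_zero_of_one_le (by linarith)]
            simp
    have hm : Measurable (betaPDF (1 - d) (a + d)) := measurable_betaPDF _ _
    rw [lintegral_comp_mul_left (by fun_prop) hv, ← lintegral_const_mul _ (by fun_prop)]
    simp_rw [key]
    rw [lintegral_const_mul _ (measurable_betaPDF _ _),
      lintegral_betaPDF_eq_one (by linarith) (by linarith), mul_one,
      betaPDF_of_pos_lt_one hw.1 hw.2, stickPDF_of_mem hw,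
      ← ENNReal.ofReal_add (by have := hw.1; positivity) (by have := hw.1; positivity)]
    congr 1
    have e1 : w ^ (1 - d - 1) = w * w ^ (-1 - d) := by
      nth_rw 2 [← Real.rpow_one w]
      rw [← Real.rpow_add hw.1]
      congr 1
      ring
    have e2 : (1 - w) ^ (a + d) = (1 - w) * (1 - w) ^ (a + d - 1) := by
      nth_rw 2 [← Real.rpow_one (1 - w)]
      rw [← Real.rpow_add hv]
      congr 1
      ring
    rw [e1, e2]
    ring
  · rw [betaPDF_of_notMem hw, stickPDF_of_notMem hw, zero_add, lintegral_eq_zero_iff']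
    · refine ae_of_all _ fun u => ?_
      simp only [Pi.zero_apply]
      by_cases hu : 0 < u ∧ u < 1
      · have hu' : 0 < 1 - u := by linarith
        rw [stickPDF_of_notMem]
        · simp
        · rintro ⟨h1, h2⟩
          rw [div_lt_one hu'] at h2
          have := (div_pos_iff_of_pos_right hu').1 h1
          exact hw ⟨this, by linarith⟩
      · simp [betaPDF_of_notMem hu]
    · have hm : Measurable (betaPDF (1 - d) (a + d)) := measurable_betaPDF _ _
      fun_prop

/-- The mean measure of the stick-breaking weights, decomposed at the first stick. -/
lemma lintegral_stickIntensity_eq {a d : ℝ} (hd1 : d < 1) (hd0 : 0 ≤ d) (ha : 0 < a)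
    {f : ℝ → ℝ≥0∞} (hf : Measurable f) :
    ∫⁻ w, f w ∂(stickIntensity a d) = ∫⁻ u, f u ∂(betaMeasure (1 - d) (a + d)) +
      ∫⁻ u, ∫⁻ y, f ((1 - u) * y) ∂(stickIntensity (a + d) d) ∂(betaMeasure (1 - d) (a + d)) := by
  have hm : Measurable (betaPDF (1 - d) (a + d)) := measurable_betaPDF _ _
  have h1 : ∀ u, betaPDF (1 - d) (a + d) u * ∫⁻ y, f ((1 - u) * y) ∂(stickIntensity (a + d) d) =
      ∫⁻ w, betaPDF (1 - d) (a + d) u *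
        (ENNReal.ofReal (1 / (1 - u)) * stickPDF (a + d) d (w / (1 - u))) * f w := by
    intro u
    by_cases hu : 0 < u ∧ u < 1
    · have hu' : 0 < 1 - u := by linarith
      rw [lintegral_stickIntensity (by fun_prop),
        lintegral_comp_mul_left (by fun_prop) (one_div_pos.2 hu'),
        ← lintegral_const_mul _ (by fun_prop), ← lintegral_const_mul _ (by fun_prop)]
      refine lintegral_congr fun w => ?_
      have e1 : 1 / (1 - u) * w = w / (1 - u) := by ring
      rw [e1, mul_div_cancel₀ _ hu'.ne']
      ring
    · simp [betaPDF_of_notMem hu]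
  have hm2 : Measurable fun u => ∫⁻ y, f ((1 - u) * y) ∂(stickIntensity (a + d) d) :=
    Measurable.lintegral_prod_right' (f := fun p : ℝ × ℝ => f ((1 - p.1) * p.2)) (by fun_prop)
  rw [lintegral_betaMeasure hf, lintegral_betaMeasure hm2, lintegral_stickIntensity hf]
  simp_rw [h1]
  rw [lintegral_lintegral_swap (by fun_prop), ← lintegral_add_left (by fun_prop)]
  refine lintegral_congr fun w => ?_
  rw [lintegral_mul_const _ (by fun_prop), ← add_mul, stickPDF_convolution hd1 hd0 ha]

/-! ### The product in the truncation bound and its asymptotics. -/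

/-- The product `∏_{k=1}^K (1 + k d) / (2 + k d - d)`. -/
def stickProd (d : ℝ) (K : ℕ) : ℝ :=
  ∏ k ∈ Finset.Icc 1 K, (1 + (k : ℝ) * d) / (2 + (k : ℝ) * d - d)

/-- With `l = k - 1` each factor is the mean of `1 - U l` for `U l ~ Beta(1 - d, 1 + (l + 1) d)`. -/
lemma stickProd_eq_range (d : ℝ) (K : ℕ) : stickProd d K =
    ∏ l ∈ Finset.range K, (1 + ((l : ℝ) + 1) * d) / (2 + (l : ℝ) * d) := by
  induction K with
  | zero => simp [stickProd]
  | succ n ih =>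
    rw [stickProd, Finset.prod_Icc_succ_top (by omega), Finset.prod_range_succ, ← ih, stickProd]
    push_cast
    congr 2
    ring

/-- Dividing each factor by `d` gives a ratio of rising factorials starting at `1 / d + 1` and `2 /
d`. Euler's sequence has `K + 1` factors in its denominator: the extra `1 / d` at the bottom end is
absorbed by `GammaSeq (1 / d) K / d`, the extra `2 / d + K` at the top end by `1 + 2 / d / K`. -/
lemma stickProd_eq_GammaSeq {d : ℝ} (hd : 0 < d) {K : ℕ} (hK : K ≠ 0) :
    stickProd d K = Real.GammaSeq (2 / d) K / (Real.GammaSeq (1 / d) K / d) *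
      ((1 + 2 / d / K)) * (K : ℝ) ^ (1 - d⁻¹) := by
  have hK' : (0 : ℝ) < K := by positivity
  have h1 : stickProd d K = (∏ j ∈ Finset.range K, (1 / d + 1 + (j : ℝ))) /
      ∏ j ∈ Finset.range K, (2 / d + (j : ℝ)) := by
    rw [stickProd_eq_range, ← Finset.prod_div_distrib]
    refine Finset.prod_congr rfl fun j _ => ?_
    field_simp
    ring
  have h2 : ∏ j ∈ Finset.range (K + 1), (1 / d + (j : ℝ)) =
      (∏ j ∈ Finset.range K, (1 / d + 1 + (j : ℝ))) * (1 / d) := by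
    rw [Finset.prod_range_succ']
    push_cast
    rw [add_zero]
    congr 1
    refine Finset.prod_congr rfl fun j _ => ?_
    ring
  have h3 : ∏ j ∈ Finset.range (K + 1), (2 / d + (j : ℝ)) =
      (∏ j ∈ Finset.range K, (2 / d + (j : ℝ))) * (2 / d + K) := Finset.prod_range_succ _ _
  have h4 : ∏ j ∈ Finset.range K, (2 / d + (j : ℝ)) ≠ 0 :=
    (Finset.prod_pos fun j _ => by positivity).ne'
  have h5 : ∏ j ∈ Finset.range K, (1 / d + 1 + (j : ℝ)) ≠ 0 :=
    (Finset.prod_pos fun j _ => by positivity).ne'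
  rw [h1, Real.GammaSeq, Real.GammaSeq, h2, h3]
  have e : (K : ℝ) ^ (2 / d) * (K : ℝ) ^ (1 - d⁻¹) = (K : ℝ) ^ (1 / d) * K := by
    nth_rw 4 [← Real.rpow_one (K : ℝ)]
    rw [← Real.rpow_add hK', ← Real.rpow_add hK']
    congr 1
    field_simp
    ring
  have hf : (K.factorial : ℝ) ≠ 0 := by positivity
  have hr : (K : ℝ) ^ (1 / d) ≠ 0 := by positivity
  have hr2 : 2 / d + (K : ℝ) ≠ 0 := by positivity
  generalize (K.factorial : ℝ) = F at *
  generalize ∏ j ∈ Finset.range K, (2 / d + (j : ℝ)) = A at *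
  generalize ∏ j ∈ Finset.range K, (1 / d + 1 + (j : ℝ)) = B at *
  have : B / A = ((K : ℝ) ^ (2 / d) * (K : ℝ) ^ (1 - d⁻¹)) * (B / A) / ((K : ℝ) ^ (1 / d) * K) := by
    rw [e]
    field_simp
  rw [this]
  generalize (K : ℝ) ^ (1 / d) = x1 at *
  generalize (K : ℝ) ^ (2 / d) = x2 at *
  generalize (K : ℝ) ^ (1 - d⁻¹) = x3 at *
  field_simp
  ring

lemma stickProd_isEquivalent {d : ℝ} (hd0 : 0 ≤ d) :
    (fun K : ℕ => stickProd d K) ~[atTop] fun K : ℕ => if d = 0 then (2 : ℝ) ^ (-(K : ℝ))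
      else Real.Gamma (2 / d) / Real.Gamma ((1 + d) / d) * (K : ℝ) ^ (1 - d⁻¹) := by
  rcases hd0.eq_or_lt with rfl | hd
  · simp only [if_true]
    refine (EventuallyEq.of_eq ?_).isEquivalent
    ext K
    rw [Real.rpow_neg (by norm_num), Real.rpow_natCast]
    simp [stickProd, div_eq_mul_inv]
  · simp only [hd.ne', if_false]
    have hΓ : Real.Gamma ((1 + d) / d) = Real.Gamma (1 / d) / d := by
      rw [add_div, div_self hd.ne', Real.Gamma_add_one (by positivity)]
      ring
    have h0 : Real.Gamma (1 / d) ≠ 0 := (Real.Gamma_pos_of_pos (by positivity)).ne'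
    have h1 : Tendsto (fun K : ℕ => Real.GammaSeq (2 / d) K / (Real.GammaSeq (1 / d) K / d) *
        ((1 + 2 / d / K))) atTop (𝓝 (Real.Gamma (2 / d) / Real.Gamma ((1 + d) / d) * (1 + 0))) := by
      rw [hΓ]
      refine ((Real.GammaSeq_tendsto_Gamma _).div
        ((Real.GammaSeq_tendsto_Gamma _).div_const d) (by positivity)).mul
        (tendsto_const_nhds.add (tendsto_const_div_atTop_nhds_zero_nat _))
    rw [add_zero, mul_one] at h1
    have h2 : Real.Gamma (2 / d) / Real.Gamma ((1 + d) / d) ≠ 0 := by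
      have := Real.Gamma_pos_of_pos (by positivity : 0 < 2 / d)
      have := Real.Gamma_pos_of_pos (by positivity : 0 < (1 + d) / d)
      positivity
    refine IsEquivalent.congr_left (u := fun K : ℕ => (Real.GammaSeq (2 / d) K /
        (Real.GammaSeq (1 / d) K / d) * ((1 + 2 / d / K))) * (K : ℝ) ^ (1 - d⁻¹)) ?_ ?_
    · exact ((isEquivalent_const_iff_tendsto h2).2 h1).mul IsEquivalent.refl
    · filter_upwards [eventually_ne_atTop 0] with K hK using (stickProd_eq_GammaSeq hd hK).symm

lemma plTruncationBound_isEquivalent {γ α d : ℝ} (hd0 : 0 ≤ d) (N : ℕ) :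
    (fun K : ℕ => plTruncationBound γ α d N K) ~[atTop] fun K : ℕ =>
        γ * N * α / (α - 1) *
          (if d = 0 then (2 : ℝ) ^ (-(K : ℝ))
           else Real.Gamma (2 / d) / Real.Gamma ((1 + d) / d) * (K : ℝ) ^ (1 - d⁻¹)) := by
  have h : (fun K : ℕ => plTruncationBound γ α d N K) =
      fun K : ℕ => γ * N * α / (α - 1) * stickProd d K := by
    ext K
    rw [plTruncationBound, stickProd]
    ring
  rw [h]
  exact IsEquivalent.refl.mul (stickProd_isEquivalent hd0)

/-- This is the statement that the stick is used up in mean. For `0 < d < 1` it holds because the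
exponent `1 - d⁻¹` is negative. -/
lemma tendsto_stickProd {d : ℝ} (hd0 : 0 ≤ d) (hd1 : d < 1) :
    Tendsto (fun K : ℕ => stickProd d K) atTop (𝓝 0) := by
  refine (stickProd_isEquivalent hd0).symm.tendsto_nhds ?_
  split_ifs with h
  · simp_rw [Real.rpow_neg (by norm_num : (0:ℝ) ≤ 2), Real.rpow_natCast, ← inv_pow]
    exact tendsto_pow_atTop_nhds_zero_of_lt_one (by norm_num) (by norm_num)
  · have hd : 0 < d := lt_of_le_of_ne hd0 (Ne.symm h)
    have h1 : 0 < d⁻¹ - 1 := by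
      have := (one_lt_inv₀ hd).2 hd1
      linarith
    have := ((tendsto_rpow_neg_atTop h1).comp tendsto_natCast_atTop_atTop).const_mul
      (Real.Gamma (2 / d) / Real.Gamma ((1 + d) / d))
    simpa using this

/-! ### Exhausting the stick. -/

/-- Multiplying the `Beta(p, q)` density by `1 - u` gives `q / (p + q)` times the `Beta(p, q + 1)`
density. -/
lemma lintegral_one_sub_betaMeasure {p q : ℝ} (hp : 0 < p) (hq : 0 < q) :
    ∫⁻ u, ENNReal.ofReal (1 - u) ∂(betaMeasure p q) = ENNReal.ofReal (q / (p + q)) := by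
  rw [lintegral_betaMeasure (by fun_prop)]
  have hB : 0 < beta p q := beta_pos hp hq
  have hB1 : beta p (q + 1) = q / (p + q) * beta p q := by
    have h1 : 0 < Real.Gamma (p + q) := Real.Gamma_pos_of_pos (by positivity)
    rw [beta, beta, ← add_assoc, Real.Gamma_add_one hq.ne', Real.Gamma_add_one (by positivity)]
    field_simp
  have h : ∀ u, betaPDF p q u * ENNReal.ofReal (1 - u) =
      ENNReal.ofReal (q / (p + q)) * betaPDF p (q + 1) u := by
    intro u
    by_cases hu : 0 < u ∧ u < 1
    · have hu1 : 0 < 1 - u := by linarith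
      rw [betaPDF_of_pos_lt_one hu.1 hu.2, betaPDF_of_pos_lt_one hu.1 hu.2,
        ← ENNReal.ofReal_mul' hu1.le, ← ENNReal.ofReal_mul (by positivity)]
      congr 1
      rw [hB1, add_sub_cancel_right]
      have : (1 - u) ^ q = (1 - u) ^ (q - 1) * (1 - u) := by
        nth_rw 3 [← Real.rpow_one (1 - u)]
        rw [← Real.rpow_add hu1]
        congr 1
        ring
      rw [this]
      field_simp
    · rw [betaPDF_of_notMem hu, betaPDF_of_notMem hu, zero_mul, mul_zero]
  simp_rw [h]
  rw [lintegral_const_mul _ (measurable_betaPDF _ _), lintegral_betaPDF_eq_one hp (by linarith),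
    mul_one]

lemma ae_betaMeasure_mem (p q : ℝ) : ∀ᵐ u ∂(betaMeasure p q), 0 < u ∧ u < 1 := by
  rw [betaMeasure, ae_withDensity_iff (measurable_betaPDF p q)]
  refine ae_of_all _ fun u hu => ?_
  by_contra h
  exact hu (betaPDF_of_notMem h)

section Sticks
variable {Ω : Type*} [MeasurableSpace Ω] {P : Measure Ω} {U : ℕ → Ω → ℝ} {a d : ℝ}

lemma ae_mem_Ioo_of_law {X : Ω → ℝ} {p q : ℝ} (hX : Measurable X)
    (hlaw : P.map X = betaMeasure p q) : ∀ᵐ ω ∂P, 0 < X ω ∧ X ω < 1 :=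
  ae_of_ae_map hX.aemeasurable (hlaw ▸ ae_betaMeasure_mem p q)

/-- Expectations over the first `K` stick-breaking weights. -/
lemma sum_lintegral_sticks (hU : ∀ l, Measurable (U l)) (hind : iIndepFun U P) (hd0 : 0 ≤ d)
    (hd1 : d < 1) (ha : 0 < a)
    (hlaw : ∀ l : ℕ, P.map (U l) = betaMeasure (1 - d) (a + ((l : ℝ) + 1) * d))
    {f : ℝ → ℝ≥0∞} (hf : Measurable f) (K : ℕ) :
    ∑ k ∈ Finset.range K, ∫⁻ ω, f (U k ω * ∏ l ∈ Finset.range k, (1 - U l ω)) ∂P +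
      ∫⁻ ω, ∫⁻ y, f ((∏ l ∈ Finset.range K, (1 - U l ω)) * y) ∂(stickIntensity (a + K * d) d) ∂P =
      ∫⁻ w, f w ∂(stickIntensity a d) := by
  have := hind.isProbabilityMeasure
  induction K with
  | zero => simp
  | succ K ih =>
    rw [← ih, Finset.sum_range_succ, add_assoc]
    congr 1
    let R : Ω → ℝ := fun ω => ∏ l ∈ Finset.range K, (1 - U l ω)
    have hR : Measurable R := by fun_prop
    have hRU : IndepFun R (U K) P := by
      have h1 := (hind.comp (fun _ x => 1 - x) fun _ => by fun_prop).indepFun_finsetProd_of_notMem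
        (fun i => by fun_prop) (s := Finset.range K) (i := K) (by simp)
      have h2 := h1.comp (φ := id) (ψ := fun x => 1 - x) measurable_id (by fun_prop)
      convert h2 using 1
      · ext ω; simp [R]
      · ext ω; simp
    have hmf : ∀ b, Measurable (Function.uncurry fun r u : ℝ =>
        ∫⁻ y, f (r * (1 - u) * y) ∂(stickIntensity b d)) := fun b =>
      Measurable.lintegral_prod_right' (f := fun p : (ℝ × ℝ) × ℝ => f (p.1.1 * (1 - p.1.2) * p.2))
        (by fun_prop)
    -- The one-step decomposition at parameter `a + K d`, rescaled by the current remainder `r`: the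
    -- next weight is `r * U K`, and `r * (1 - U K)` is left for a measure with parameter `a + (K +
    -- 1) d`.
    have h1 : ∀ r : ℝ, ∫⁻ y, f (r * y) ∂(stickIntensity (a + K * d) d) =
        ∫⁻ ω, f (r * U K ω) ∂P +
          ∫⁻ ω, ∫⁻ y, f (r * (1 - U K ω) * y) ∂(stickIntensity (a + (K + 1 : ℕ) * d) d) ∂P := by
      intro r
      have e : a + K * d + d = a + (K + 1 : ℕ) * d := by push_cast; ring
      have e2 : a + K * d + d = a + ((K : ℝ) + 1) * d := by ring
      rw [lintegral_stickIntensity_eq hd1 hd0 (by positivity) (f := fun y => f (r * y))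
        (by fun_prop), e2, ← hlaw K, lintegral_map (by fun_prop) (hU K), ← e2, e,
        lintegral_map _ (hU K)]
      · simp_rw [mul_assoc]
      · have := (hmf (a + (K + 1 : ℕ) * d)).comp (measurable_prodMk_left (x := r))
        simpa only [mul_assoc, Function.comp_def, Function.uncurry_apply_pair] using this
    have h2 : ∫⁻ ω, f (U K ω * ∏ l ∈ Finset.range K, (1 - U l ω)) ∂P =
        ∫⁻ ω, ∫⁻ ω', f (R ω * U K ω') ∂P ∂P := by
      rw [← IndepFun.lintegral_comp (h := fun r u => f (r * u)) hRU hR (hU K) (by fun_prop)]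
      refine lintegral_congr fun ω => ?_
      rw [mul_comm]
    have h3 : ∫⁻ ω, ∫⁻ y, f ((∏ l ∈ Finset.range (K + 1), (1 - U l ω)) * y)
          ∂(stickIntensity (a + (K + 1 : ℕ) * d) d) ∂P =
        ∫⁻ ω, ∫⁻ ω', ∫⁻ y, f (R ω * (1 - U K ω') * y)
          ∂(stickIntensity (a + (K + 1 : ℕ) * d) d) ∂P ∂P := by
      rw [← IndepFun.lintegral_comp (h := fun r u => ∫⁻ y, f (r * (1 - u) * y)
          ∂(stickIntensity (a + (K + 1 : ℕ) * d) d)) hRU hR (hU K) (hmf _)]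
      simp_rw [Finset.prod_range_succ]
      rfl
    rw [h2, h3]
    simp_rw [h1]
    rw [lintegral_add_left]
    exact (Measurable.lintegral_prod_right' (f := fun p : ℝ × Ω => f (p.1 * U K p.2))
      (by fun_prop)).comp hR

lemma lintegral_remaining_stick (hU : ∀ l, Measurable (U l)) (hind : iIndepFun U P) (hd0 : 0 ≤ d)
    (hd1 : d < 1) (hlaw : ∀ l : ℕ, P.map (U l) = betaMeasure (1 - d) (1 + ((l : ℝ) + 1) * d))
    (K : ℕ) :
    ∫⁻ ω, ENNReal.ofReal (∏ l ∈ Finset.range K, (1 - U l ω)) ∂P = ENNReal.ofReal (stickProd d K) := by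
  have h1 : ∀ᵐ ω ∂P, ∀ l, 0 < U l ω ∧ U l ω < 1 :=
    ae_all_iff.2 fun l => ae_mem_Ioo_of_law (hU l) (hlaw l)
  have h2 : ∫⁻ ω, ENNReal.ofReal (∏ l ∈ Finset.range K, (1 - U l ω)) ∂P =
      ∫⁻ ω, ∏ l ∈ Finset.range K, ENNReal.ofReal (1 - U l ω) ∂P := by
    refine lintegral_congr_ae (h1.mono fun ω hω => ?_)
    exact ENNReal.ofReal_prod_of_nonneg fun l _ => by linarith [(hω l).2]
  rw [h2, lintegral_prod_eq_prod_lintegral_of_indepFun _ (fun l ω => ENNReal.ofReal (1 - U l ω))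
    (hind.comp (fun _ x => ENNReal.ofReal (1 - x)) fun _ => by fun_prop) fun i => by fun_prop,
    stickProd_eq_range, ENNReal.ofReal_prod_of_nonneg fun l _ => by positivity]
  refine Finset.prod_congr rfl fun l _ => ?_
  rw [← lintegral_map (f := fun u => ENNReal.ofReal (1 - u)) (by fun_prop) (hU l), hlaw,
    lintegral_one_sub_betaMeasure (by linarith) (by positivity)]
  congr 2
  ring

/-- The decomposition for `f w = w`: the intensity weighted by `w` has mass `1` at every stage, so
the remainder term is just the mean of the remaining stick. -/
lemma lintegral_ofReal_sticks (hU : ∀ l, Measurable (U l)) (hind : iIndepFun U P) (hd0 : 0 ≤ d)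
    (hd1 : d < 1) (hlaw : ∀ l : ℕ, P.map (U l) = betaMeasure (1 - d) (1 + ((l : ℝ) + 1) * d))
    (K : ℕ) :
    ∑ k ∈ Finset.range K,
      ∫⁻ ω, ENNReal.ofReal (U k ω * ∏ l ∈ Finset.range k, (1 - U l ω)) ∂P +
      ENNReal.ofReal (stickProd d K) = 1 := by
  rw [← lintegral_remaining_stick hU hind hd0 hd1 hlaw,
    ← lintegral_ofReal_stickIntensity (a := 1) hd1 (by linarith),
    ← sum_lintegral_sticks hU hind hd0 hd1 one_pos hlaw (f := ENNReal.ofReal) (by fun_prop) K]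
  congr 1
  have h1 : ∀ᵐ ω ∂P, ∀ l, 0 < U l ω ∧ U l ω < 1 :=
    ae_all_iff.2 fun l => ae_mem_Ioo_of_law (hU l) (hlaw l)
  refine lintegral_congr_ae (h1.mono fun ω hω => ?_)
  have hR : 0 ≤ ∏ l ∈ Finset.range K, (1 - U l ω) :=
    Finset.prod_nonneg fun l _ => by linarith [(hω l).2]
  simp_rw [ENNReal.ofReal_mul hR]
  rw [lintegral_const_mul _ (by fun_prop), lintegral_ofReal_stickIntensity hd1 (by positivity),
    mul_one]

lemma tsum_lintegral_ofReal_sticks_le (hU : ∀ l, Measurable (U l)) (hind : iIndepFun U P)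
    (hd0 : 0 ≤ d) (hd1 : d < 1)
    (hlaw : ∀ l : ℕ, P.map (U l) = betaMeasure (1 - d) (1 + ((l : ℝ) + 1) * d)) (K : ℕ) :
    ∑' k, (if K ≤ k then
      ∫⁻ ω, ENNReal.ofReal (U k ω * ∏ l ∈ Finset.range k, (1 - U l ω)) ∂P else 0) ≤
      ENNReal.ofReal (stickProd d K) := by
  set x : ℕ → ℝ≥0∞ := fun k =>
    ∫⁻ ω, ENNReal.ofReal (U k ω * ∏ l ∈ Finset.range k, (1 - U l ω)) ∂P
  have h := lintegral_ofReal_sticks hU hind hd0 hd1 hlaw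
  refine ENNReal.tsum_le_of_sum_range_le fun M => ?_
  -- Both blocks of weights are disjoint and lie among the first `max K M`, whose expected total is
  -- at most `1`. Cancelling the finite sum of the first `K` leaves the tail.
  have h1 : ∑ k ∈ Finset.range K, x k + ∑ k ∈ Finset.range M, (if K ≤ k then x k else 0) ≤
      ∑ k ∈ Finset.range K, x k + ENNReal.ofReal (stickProd d K) := by
    rw [h K, ← h (max K M)]
    refine le_add_right ?_
    rw [← Finset.sum_filter, ← Finset.sum_union]
    · refine Finset.sum_le_sum_of_subset fun k => ?_
      simp only [Finset.mem_union, Finset.mem_range, Finset.mem_filter, lt_max_iff]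
      tauto
    · rw [Finset.disjoint_left]
      simp only [Finset.mem_range, Finset.mem_filter]
      omega
  refine (ENNReal.add_le_add_iff_left ?_).1 h1
  intro h'
  have h2 : ∑ k ∈ Finset.range K, x k + ENNReal.ofReal (stickProd d K) = 1 := h K
  rw [h'] at h2
  simp at h2

/-- The mean measure of the stick-breaking weights. -/
lemma sum_map_sticks (hU : ∀ l, Measurable (U l)) (hind : iIndepFun U P) (hd0 : 0 ≤ d)
    (hd1 : d < 1) (hlaw : ∀ l : ℕ, P.map (U l) = betaMeasure (1 - d) (1 + ((l : ℝ) + 1) * d)) :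
    (Measure.sum fun k => P.map fun ω => U k ω * ∏ l ∈ Finset.range k, (1 - U l ω)) =
      stickIntensity 1 d := by
  set m := Measure.sum fun k => P.map fun ω => U k ω * ∏ l ∈ Finset.range k, (1 - U l ω) with hm
  have hint : ∀ f : ℝ → ℝ≥0∞, Measurable f → ∫⁻ w, f w ∂m =
      ∑' k, ∫⁻ ω, f (U k ω * ∏ l ∈ Finset.range k, (1 - U l ω)) ∂P := by
    intro f hf
    rw [hm, lintegral_sum_measure]
    exact tsum_congr fun k => lintegral_map hf (by fun_prop)
  -- Dropping the nonnegative remainder term gives one inequality between the two measures.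
  have hle : ∀ f : ℝ → ℝ≥0∞, Measurable f → ∫⁻ w, f w ∂m ≤ ∫⁻ w, f w ∂(stickIntensity 1 d) := by
    intro f hf
    rw [hint f hf]
    refine ENNReal.tsum_le_of_sum_range_le fun K => ?_
    rw [← sum_lintegral_sticks hU hind hd0 hd1 one_pos hlaw hf K]
    exact le_self_add
  have hone : ∫⁻ w, ENNReal.ofReal w ∂m = 1 := by
    rw [hint _ (by fun_prop)]
    have h1 := ENNReal.tendsto_nat_tsum fun k =>
      ∫⁻ ω, ENNReal.ofReal (U k ω * ∏ l ∈ Finset.range k, (1 - U l ω)) ∂P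
    have h2 := h1.add (ENNReal.tendsto_ofReal (tendsto_stickProd hd0 hd1))
    simp_rw [lintegral_ofReal_sticks hU hind hd0 hd1 hlaw] at h2
    simpa using (tendsto_nhds_unique h2 tendsto_const_nhds)
  have hpos1 : ∀ᵐ w ∂(stickIntensity 1 d), ENNReal.ofReal w ≠ 0 := by
    rw [stickIntensity, ae_withDensity_iff (measurable_stickPDF 1 d)]
    refine ae_of_all _ fun w hw => ?_
    by_contra h
    rw [ENNReal.ofReal_eq_zero] at h
    exact hw (stickPDF_of_notMem (by simp [h]))
  have hmle : m ≤ stickIntensity 1 d := by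
    refine Measure.le_iff.2 fun s hs => ?_
    simpa [lintegral_indicator_one hs] using hle (s.indicator 1) (measurable_one.indicator hs)
  have hpos2 : ∀ᵐ w ∂m, ENNReal.ofReal w ≠ 0 := Measure.absolutelyContinuous_of_le hmle hpos1
  -- An inequality between measures of equal total mass is an equality only if the mass is finite,
  -- hence the weighting by `w`, after which both masses are `1`. Both measures live on `w > 0`, so
  -- the weight can be divided out again.
  have heq : m.withDensity (fun w => ENNReal.ofReal w) =
      (stickIntensity 1 d).withDensity fun w => ENNReal.ofReal w := by
    have : IsFiniteMeasure (m.withDensity fun w => ENNReal.ofReal w) :=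
      isFiniteMeasure_withDensity (by simp [hone])
    refine Measure.eq_of_le_of_measure_univ_eq ?_ ?_
    · refine Measure.le_iff.2 fun s hs => ?_
      rw [withDensity_apply _ hs, withDensity_apply _ hs, ← lintegral_indicator hs,
        ← lintegral_indicator hs]
      exact hle _ (Measurable.indicator (by fun_prop) hs)
    · simp [hone, lintegral_ofReal_stickIntensity (a := 1) hd1 (by linarith)]
  rw [← withDensity_inv_same (μ := m) (f := fun w => ENNReal.ofReal w) (by fun_prop) hpos2
    (by simp), heq, withDensity_inv_same (by fun_prop) hpos1 (by simp)]

end Sticks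

/-! ### The beta prime rate as a mixture over stick weights. -/

lemma lintegral_betaPrimeMeasure {a b : ℝ} {f : ℝ → ℝ≥0∞} (hf : Measurable f) :
    ∫⁻ v, f v ∂(betaPrimeMeasure a b) = ∫⁻ v in Set.Ioi 0,
      ENNReal.ofReal (v ^ (a - 1) * (1 + v) ^ (-a - b) / beta a b) * f v := by
  rw [betaPrimeMeasure, lintegral_withDensity_eq_lintegral_mul _ (by fun_prop) hf]
  rfl

/-- The substitution `w = s t / (1 + t - s)` is the one for which `1 + t / w = (1 + t) / s`, so that
the beta prime density at `t / w` becomes a power of `s`. -/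
lemma image_moebius_Ioo {t : ℝ} (ht : 0 < t) :
    (fun s => s * t / (1 + t - s)) '' Set.Ioo 0 1 = Set.Ioo 0 1 := by
  ext w
  constructor
  · rintro ⟨s, ⟨hs0, hs1⟩, rfl⟩
    have : 0 < 1 + t - s := by linarith
    refine ⟨by positivity, ?_⟩
    simp only
    rw [div_lt_one this]
    nlinarith
  · rintro ⟨hw0, hw1⟩
    refine ⟨w * (1 + t) / (w + t), ⟨by positivity, ?_⟩, ?_⟩
    · rw [div_lt_one (by positivity)]
      nlinarith
    · have h1 : 1 + t - w * (1 + t) / (w + t) = t * (1 + t) / (w + t) := by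
        field_simp
        ring
      simp only [h1]
      field_simp

lemma setLIntegral_Ioo_comp_moebius (f : ℝ → ℝ≥0∞) {t : ℝ} (ht : 0 < t) :
    ∫⁻ w in Set.Ioo 0 1, f w = ∫⁻ s in Set.Ioo 0 1,
      ENNReal.ofReal (t * (1 + t) / (1 + t - s) ^ 2) * f (s * t / (1 + t - s)) := by
  conv_lhs => rw [← image_moebius_Ioo ht]
  have hder : ∀ s ∈ Set.Ioo (0 : ℝ) 1, HasDerivWithinAt (fun s => s * t / (1 + t - s))
      (t * (1 + t) / (1 + t - s) ^ 2) (Set.Ioo 0 1) s := by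
    intro s hs
    have hT : 1 + t - s ≠ 0 := by linarith [hs.2]
    have := (((hasDerivAt_id s).mul_const t).div ((hasDerivAt_id s).const_sub (1 + t))
      hT).hasDerivWithinAt (s := Set.Ioo 0 1)
    refine this.congr_deriv ?_
    simp only [id]
    ring
  have hinj : Set.InjOn (fun s => s * t / (1 + t - s)) (Set.Ioo 0 1) := by
    intro x hx y hy h
    have hx' : 1 + t - x ≠ 0 := by linarith [hx.2]
    have hy' : 1 + t - y ≠ 0 := by linarith [hy.2]
    simp only at h
    rw [div_eq_div_iff hx' hy'] at h
    have h2 : (x - y) * (t * (1 + t)) = 0 := by linarith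
    rcases mul_eq_zero.1 h2 with h3 | h3
    · linarith
    · exact absurd h3 (by positivity)
  rw [lintegral_image_eq_lintegral_abs_deriv_mul measurableSet_Ioo hder hinj]
  refine setLIntegral_congr_fun measurableSet_Ioo fun s hs => ?_
  have hT : 0 < 1 + t - s := by linarith [hs.2]
  rw [abs_of_pos (by positivity)]

/-- Here `1 - w = (1 + t) (1 - s) / (1 + t - s)`. The powers of `1 + t - s` cancel, those of `1 + t`
collect to `(1 + t) ^ (-α)`, and those of `s` and `1 - s` form a `Beta(α, 1 + d)` density. -/
lemma betaPrime_mixture_identity {α d s t : ℝ} (hα : 0 < α) (hd0 : 0 ≤ d) (hd1 : d < 1)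
    (hs : 0 < s ∧ s < 1) (ht : 0 < t) {γ : ℝ} :
    γ * α * (t * (1 + t) / (1 + t - s) ^ 2 *
      (1 / beta (1 - d) (1 + d) * (s * t / (1 + t - s)) ^ (-1 - d) *
        (1 - s * t / (1 + t - s)) ^ (1 + d - 1) *
      (1 / (s * t / (1 + t - s)) * ((t / (s * t / (1 + t - s))) ^ ((1 : ℝ) - 1) *
        (1 + t / (s * t / (1 + t - s))) ^ (-1 - (α + d)) / beta 1 (α + d))))) =
    γ * Real.Gamma (α + 1) / (Real.Gamma (1 - d) * Real.Gamma (α + d))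
      * t ^ (-1 - d) * (1 + t) ^ (-α) *
      (1 / beta α (1 + d) * s ^ (α - 1) * (1 - s) ^ (1 + d - 1)) := by
  obtain ⟨hs0, hs1⟩ := hs
  have hT : 0 < 1 + t - s := by linarith
  have hy : 0 < 1 - s := by linarith
  have hA : 0 < 1 + t := by linarith
  have e1 : 1 - s * t / (1 + t - s) = (1 + t) * (1 - s) / (1 + t - s) := by
    field_simp
    ring
  have e2 : 1 + t / (s * t / (1 + t - s)) = (1 + t) / s := by
    field_simp
    ring
  rw [e1, e2]
  generalize 1 + t - s = T at *
  generalize 1 - s = y at *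
  generalize 1 + t = A at *
  rw [sub_self, Real.rpow_zero, Real.div_rpow (by positivity) hT.le,
    Real.div_rpow (by positivity) hT.le, Real.div_rpow hA.le hs0.le,
    Real.mul_rpow hs0.le ht.le, Real.mul_rpow hA.le hy.le]
  have f1 : s ^ (-1 - d) = s ^ (α - 1) * s * s ^ (-1 - (α + d)) := by
    nth_rw 3 [← Real.rpow_one s]
    rw [← Real.rpow_add hs0, ← Real.rpow_add hs0]
    congr 1
    ring
  have f2 : T * T ^ (-1 - d) * T ^ (1 + d - 1) = 1 := by
    nth_rw 1 [← Real.rpow_one T]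
    rw [← Real.rpow_add hT, ← Real.rpow_add hT, ← Real.rpow_zero T]
    congr 1
    ring
  have f3 : A ^ (-α) = A * A ^ (1 + d - 1) * A ^ (-1 - (α + d)) := by
    nth_rw 2 [← Real.rpow_one A]
    rw [← Real.rpow_add hA, ← Real.rpow_add hA]
    congr 1
    ring
  rw [f1, f3]
  have g1 : 0 < Real.Gamma (1 - d) := Real.Gamma_pos_of_pos (by linarith)
  have g2 : 0 < Real.Gamma (α + d) := Real.Gamma_pos_of_pos (by linarith)
  have g3 : 0 < Real.Gamma α := Real.Gamma_pos_of_pos (by linarith)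
  have g4 : 0 < Real.Gamma (1 + d) := Real.Gamma_pos_of_pos (by linarith)
  have hb1 : beta (1 - d) (1 + d) = Real.Gamma (1 - d) * Real.Gamma (1 + d) := by
    rw [beta, sub_add_add_cancel, one_add_one_eq_two, Real.Gamma_two, div_one]
  have hb2 : beta 1 (α + d) = 1 / (α + d) := by
    rw [beta, Real.Gamma_one, add_comm 1, Real.Gamma_add_one (by positivity)]
    field_simp
  have hb3 : beta α (1 + d) = Real.Gamma α * Real.Gamma (1 + d) /
      ((α + d) * Real.Gamma (α + d)) := by
    rw [beta, ← Real.Gamma_add_one (by positivity)]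
    ring_nf
  rw [hb1, hb2, hb3, Real.Gamma_add_one hα.ne']
  have i1 : s ^ (-1 - (α + d)) ≠ 0 := by positivity
  have i2 : T ^ (-1 - d) ≠ 0 := by positivity
  have i3 : T ^ (1 + d - 1) ≠ 0 := by positivity
  generalize s ^ (-1 - (α + d)) = x1 at *
  generalize T ^ (-1 - d) = x2 at *
  generalize T ^ (1 + d - 1) = x3 at *
  generalize A ^ (1 + d - 1) = x4
  generalize A ^ (-1 - (α + d)) = x5
  generalize s ^ (α - 1) = x6
  generalize t ^ (-1 - d) = x7
  generalize y ^ (1 + d - 1) = x8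
  have hα' : α + d ≠ 0 := by positivity
  generalize Real.Gamma (1 - d) = y1 at *
  generalize Real.Gamma (1 + d) = y2 at *
  generalize Real.Gamma α = y3 at *
  generalize Real.Gamma (α + d) = y4 at *
  have hx3 : x3 = 1 / (T * x2) := by
    field_simp
    linarith
  rw [hx3]
  field_simp

/-- The integral over `w` is the density at `t` of the product `v * w`. In the variable `s` it is
the beta prime rate times a beta density of total mass `1`. -/
lemma betaPrime_mixture_density {γ α d t : ℝ} (hγ : 0 < γ) (hα : 0 < α) (hd0 : 0 ≤ d)
    (hd1 : d < 1) (ht : 0 < t) :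
    ENNReal.ofReal (γ * α) * ∫⁻ w, stickPDF 1 d w * (ENNReal.ofReal (1 / w) *
      ENNReal.ofReal ((t / w) ^ ((1 : ℝ) - 1) * (1 + t / w) ^ (-1 - (α + d)) / beta 1 (α + d))) =
    ENNReal.ofReal (γ * Real.Gamma (α + 1) / (Real.Gamma (1 - d) * Real.Gamma (α + d))
      * t ^ (-1 - d) * (1 + t) ^ (-α)) := by
  have hb : 0 < beta 1 (α + d) := beta_pos one_pos (by linarith)
  have hb2 : 0 < beta (1 - d) (1 + d) := beta_pos (by linarith) (by linarith)
  have g1 : 0 < Real.Gamma (1 - d) := Real.Gamma_pos_of_pos (by linarith)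
  have g2 : 0 < Real.Gamma (α + d) := Real.Gamma_pos_of_pos (by linarith)
  have g3 : 0 < Real.Gamma (α + 1) := Real.Gamma_pos_of_pos (by linarith)
  have hsup : ∀ {F : ℝ → ℝ≥0∞}, (∫⁻ w, stickPDF 1 d w * F w) =
      ∫⁻ w in Set.Ioo 0 1, stickPDF 1 d w * F w := by
    intro F
    refine (setLIntegral_eq_of_support_subset fun w hw => ?_).symm
    by_contra h
    exact hw (by simp [stickPDF_of_notMem (show ¬ (0 < w ∧ w < 1) from h)])
  rw [hsup, setLIntegral_Ioo_comp_moebius _ ht, ← lintegral_const_mul _ (by fun_prop)]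
  have key : ∀ s ∈ Set.Ioo (0 : ℝ) 1, ENNReal.ofReal (γ * α) *
      (ENNReal.ofReal (t * (1 + t) / (1 + t - s) ^ 2) * (stickPDF 1 d (s * t / (1 + t - s)) *
      (ENNReal.ofReal (1 / (s * t / (1 + t - s))) *
      ENNReal.ofReal ((t / (s * t / (1 + t - s))) ^ ((1 : ℝ) - 1) *
        (1 + t / (s * t / (1 + t - s))) ^ (-1 - (α + d)) / beta 1 (α + d))))) =
      ENNReal.ofReal (γ * Real.Gamma (α + 1) / (Real.Gamma (1 - d) * Real.Gamma (α + d))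
      * t ^ (-1 - d) * (1 + t) ^ (-α)) * betaPDF α (1 + d) s := by
    intro s hs
    have hw : s * t / (1 + t - s) ∈ Set.Ioo (0 : ℝ) 1 := by
      rw [← image_moebius_Ioo ht]
      exact ⟨s, hs, rfl⟩
    have hw0 := hw.1
    have hw1 : 0 < 1 - s * t / (1 + t - s) := by linarith [hw.2]
    have hT : 0 < 1 + t - s := by linarith [hs.2]
    rw [stickPDF_of_mem hw, betaPDF_of_pos_lt_one hs.1 hs.2, ← ENNReal.ofReal_mul (by positivity),
      ← ENNReal.ofReal_mul (by positivity), ← ENNReal.ofReal_mul (by positivity),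
      ← ENNReal.ofReal_mul (by positivity), ← ENNReal.ofReal_mul (by positivity),
      betaPrime_mixture_identity hα hd0 hd1 hs ht]
  rw [setLIntegral_congr_fun measurableSet_Ioo key, lintegral_const_mul _ (measurable_betaPDF _ _)]
  have : ∫⁻ s in Set.Ioo 0 1, betaPDF α (1 + d) s = 1 := by
    rw [← lintegral_betaPDF_eq_one hα (by linarith : 0 < 1 + d)]
    refine setLIntegral_eq_of_support_subset fun w hw => ?_
    by_contra h
    exact hw (betaPDF_of_notMem (show ¬ (0 < w ∧ w < 1) from h))
  rw [this, mul_one]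

/-- The rate of the beta prime process as a mixture of stick-breaking weights. -/
lemma lintegral_betaPrime_stickIntensity {γ α d : ℝ} (hγ : 0 < γ) (hα : 0 < α) (hd0 : 0 ≤ d)
    (hd1 : d < 1) {f : ℝ → ℝ≥0∞} (hf : Measurable f) :
    ENNReal.ofReal (γ * α) *
      ∫⁻ v, ∫⁻ w, f (v * w) ∂(stickIntensity 1 d) ∂(betaPrimeMeasure 1 (α + d)) =
      ∫⁻ t, f t ∂(betaPrimeProcessRate γ α d) := by
  have hm : Measurable fun v => ∫⁻ w, f (v * w) ∂(stickIntensity 1 d) :=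
    Measurable.lintegral_prod_right' (f := fun p : ℝ × ℝ => f (p.1 * p.2)) (by fun_prop)
  rw [lintegral_betaPrimeMeasure hm, lintegral_betaPrimeProcessRate hf]
  let b : ℝ → ℝ≥0∞ := fun v =>
    ENNReal.ofReal (v ^ ((1 : ℝ) - 1) * (1 + v) ^ (-1 - (α + d)) / beta 1 (α + d))
  have hb : Measurable b := by fun_prop
  have h1 : ∀ v, b v * ∫⁻ w, f (v * w) ∂(stickIntensity 1 d) =
      ∫⁻ w, b v * (stickPDF 1 d w * f (v * w)) := by
    intro v
    rw [lintegral_stickIntensity (by fun_prop), lintegral_const_mul _ (by fun_prop)]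
  have h2 : ∀ w, ∫⁻ v in Set.Ioi 0, b v * (stickPDF 1 d w * f (v * w)) =
      ∫⁻ t in Set.Ioi 0, stickPDF 1 d w * (ENNReal.ofReal (1 / w) * b (t / w)) * f t := by
    intro w
    by_cases hw : 0 < w ∧ w < 1
    · rw [setLIntegral_Ioi_comp_mul_left (by fun_prop) (one_div_pos.2 hw.1),
        ← lintegral_const_mul _ (by fun_prop)]
      refine lintegral_congr fun t => ?_
      have e1 : 1 / w * t = t / w := by ring
      rw [e1, div_mul_cancel₀ _ hw.1.ne']
      ring
    · simp [stickPDF_of_notMem hw]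
  change ENNReal.ofReal (γ * α) * ∫⁻ v in Set.Ioi 0, b v * _ = _
  simp_rw [h1]
  rw [lintegral_lintegral_swap (by fun_prop)]
  simp_rw [h2]
  rw [lintegral_lintegral_swap (by fun_prop), ← lintegral_const_mul]
  · refine setLIntegral_congr_fun measurableSet_Ioi fun t ht => ?_
    rw [lintegral_mul_const _ (by fun_prop), ← mul_assoc,
      betaPrime_mixture_density hγ hα hd0 hd1 ht]
  · exact Measurable.lintegral_prod_right' (f := fun p : ℝ × ℝ =>
      stickPDF 1 d p.2 * (ENNReal.ofReal (1 / p.2) * b (p.1 / p.2)) * f p.1) (by fun_prop)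

/-! ### Joining and regrouping independent families. -/

section Families
variable {Ω ι κ : Type*} [MeasurableSpace Ω] {P : Measure Ω}

/-- Two independent families of independent random variables can be joined coordinatewise. -/
lemma iIndepFun.prodMk_of_indepFun {E F : ι → Type*} [∀ i, MeasurableSpace (E i)]
    [∀ i, MeasurableSpace (F i)] {A : ∀ i, Ω → E i} {B : ∀ i, Ω → F i} (hA : iIndepFun A P)
    (hB : iIndepFun B P) (hmA : ∀ i, Measurable (A i)) (hmB : ∀ i, Measurable (B i))
    (hAB : IndepFun (fun ω i => A i ω) (fun ω i => B i ω) P) :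
    iIndepFun (fun i ω => (A i ω, B i ω)) P := by
  have := hA.isProbabilityMeasure
  have hmAB : ∀ i, Measurable fun ω => (A i ω, B i ω) := fun i => (hmA i).prodMk (hmB i)
  have : ∀ i, IsProbabilityMeasure (P.map fun ω => (A i ω, B i ω)) := fun i =>
    Measure.isProbabilityMeasure_map (hmAB i).aemeasurable
  rw [iIndepFun_iff_map_fun_eq_infinitePi_map hmAB]
  refine Measure.eq_infinitePi _ fun s t ht => ?_
  have hind : ∀ i, IndepFun (A i) (B i) P := fun i =>
    hAB.comp (measurable_pi_apply i) (measurable_pi_apply i)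
  rw [Measure.map_apply (by fun_prop) (MeasurableSet.pi s.countable_toSet fun i _ => ht i)]
  have hone : ∀ i, Measurable ((t i).indicator (1 : E i × F i → ℝ≥0∞)) := fun i =>
    measurable_one.indicator (ht i)
  have h1 : ∀ i, P.map (fun ω => (A i ω, B i ω)) (t i) =
      ∫⁻ ω, ∫⁻ ω', (t i).indicator 1 (A i ω, B i ω') ∂P ∂P := by
    intro i
    rw [← IndepFun.lintegral_comp (h := fun a b => (t i).indicator 1 (a, b)) (hind i) (hmA i)
      (hmB i) (hone i), ← lintegral_indicator_one (ht i), lintegral_map (hone i) (hmAB i)]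
  -- The probability of a cylinder is the mean of a finite product of indicators. It factors when
  -- first the `B i`, then the `A i`, are integrated out.
  have h2 : P ((fun ω i => (A i ω, B i ω)) ⁻¹' (s : Set ι).pi t) =
      ∫⁻ ω, ∏ i ∈ s, (t i).indicator 1 (A i ω, B i ω) ∂P := by
    rw [← lintegral_indicator_one]
    · refine lintegral_congr fun ω => ?_
      by_cases h : ∀ i ∈ s, (A i ω, B i ω) ∈ t i
      · rw [Set.indicator_of_mem (by simpa using h), Finset.prod_eq_one]
        · rfl
        · intro i hi
          rw [Set.indicator_of_mem (h i hi)]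
          rfl
      · rw [Set.indicator_of_notMem (by simpa using h)]
        push Not at h
        obtain ⟨i, hi, hti⟩ := h
        exact (Finset.prod_eq_zero hi (Set.indicator_of_notMem hti _)).symm
    · exact (by fun_prop : Measurable fun ω i => (A i ω, B i ω))
        (MeasurableSet.pi s.countable_toSet fun i _ => ht i)
  rw [h2, IndepFun.lintegral_comp (h := fun (a : ∀ i, E i) (b : ∀ i, F i) =>
    ∏ i ∈ s, (t i).indicator 1 (a i, b i)) hAB (by fun_prop) (by fun_prop)]
  · have h3 : ∀ ω, ∫⁻ ω', ∏ i ∈ s, (t i).indicator 1 (A i ω, B i ω') ∂P =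
        ∏ i ∈ s, ∫⁻ ω', (t i).indicator 1 (A i ω, B i ω') ∂P := by
      intro ω
      exact lintegral_prod_eq_prod_lintegral_of_indepFun s
        (fun i ω' => (t i).indicator 1 (A i ω, B i ω'))
        (hB.comp (fun i b => (t i).indicator 1 (A i ω, b))
          fun i => (hone i).comp measurable_prodMk_left)
        fun i => (hone i).comp (by fun_prop)
    have hm4 : ∀ i, Measurable fun a => ∫⁻ ω', (t i).indicator (1 : E i × F i → ℝ≥0∞) (a, B i ω') ∂P :=
      fun i => Measurable.lintegral_prod_right'
        (f := fun p : E i × Ω => (t i).indicator (1 : E i × F i → ℝ≥0∞) (p.1, B i p.2))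
        ((hone i).comp (by fun_prop))
    simp_rw [h3, h1]
    exact lintegral_prod_eq_prod_lintegral_of_indepFun s
        (fun i ω => ∫⁻ ω', (t i).indicator 1 (A i ω, B i ω') ∂P)
        (hA.comp (fun i a => ∫⁻ ω', (t i).indicator 1 (a, B i ω') ∂P) hm4)
        fun i => (hm4 i).comp (hmA i)
  · exact Finset.measurable_prod _ fun i _ => (hone i).comp (by fun_prop)

/-- The sections of a doubly indexed family of independent random variables are independent. -/
lemma iIndepFun.curry {E : Type*} [MeasurableSpace E] {U : ι × κ → Ω → E} (hU : iIndepFun U P)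
    (hm : ∀ q, Measurable (U q)) : iIndepFun (fun i ω l => U (i, l) ω) P := by
  have := hU.isProbabilityMeasure
  have : ∀ q, IsProbabilityMeasure (P.map (U q)) := fun q =>
    Measure.isProbabilityMeasure_map (hm q).aemeasurable
  rw [iIndepFun_iff_map_fun_eq_infinitePi_map fun i => by fun_prop]
  have h1 := hU.map_fun_eq_infinitePi_map hm
  have h2 := Measure.infinitePi_map_curry fun (i : ι) (l : κ) => P.map (U (i, l))
  have h3 : ∀ i, P.map (fun ω l => U (i, l) ω) = Measure.infinitePi fun l => P.map (U (i, l)) :=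
    fun i => (hU.precomp (g := fun l => (i, l)) (Prod.mk_right_injective i)).map_fun_eq_infinitePi_map
      fun l => hm (i, l)
  simp_rw [h3]
  rw [← h2, ← h1, Measure.map_map (by fun_prop) (by fun_prop)]
  rfl

end Families

/-! ### The atoms of the power-law representation. -/

/-- The weight `V U_k ∏_{l < k} (1 - U_l)` as a function of `V` and the sticks `U`. -/
def roundWeight (k : ℕ) (z : ℝ × (ℕ → ℝ)) : ℝ :=
  z.1 * z.2 k * ∏ l ∈ Finset.range k, (1 - z.2 l)

@[fun_prop]
lemma measurable_roundWeight (k : ℕ) : Measurable (roundWeight k) := by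
  unfold roundWeight
  fun_prop

/-- The joint law of the sticks `U_l ~ Beta(1 - d, 1 + (l + 1) d)`. -/
def stickLaw (d : ℝ) : Measure (ℕ → ℝ) :=
  Measure.infinitePi fun l : ℕ => betaMeasure (1 - d) (1 + ((l : ℝ) + 1) * d)

/-- The law of the weights of round `k`. -/
def roundLaw (g : Measure ℝ) (d : ℝ) (k : ℕ) : Measure ℝ :=
  (g.prod (stickLaw d)).map (roundWeight k)

section PowerLaw
variable {Ω Ψ : Type*} [MeasurableSpace Ω] [MeasurableSpace Ψ] {P : Measure Ω}
  [IsProbabilityMeasure P] {G : Measure Ψ} {C : ℕ → Ω → ℕ} {V : ℕ × ℕ → Ω → ℝ}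
  {U : (ℕ × ℕ) × ℕ → Ω → ℝ} {ψ : ℕ × ℕ → Ω → Ψ} {c d : ℝ} {g : Measure ℝ}

/-- The weight of the atom `p`, whether present or not. -/
def atomWeight (V : ℕ × ℕ → Ω → ℝ) (U : (ℕ × ℕ) × ℕ → Ω → ℝ) (p : ℕ × ℕ) (ω : Ω) : ℝ :=
  roundWeight p.1 (V p ω, fun l => U (p, l) ω)

omit [MeasurableSpace Ω] in
lemma plWeight_eq (p : ℕ × ℕ) (ω : Ω) :
    plWeight C V U p ω = if p.2 < C p.1 ω then atomWeight V U p ω else 0 := rfl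

namespace IsPowerLawRep

omit [IsProbabilityMeasure P] in
lemma measurable_atomWeight (h : IsPowerLawRep P C V U ψ c 1 d g G) (p : ℕ × ℕ) :
    Measurable (atomWeight V U p) := by
  have hV := h.measurable_V
  have hU := h.measurable_U
  unfold atomWeight
  fun_prop

lemma isProbabilityMeasure_g (h : IsPowerLawRep P C V U ψ c 1 d g G) : IsProbabilityMeasure g :=
  h.law_V (0, 0) ▸ Measure.isProbabilityMeasure_map (h.measurable_V _).aemeasurable

lemma isProbabilityMeasure_stickLaw (h : IsPowerLawRep P C V U ψ c 1 d g G) :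
    IsProbabilityMeasure (stickLaw d) := by
  have : ∀ l : ℕ, IsProbabilityMeasure (betaMeasure (1 - d) (1 + ((l : ℝ) + 1) * d)) := fun l =>
    h.law_U ((0, 0), l) ▸ Measure.isProbabilityMeasure_map (h.measurable_U _).aemeasurable
  unfold stickLaw
  infer_instance

lemma isProbabilityMeasure_roundLaw (h : IsPowerLawRep P C V U ψ c 1 d g G) (k : ℕ) :
    IsProbabilityMeasure (roundLaw g d k) := by
  have := h.isProbabilityMeasure_g
  have := h.isProbabilityMeasure_stickLaw
  exact Measure.isProbabilityMeasure_map (measurable_roundWeight k).aemeasurable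

omit [IsProbabilityMeasure P] in
lemma indepFun_V_U (h : IsPowerLawRep P C V U ψ c 1 d g G) :
    IndepFun (fun ω p => V p ω) (fun ω q => U q ω) P :=
  h.indep_V_Uψ.comp measurable_id measurable_fst

lemma map_atomWeight (h : IsPowerLawRep P C V U ψ c 1 d g G) (p : ℕ × ℕ) :
    P.map (atomWeight V U p) = roundLaw g d p.1 := by
  have hV := h.measurable_V
  have hU := h.measurable_U
  have hlU : P.map (fun ω l => U (p, l) ω) = stickLaw d := by
    have h1 := (h.indep_U.precomp (g := fun l => (p, l)) (Prod.mk_right_injective p))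
    rw [h1.map_fun_eq_infinitePi_map fun l => hU (p, l), stickLaw]
    simp_rw [h.law_U]
  have hind : IndepFun (V p) (fun ω l => U (p, l) ω) P :=
    h.indepFun_V_U.comp (φ := fun v : ℕ × ℕ → ℝ => v p) (ψ := fun (u : (ℕ × ℕ) × ℕ → ℝ) l => u (p, l))
      (by fun_prop) (by fun_prop)
  rw [roundLaw, ← hlU, ← h.law_V p,
    ← (indepFun_iff_map_prod_eq_prod_map_map (by fun_prop) (by fun_prop)).1 hind,
    Measure.map_map (by fun_prop) (by fun_prop)]
  rfl

omit [IsProbabilityMeasure P] in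
lemma iIndepFun_atoms (h : IsPowerLawRep P C V U ψ c 1 d g G) :
    iIndepFun (fun p ω => (atomWeight V U p ω, ψ p ω)) P := by
  have hV := h.measurable_V
  have hU := h.measurable_U
  have hψ := h.measurable_ψ
  have h1 : iIndepFun (fun p ω => ((fun l => U (p, l) ω), ψ p ω)) P := by
    refine iIndepFun.prodMk_of_indepFun (iIndepFun.curry h.indep_U hU) h.indep_ψ
      (by fun_prop) hψ ?_
    exact h.indep_U_ψ.comp (φ := fun (u : (ℕ × ℕ) × ℕ → ℝ) p l => u (p, l)) (ψ := id)
      (by fun_prop) measurable_id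
  have h2 : iIndepFun (fun p ω => (V p ω, ((fun l => U (p, l) ω), ψ p ω))) P := by
    refine iIndepFun.prodMk_of_indepFun h.indep_V h1 hV (by fun_prop) ?_
    exact h.indep_V_Uψ.comp (φ := id) (ψ := fun (z : ((ℕ × ℕ) × ℕ → ℝ) × (ℕ × ℕ → Ψ)) p =>
      ((fun l => z.1 (p, l)), z.2 p)) measurable_id (by fun_prop)
  exact h2.comp (fun p (z : ℝ × (ℕ → ℝ) × Ψ) => (roundWeight p.1 (z.1, z.2.1), z.2.2))
    fun p => by fun_prop

omit [IsProbabilityMeasure P] in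
lemma indepFun_C_atoms (h : IsPowerLawRep P C V U ψ c 1 d g G) :
    IndepFun (fun ω k => C k ω) (fun ω p => (atomWeight V U p ω, ψ p ω)) P :=
  h.indep_C_VUψ.comp (φ := id)
    (ψ := fun (z : (ℕ × ℕ → ℝ) × ((ℕ × ℕ) × ℕ → ℝ) × (ℕ × ℕ → Ψ)) (p : ℕ × ℕ) =>
      (roundWeight p.1 (z.1 p, fun l => z.2.1 (p, l)), z.2.2 p)) measurable_id (by fun_prop)

lemma map_atoms (h : IsPowerLawRep P C V U ψ c 1 d g G) (p : ℕ × ℕ) :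
    P.map (fun ω => (atomWeight V U p ω, ψ p ω)) = (roundLaw g d p.1).prod G := by
  have hW := h.measurable_atomWeight p
  -- From `V` independent of `(U, ψ)` and `U` independent of `ψ`, the joint law is a triple product;
  -- reassociating it separates `(V, U)` from `ψ`.
  have h0 : IndepFun (fun ω => (fun p => V p ω, fun q => U q ω)) (fun ω p => ψ p ω) P := by
    have hV := h.measurable_V
    have hU := h.measurable_U
    have hψ := h.measurable_ψ
    have h1 := (indepFun_iff_map_prod_eq_prod_map_map (by fun_prop) (by fun_prop)).1 h.indep_V_Uψ
    have h2 := (indepFun_iff_map_prod_eq_prod_map_map (by fun_prop) (by fun_prop)).1 h.indep_U_ψ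
    have h3 := (indepFun_iff_map_prod_eq_prod_map_map (by fun_prop) (by fun_prop)).1 h.indepFun_V_U
    rw [indepFun_iff_map_prod_eq_prod_map_map (by fun_prop) (by fun_prop), h3]
    rw [h2] at h1
    have := Measure.isProbabilityMeasure_map (μ := P) (f := fun ω p => V p ω) (by fun_prop)
    have := Measure.isProbabilityMeasure_map (μ := P) (f := fun ω p => U p ω) (by fun_prop)
    have := Measure.isProbabilityMeasure_map (μ := P) (f := fun ω p => ψ p ω) (by fun_prop)
    rw [← MeasurableEquiv.prodAssoc.map_measurableEquiv_injective.eq_iff, Measure.prodAssoc_prod,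
      ← h1, Measure.map_map (by fun_prop) (by fun_prop)]
    rfl
  have h1 : IndepFun (atomWeight V U p) (ψ p) P :=
    h0.comp (φ := fun z : (ℕ × ℕ → ℝ) × ((ℕ × ℕ) × ℕ → ℝ) =>
      roundWeight p.1 (z.1 p, fun l => z.2 (p, l))) (ψ := fun z : ℕ × ℕ → Ψ => z p)
      (by fun_prop) (by fun_prop)
  rw [(indepFun_iff_map_prod_eq_prod_map_map hW.aemeasurable
    (h.measurable_ψ p).aemeasurable).1 h1, h.map_atomWeight, h.law_ψ]

end IsPowerLawRep
end PowerLaw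

/-! ### Means of sums over rounds. -/

lemma lintegral_natCast_poissonMeasure (r : ℝ≥0) : ∫⁻ n, (n : ℝ≥0∞) ∂(poissonMeasure r) = r := by
  rw [poissonMeasure, lintegral_sum_measure]
  simp_rw [lintegral_smul_measure, lintegral_dirac, smul_eq_mul]
  rw [tsum_eq_zero_add' ENNReal.summable]
  have h : ∀ n : ℕ, ENNReal.ofReal (Real.exp (-r) * r ^ (n + 1) / (n + 1).factorial) *
      ((n + 1 : ℕ) : ℝ≥0∞) = r * ENNReal.ofReal (Real.exp (-r) * r ^ n / n.factorial) := by
    intro n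
    rw [← ENNReal.ofReal_natCast, ← ENNReal.ofReal_mul (by positivity),
      ← ENNReal.ofReal_coe_nnreal, ← ENNReal.ofReal_mul (by positivity)]
    congr 1
    rw [Nat.factorial_succ]
    push_cast
    field_simp
    ring
  simp_rw [h]
  rw [ENNReal.tsum_mul_left, ← ENNReal.ofReal_tsum_of_nonneg (fun n => by positivity)
    (hasSum_one_poissonMeasure r).summable, (hasSum_one_poissonMeasure r).tsum_eq]
  simp

/-- The mean of a sum over rounds with Poisson numbers of points. -/
lemma lintegral_rounds {Ω E : Type*} [MeasurableSpace Ω] [MeasurableSpace E] {P : Measure Ω}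
    [IsProbabilityMeasure P] {C : ℕ → Ω → ℕ}
    {X : ℕ × ℕ → Ω → E} {c : ℝ≥0} {τ : ℕ → Measure E}
    (hC : ∀ k, Measurable (C k)) (hX : ∀ p, Measurable (X p))
    (hlC : ∀ k, P.map (C k) = poissonMeasure c) (hlX : ∀ p, P.map (X p) = τ p.1)
    (hCX : IndepFun (fun ω k => C k ω) (fun ω p => X p ω) P)
    {F : ℕ → E → ℝ≥0∞} (hF : ∀ k, Measurable (F k)) :
    ∫⁻ ω, (∑' p : ℕ × ℕ, if p.2 < C p.1 ω then F p.1 (X p ω) else 0) ∂P =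
      ∑' k, c * ∫⁻ x, F k x ∂(τ k) := by
  rw [IndepFun.lintegral_comp (h := fun (c : ℕ → ℕ) (x : ℕ × ℕ → E) =>
    ∑' p : ℕ × ℕ, if p.2 < c p.1 then F p.1 (x p) else 0) hCX (by fun_prop) (by fun_prop) ?_]
  swap
  · refine Measurable.tsum fun p => Measurable.ite ?_ ?_ measurable_const
    · exact measurableSet_lt measurable_const (by fun_prop)
    · exact (hF p.1).comp (by fun_prop)
  have h1 : ∀ ω, ∫⁻ ω', (∑' p : ℕ × ℕ, if p.2 < C p.1 ω then F p.1 (X p ω') else 0) ∂P =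
      ∑' k, C k ω * ∫⁻ x, F k x ∂(τ k) := by
    intro ω
    have hm : ∀ p : ℕ × ℕ, Measurable fun ω' => if p.2 < C p.1 ω then F p.1 (X p ω') else 0 := by
      intro p
      split_ifs
      · exact (hF p.1).comp (hX p)
      · exact measurable_const
    rw [lintegral_tsum fun p => (hm p).aemeasurable, ENNReal.tsum_prod']
    congr 1 with k
    have h3 : ∀ i, ∫⁻ ω', (if i < C k ω then F k (X (k, i) ω') else 0) ∂P =
        if i ∈ Finset.range (C k ω) then ∫⁻ x, F k x ∂(τ k) else 0 := by
      intro i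
      simp only [Finset.mem_range]
      split_ifs with h
      · rw [← lintegral_map (hF k) (hX (k, i)), hlX]
      · simp
    simp_rw [h3]
    rw [tsum_eq_sum (s := Finset.range (C k ω)) (by simp +contextual)]
    simp +contextual
  simp_rw [h1]
  have hm : ∀ k, Measurable fun ω => (C k ω : ℝ≥0∞) := fun k =>
    (Measurable.of_discrete (f := fun n : ℕ => (n : ℝ≥0∞))).comp (hC k)
  rw [lintegral_tsum fun k => ((hm k).mul_const _).aemeasurable]
  congr 1 with k
  rw [lintegral_mul_const _ (hm k),
    ← lintegral_map (f := fun n : ℕ => (n : ℝ≥0∞)) Measurable.of_discrete (hC k), hlC,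
    lintegral_natCast_poissonMeasure]

/-! ### The power-law representation is a beta prime process. -/

section PowerLaw
variable {Ω Ψ : Type*} [MeasurableSpace Ω] [MeasurableSpace Ψ] {P : Measure Ω}
  [IsProbabilityMeasure P] {G : Measure Ψ} [IsProbabilityMeasure G] {C : ℕ → Ω → ℕ}
  {V : ℕ × ℕ → Ω → ℝ} {U : (ℕ × ℕ) × ℕ → Ω → ℝ} {ψ : ℕ × ℕ → Ω → Ψ} {γ α d : ℝ}

lemma isProbabilityMeasure_betaMeasure_stick (hd0 : 0 ≤ d) (hd1 : d < 1) (l : ℕ) :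
    IsProbabilityMeasure (betaMeasure (1 - d) (1 + ((l : ℝ) + 1) * d)) :=
  isProbabilityMeasureBeta (by linarith) (by positivity)

lemma isProbabilityMeasure_stickLaw (hd0 : 0 ≤ d) (hd1 : d < 1) :
    IsProbabilityMeasure (stickLaw d) := by
  have := isProbabilityMeasure_betaMeasure_stick hd0 hd1
  unfold stickLaw
  infer_instance

lemma iIndepFun_eval_stickLaw (hd0 : 0 ≤ d) (hd1 : d < 1) :
    iIndepFun (fun l (u : ℕ → ℝ) => u l) (stickLaw d) := by
  have := isProbabilityMeasure_betaMeasure_stick hd0 hd1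
  exact iIndepFun_infinitePi (X := fun _ x => x) fun _ => measurable_id

lemma map_eval_stickLaw (hd0 : 0 ≤ d) (hd1 : d < 1) (l : ℕ) :
    (stickLaw d).map (fun u => u l) = betaMeasure (1 - d) (1 + ((l : ℝ) + 1) * d) := by
  have := isProbabilityMeasure_betaMeasure_stick hd0 hd1
  exact Measure.infinitePi_map_eval (fun l : ℕ => betaMeasure (1 - d) (1 + ((l : ℝ) + 1) * d)) l

lemma lintegral_roundLaw {g : Measure ℝ} [SFinite g] (hd0 : 0 ≤ d) (hd1 : d < 1)
    {f : ℝ → ℝ≥0∞} (hf : Measurable f) (k : ℕ) :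
    ∫⁻ θ, f θ ∂(roundLaw g d k) =
      ∫⁻ v, ∫⁻ u, f (v * (u k * ∏ l ∈ Finset.range k, (1 - u l))) ∂(stickLaw d) ∂g := by
  have := isProbabilityMeasure_stickLaw hd0 hd1
  rw [roundLaw, lintegral_map hf (by fun_prop), lintegral_prod _ (by fun_prop)]
  simp_rw [roundWeight, mul_assoc]

/-- The rates of the rounds add up to the rate of the beta prime process. -/
lemma tsum_lintegral_roundLaw (hγ : 0 < γ) (hα : 0 < α) (hd0 : 0 ≤ d) (hd1 : d < 1)
    {f : ℝ → ℝ≥0∞} (hf : Measurable f) [SFinite (betaPrimeMeasure 1 (α + d))] :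
    ∑' k, ((γ * α).toNNReal : ℝ≥0∞) *
      ∫⁻ θ, f θ ∂(roundLaw (betaPrimeMeasure 1 (α + d)) d k) =
      ∫⁻ t, f t ∂(betaPrimeProcessRate γ α d) := by
  have := isProbabilityMeasure_stickLaw hd0 hd1
  rw [ENNReal.tsum_mul_left, ← lintegral_betaPrime_stickIntensity hγ hα hd0 hd1 hf]
  simp_rw [lintegral_roundLaw hd0 hd1 hf]
  rw [← lintegral_tsum fun k => (Measurable.lintegral_prod_right' (f := fun p : ℝ × (ℕ → ℝ) =>
    f (p.1 * (p.2 k * ∏ l ∈ Finset.range k, (1 - p.2 l)))) (by fun_prop)).aemeasurable]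
  congr 1
  refine lintegral_congr fun v => ?_
  rw [← sum_map_sticks (fun l => measurable_pi_apply l) (iIndepFun_eval_stickLaw hd0 hd1) hd0 hd1
    (map_eval_stickLaw hd0 hd1), lintegral_sum_measure]
  refine tsum_congr fun k => ?_
  rw [lintegral_map (by fun_prop) (by fun_prop)]

namespace IsPowerLawRep

/-- The power-law representation of the beta prime process. -/
theorem isCRM_betaPrime
    (h : IsPowerLawRep P C V U ψ (γ * α) 1 d (betaPrimeMeasure 1 (α + d)) G)
    (hγ : 0 < γ) (hα : 0 < α) (hd0 : 0 ≤ d) (hd1 : d < 1) :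
    IsCRM P (fun ω => weightedAtoms (fun p => plWeight C V U p ω) (fun p => ψ p ω))
      (betaPrimeProcessRate γ α d) G := by
  have := h.isProbabilityMeasure_g
  have := h.isProbabilityMeasure_roundLaw
  have hψ := h.measurable_ψ
  have hC := h.measurable_C
  have hW := h.measurable_atomWeight
  -- Only the atoms present are counted. `plWeight` gives the absent ones weight `0`; as points they
  -- would pile up infinite mass at weight `0`, but they add nothing to the random measure.
  let M : Ω → Measure (ℝ × Ψ) := fun ω => Measure.sum fun p : ℕ × ℕ =>
    if p.2 < C p.1 ω then Measure.dirac (atomWeight V U p ω, ψ p ω) else 0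
  have hM : Measurable M := by
    refine measurable_measure_sum fun p => Measurable.ite ?_
      (Measure.measurable_dirac.comp (by fun_prop)) measurable_const
    exact measurableSet_lt measurable_const (hC p.1)
  have hMf : ∀ f : ℝ × Ψ → ℝ≥0∞, Measurable f → ∀ ω, ∫⁻ x, f x ∂(M ω) =
      ∑' p : ℕ × ℕ, if p.2 < C p.1 ω then f (atomWeight V U p ω, ψ p ω) else 0 := by
    intro f hf ω
    rw [lintegral_sum_measure]
    refine tsum_congr fun p => ?_
    split_ifs
    · exact lintegral_dirac' _ hf
    · simp
  have hprob := Measure.isProbabilityMeasure_map (μ := P) hM.aemeasurable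
  refine ⟨P.map M, isPoissonProcessLaw_of_lintegral_nexp fun f hf => ?_, ?_⟩
  · rw [lintegral_map (by fun_prop) hM]
    simp_rw [hMf f hf]
    rw [lintegral_nexp_rounds (X := fun p ω => (atomWeight V U p ω, ψ p ω)) (F := fun _ => f)
      (τ := fun k => (roundLaw (betaPrimeMeasure 1 (α + d)) d k).prod G) hC
      (fun p => (hW p).prodMk (hψ p)) h.law_C h.map_atoms h.indep_C h.iIndepFun_atoms
      h.indepFun_C_atoms fun _ => hf]
    have hm : Measurable fun x => 1 - nexp (f x) := by fun_prop
    rw [lintegral_prod _ hm.aemeasurable,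
      ← tsum_lintegral_roundLaw hγ hα hd0 hd1 hm.lintegral_prod_right']
    congr 2 with k
    rw [lintegral_prod _ hm.aemeasurable]
  · rw [Measure.map_map measurable_traitsOfPoints hM]
    congr 1 with ω s hs
    simp only [Function.comp_apply]
    rw [traitsOfPoints, Measure.map_apply measurable_snd hs,
      withDensity_apply _ (measurable_snd hs), ← lintegral_indicator (measurable_snd hs),
      hMf _ (Measurable.indicator (by fun_prop) (measurable_snd hs)), weightedAtoms,
      Measure.sum_apply _ hs]
    refine tsum_congr fun p => ?_
    rw [plWeight_eq]
    split_ifs with hp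
    · by_cases h' : ψ p ω ∈ s <;> simp [h', hs]
    · simp

end IsPowerLawRep

/-! ### The truncation error -/

/-- The probability `1 - π(θ)^N` that one of `N` observations has a nonzero count at an atom of
weight `θ`. -/
def missRate (N : ℕ) (θ : ℝ) : ℝ≥0∞ := 1 - (oddsBernoulliPMF θ.toNNReal 0 : ℝ≥0∞) ^ N

lemma oddsBernoulliPMF_zero (θ : ℝ≥0) : oddsBernoulliPMF θ 0 = (1 + θ)⁻¹ := by
  simp [oddsBernoulliPMF]

lemma measurable_oddsBernoulliPMF (x : ℕ) : Measurable fun θ => oddsBernoulliPMF θ x := by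
  unfold oddsBernoulliPMF
  split_ifs <;> fun_prop

@[fun_prop]
lemma measurable_missRate (N : ℕ) : Measurable (missRate N) := by
  have h := (measurable_oddsBernoulliPMF 0).comp measurable_real_toNNReal
  exact measurable_const.sub (h.coe_nnreal_ennreal.pow_const N)

/-- Bernoulli's inequality for `(1 + t)⁻¹ ^ N`, together with `1 - (1 + t)⁻¹ = t / (1 + t) ≤ t`. -/
lemma missRate_le (N : ℕ) (θ : ℝ) : missRate N θ ≤ N * ENNReal.ofReal θ := by
  unfold missRate
  rw [oddsBernoulliPMF_zero, ENNReal.ofReal]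
  generalize θ.toNNReal = t
  have h : (1 : ℝ≥0) - ((1 + t)⁻¹) ^ N ≤ N * t := by
    rw [tsub_le_iff_right]
    have h1 := one_add_mul_le_pow (a := ((1 + t)⁻¹ : ℝ) - 1) (by
      have : (0 : ℝ) ≤ (1 + t : ℝ)⁻¹ := by positivity
      linarith) N
    have h2 : -(t : ℝ) ≤ ((1 + t)⁻¹ : ℝ) - 1 := by
      have : (0 : ℝ) < 1 + t := by positivity
      have h3 : ((1 + t)⁻¹ : ℝ) - 1 = - (t / (1 + t)) := by
        field_simp
        ring
      rw [h3, neg_le_neg_iff]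
      exact div_le_self (by positivity) (by linarith [t.2])
    have h4 : (N : ℝ) * -(t : ℝ) ≤ N * (((1 + t)⁻¹ : ℝ) - 1) := by gcongr
    rw [← NNReal.coe_le_coe]
    push_cast
    rw [add_sub_cancel] at h1
    linarith
  exact_mod_cast h

namespace IsPowerLawRep

omit [IsProbabilityMeasure G] in
-- Campbell's formula for the superposed rounds; an integrand that depends on the round switches off
-- the rounds that are kept.
lemma truncationB_eq {c : ℝ} {g : Measure ℝ} (h : IsPowerLawRep P C V U ψ c 1 d g G) (N K : ℕ) :
    truncationB P C (plWeight C V U) N K = ∑' k, c.toNNReal *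
      ∫⁻ θ, (if K ≤ k then missRate N θ else 0) ∂(roundLaw g d k) := by
  have hC := h.measurable_C
  have hW := h.measurable_atomWeight
  have hw : ∀ p, Measurable (plWeight C V U p) := fun p => by
    refine Measurable.ite ?_ (hW p) measurable_const
    exact measurableSet_lt measurable_const (hC p.1)
  have hm : Measurable fun ω => Measure.sum fun p : ℕ × ℕ =>
      if K ≤ p.1 ∧ p.2 < C p.1 ω then Measure.dirac (plWeight C V U p ω) else 0 := by
    refine measurable_measure_sum fun p => Measurable.ite ?_
      (Measure.measurable_dirac.comp (hw p)) measurable_const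
    exact (MeasurableSet.const _).inter (measurableSet_lt measurable_const (hC p.1))
  change ∫⁻ θ, missRate N θ ∂(tailRate P C (plWeight C V U) K) = _
  rw [tailRate, Measure.lintegral_bind hm.aemeasurable (by fun_prop)]
  have hind : IndepFun (fun ω k => C k ω) (fun ω p => atomWeight V U p ω) P :=
    h.indepFun_C_atoms.comp (φ := id) (ψ := fun (z : ℕ × ℕ → ℝ × Ψ) p => (z p).1) measurable_id
      (by fun_prop)
  rw [← lintegral_rounds (X := fun p ω => atomWeight V U p ω)
    (F := fun k θ => if K ≤ k then missRate N θ else 0) hC hW h.law_C h.map_atomWeight hind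
    fun k => by split_ifs <;> fun_prop]
  refine lintegral_congr fun ω => ?_
  rw [lintegral_sum_measure]
  refine tsum_congr fun p => ?_
  rw [plWeight_eq]
  by_cases h1 : K ≤ p.1 <;> by_cases h2 : p.2 < C p.1 ω <;>
    simp [h1, h2, lintegral_dirac' _ (measurable_missRate N)]

end IsPowerLawRep

/-- It is simpler to integrate `1 + v`: the factor lowers the exponent, `b (1 + v) ^ (-b)` has an
explicit antiderivative, and the total is `b / (b - 1)`. Subtracting the mass `1` gives the mean. -/
lemma lintegral_ofReal_betaPrimeMeasure {b : ℝ} (hb : 1 < b)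
    [IsProbabilityMeasure (betaPrimeMeasure 1 b)] :
    ∫⁻ v, ENNReal.ofReal v ∂(betaPrimeMeasure 1 b) = ENNReal.ofReal (1 / (b - 1)) := by
  have hbeta : beta 1 b = 1 / b := by
    have := Real.Gamma_pos_of_pos (by linarith : 0 < b)
    rw [beta, Real.Gamma_one, add_comm 1, Real.Gamma_add_one (by positivity)]
    field_simp
  have hderiv : ∀ v ∈ Set.Ici (0 : ℝ), HasDerivAt (fun v : ℝ => -(b / (b - 1)) * (1 + v) ^ (1 - b))
      (b * (1 + v) ^ (-b)) v := by
    intro v hv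
    have hv' : (0 : ℝ) < 1 + v := by linarith [Set.mem_Ici.1 hv]
    have h1 := (((hasDerivAt_id v).const_add 1).rpow_const (p := 1 - b)
      (Or.inl hv'.ne')).const_mul (-(b / (b - 1)))
    refine h1.congr_deriv ?_
    have : b - 1 ≠ 0 := by linarith
    simp only [id]
    rw [show 1 - b - 1 = -b by ring]
    field_simp
    ring
  have hlim : Tendsto (fun v : ℝ => -(b / (b - 1)) * (1 + v) ^ (1 - b)) atTop (𝓝 0) := by
    have h1 := (tendsto_rpow_neg_atTop (by linarith : 0 < b - 1)).comp
      (tendsto_atTop_add_const_left atTop (1 : ℝ) tendsto_id)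
    have h2 := h1.const_mul (-(b / (b - 1)))
    simpa [Function.comp_def] using h2
  have hpos : ∀ v ∈ Set.Ioi (0 : ℝ), 0 ≤ b * (1 + v) ^ (-b) := fun v hv => by
    have : 0 < v := hv
    positivity
  have hint := integrableOn_Ioi_deriv_of_nonneg' hderiv hpos hlim
  have hval := integral_Ioi_of_hasDerivAt_of_nonneg' hderiv hpos hlim
  have h0 : ∫⁻ v in Set.Ioi 0, ENNReal.ofReal (b * (1 + v) ^ (-b)) =
      ENNReal.ofReal (b / (b - 1)) := by
    rw [← ofReal_integral_eq_lintegral_ofReal hint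
      ((ae_restrict_iff' measurableSet_Ioi).2 (ae_of_all _ hpos)), hval]
    simp
  have h1 : ∫⁻ v, ENNReal.ofReal v ∂(betaPrimeMeasure 1 b) + 1 =
      ENNReal.ofReal (1 / (b - 1)) + 1 := by
    have h2 : ENNReal.ofReal (1 / (b - 1)) + 1 = ENNReal.ofReal (b / (b - 1)) := by
      rw [← ENNReal.ofReal_one, ← ENNReal.ofReal_add (by
        have : 0 < b - 1 := by linarith
        positivity) (by norm_num)]
      congr 1
      have : b - 1 ≠ 0 := by linarith
      field_simp
      ring
    have h3 : ∫⁻ v, 1 ∂(betaPrimeMeasure 1 b) = 1 := by simp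
    have h4 : ∫⁻ v, ENNReal.ofReal v ∂(betaPrimeMeasure 1 b) + 1 =
        ∫⁻ v, ENNReal.ofReal v ∂(betaPrimeMeasure 1 b) + ∫⁻ v, 1 ∂(betaPrimeMeasure 1 b) := by
      rw [h3]
    rw [h2, ← h0, h4, ← lintegral_add_left (by fun_prop), lintegral_betaPrimeMeasure (by fun_prop)]
    refine setLIntegral_congr_fun measurableSet_Ioi fun v hv => ?_
    have hv' : 0 < v := hv
    have hb0 : 0 < b := by linarith
    rw [← ENNReal.ofReal_one, ← ENNReal.ofReal_add hv'.le (by norm_num),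
      ← ENNReal.ofReal_mul (by rw [hbeta]; positivity), hbeta, sub_self, Real.rpow_zero]
    congr 1
    have : (1 + v) ^ (-b) = (1 + v) ^ (-1 - b) * (1 + v) := by
      nth_rw 3 [← Real.rpow_one (1 + v)]
      rw [← Real.rpow_add (by linarith)]
      congr 1
      ring
    rw [this]
    field_simp
    ring
  exact (ENNReal.add_left_inj (by simp)).1 h1

namespace IsPowerLawRep

omit [IsProbabilityMeasure G] in
theorem truncationB_le (h : IsPowerLawRep P C V U ψ (γ * α) 1 d (betaPrimeMeasure 1 (α + d)) G)
    (hγ : 0 < γ) (hα : 1 < α) (hd0 : 0 ≤ d) (hd1 : d < 1) (N K : ℕ) :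
    truncationB P C (plWeight C V U) N K ≤ ENNReal.ofReal (plTruncationBound γ α d N K) := by
  have := h.isProbabilityMeasure_g
  have := h.isProbabilityMeasure_stickLaw
  have hα' : 0 < α - 1 := by linarith
  have hprod : 0 ≤ stickProd d K := by
    rw [stickProd_eq_range]
    positivity
  have h1 : ∀ k, ∫⁻ θ, (if K ≤ k then missRate N θ else 0)
      ∂(roundLaw (betaPrimeMeasure 1 (α + d)) d k) ≤ N * (ENNReal.ofReal (1 / (α - 1)) *
        if K ≤ k then ∫⁻ u, ENNReal.ofReal (u k * ∏ l ∈ Finset.range k, (1 - u l)) ∂(stickLaw d)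
        else 0) := by
    intro k
    split_ifs with hk
    · refine (lintegral_mono fun θ => missRate_le N θ).trans ?_
      rw [lintegral_const_mul _ (by fun_prop), lintegral_roundLaw hd0 hd1 (by fun_prop)]
      gcongr
      have h2 : ∀ᵐ v ∂(betaPrimeMeasure 1 (α + d)), 0 ≤ v := by
        refine withDensity_absolutelyContinuous _ _ ?_
        exact (ae_restrict_iff' measurableSet_Ioi).2 (ae_of_all _ fun v hv => le_of_lt hv)
      calc _ = ∫⁻ v, ENNReal.ofReal v *
            ∫⁻ u, ENNReal.ofReal (u k * ∏ l ∈ Finset.range k, (1 - u l)) ∂(stickLaw d)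
            ∂(betaPrimeMeasure 1 (α + d)) := by
            refine lintegral_congr_ae (h2.mono fun v hv => ?_)
            simp only
            rw [← lintegral_const_mul _ (by fun_prop)]
            simp_rw [ENNReal.ofReal_mul hv]
        _ = ENNReal.ofReal (1 / (α + d - 1)) * _ := by
            rw [lintegral_mul_const _ (by fun_prop), lintegral_ofReal_betaPrimeMeasure (by linarith)]
        -- The exact mean of `V` is `1 / (α + d - 1)`; the stated bound gives up the `d`.
        _ ≤ _ := by
            gcongr
            linarith
    · simp
  rw [h.truncationB_eq]
  calc _ ≤ ∑' k, ENNReal.ofReal (γ * α) * (N * (ENNReal.ofReal (1 / (α - 1)) *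
        if K ≤ k then ∫⁻ u, ENNReal.ofReal (u k * ∏ l ∈ Finset.range k, (1 - u l)) ∂(stickLaw d)
        else 0)) := ENNReal.tsum_le_tsum fun k => mul_le_mul_right (h1 k) _
    _ ≤ ENNReal.ofReal (γ * α) * (N * (ENNReal.ofReal (1 / (α - 1)) *
          ENNReal.ofReal (stickProd d K))) := by
        rw [ENNReal.tsum_mul_left, ENNReal.tsum_mul_left, ENNReal.tsum_mul_left]
        gcongr
        exact tsum_lintegral_ofReal_sticks_le (fun l => measurable_pi_apply l)
          (iIndepFun_eval_stickLaw hd0 hd1) hd0 hd1 (map_eval_stickLaw hd0 hd1) K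
    _ = ENNReal.ofReal (plTruncationBound γ α d N K) := by
        rw [← ENNReal.ofReal_mul (by positivity), ← ENNReal.ofReal_natCast,
          ← ENNReal.ofReal_mul (by positivity), ← ENNReal.ofReal_mul (by positivity)]
        congr 1
        rw [plTruncationBound, ← stickProd]
        ring

end IsPowerLawRep
end PowerLaw

/-! ### Product measures with parameters, and products of mixtures. -/

section ProductKernels

/-- Measurability need only be checked on cylinders, a π-system on which the product measure is a
finite product. -/
lemma measurable_infinitePi {Ω ι : Type*} [MeasurableSpace Ω] {E : ι → Type*}
    [∀ i, MeasurableSpace (E i)] {μ : Ω → ∀ i, Measure (E i)}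
    [∀ ω i, IsProbabilityMeasure (μ ω i)] (h : ∀ i, Measurable fun ω => μ ω i) :
    Measurable fun ω => Measure.infinitePi (μ ω) := by
  refine Measurable.measure_of_isPiSystem_of_isProbabilityMeasure
    (generateFrom_squareCylinders (α := E)).symm
    (isPiSystem_squareCylinders (fun _ => MeasurableSpace.isPiSystem_measurableSet) (by simp)) ?_
  rintro _ ⟨s, t, ht, rfl⟩
  have ht' : ∀ i, MeasurableSet (t i) := by simpa using ht
  simp_rw [Measure.infinitePi_pi _ fun i _ => ht' i]
  exact Finset.measurable_prod _ fun i _ => (Measure.measurable_coe (ht' i)).comp (h i)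

lemma measurable_measure_pi {Ω ι : Type*} [MeasurableSpace Ω] [Fintype ι] {E : Type*}
    [MeasurableSpace E] {μ : Ω → Measure E} [∀ ω, IsProbabilityMeasure (μ ω)] (h : Measurable μ) :
    Measurable fun ω => Measure.pi fun _ : ι => μ ω := by
  simp_rw [← Measure.infinitePi_eq_pi]
  exact measurable_infinitePi fun _ => h

/-- This keeps the counts of all `N` observations as variables of integration, so that two models
can be compared before the data are drawn. -/
lemma Measure.pi_bind {ι E F : Type*} [Fintype ι] [MeasurableSpace E] [MeasurableSpace F]
    (μ : Measure E) [IsProbabilityMeasure μ] (κ : Kernel E F) [IsMarkovKernel κ] :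
    (Measure.pi fun _ : ι => μ.bind κ) =
      (Measure.pi fun _ : ι => μ).bind fun x => Measure.pi fun i => κ (x i) := by
  have hm : Measurable fun x : ι → E => Measure.pi fun i => κ (x i) := by
    simp_rw [← Measure.infinitePi_eq_pi]
    exact measurable_infinitePi fun i => κ.measurable.comp (measurable_pi_apply i)
  refine Measure.pi_eq fun s hs => ?_
  rw [Measure.bind_apply (MeasurableSet.univ_pi hs) hm.aemeasurable]
  simp_rw [Measure.pi_pi]
  have hk : ∀ i, Measurable fun x => κ x (s i) := fun i => κ.measurable_coe (hs i)
  have hind : iIndepFun (fun i (x : ι → E) => κ (x i) (s i)) (Measure.pi fun _ => μ) :=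
    iIndepFun_pi (X := fun i x => κ x (s i)) fun i => (hk i).aemeasurable
  rw [lintegral_prod_eq_prod_lintegral_of_indepFun _ _ hind
    fun i => (hk i).comp (measurable_pi_apply i)]
  refine Finset.prod_congr rfl fun i _ => ?_
  rw [Measure.bind_apply (hs i) κ.measurable.aemeasurable]
  have h := lintegral_map (μ := Measure.pi fun _ : ι => μ) (hk i) (measurable_pi_apply i)
  change ∫⁻ x, κ x (s i) ∂((Measure.pi fun _ : ι => μ).map (Function.eval i)) = _ at h
  rw [(measurePreserving_eval (fun _ : ι => μ) i).map_eq] at h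
  exact h.symm

end ProductKernels

/-! ### Observations, and the coupling of the full and truncated models. -/

section Observations
variable {Ω Ψ Y ι : Type*} [MeasurableSpace Ω] [MeasurableSpace Ψ] [MeasurableSpace Y]

lemma measurable_oddsBernoulli : Measurable oddsBernoulli := by
  refine Measure.measurable_of_measurable_coe _ fun s hs => ?_
  simp_rw [oddsBernoulli, Measure.sum_apply _ hs, Measure.smul_apply, smul_eq_mul]
  exact Measurable.tsum fun x =>
    (measurable_oddsBernoulliPMF x).coe_nnreal_ennreal.mul_const _

lemma oddsBernoulli_singleton_zero (θ : ℝ≥0) :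
    oddsBernoulli θ {0} = (oddsBernoulliPMF θ 0 : ℝ≥0∞) := by
  rw [oddsBernoulli, Measure.sum_smul_dirac_singleton]

lemma oddsBernoulli_zero : oddsBernoulli 0 = Measure.dirac 0 := by
  refine Measure.ext_of_singleton fun n => ?_
  rw [oddsBernoulli, Measure.sum_smul_dirac_singleton]
  rcases Nat.eq_zero_or_pos n with rfl | hn
  · simp [oddsBernoulliPMF]
  · simp [oddsBernoulliPMF, hn.ne', hn.ne]

instance (w : ι → ℝ) : IsProbabilityMeasure (countLaw w) := by
  unfold countLaw
  infer_instance

lemma measurable_countLaw {w : ι → Ω → ℝ} (hw : ∀ i, Measurable (w i)) :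
    Measurable fun ω => countLaw fun i => w i ω :=
  measurable_infinitePi fun i => measurable_oddsBernoulli.comp (hw i).real_toNNReal

/-- The observation with trait counts `x` at the traits `ψ`. -/
def obsOfCounts (ψ : ι → Ψ) (x : ι → ℕ) : Measure Ψ :=
  Measure.sum fun i => (x i : ℝ≥0∞) • Measure.dirac (ψ i)

lemma measurable_obsOfCounts [Countable ι] {ψ : ι → Ω → Ψ} {x : ι → Ω → ℕ}
    (hψ : ∀ i, Measurable (ψ i)) (hx : ∀ i, Measurable (x i)) :
    Measurable fun ω => obsOfCounts (fun i => ψ i ω) fun i => x i ω := by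
  refine Measure.measurable_of_measurable_coe _ fun s hs => ?_
  simp_rw [obsOfCounts, Measure.sum_apply _ hs, Measure.smul_apply, smul_eq_mul]
  refine Measurable.tsum fun i => Measurable.mul ?_ ?_
  · exact (Measurable.of_discrete (f := fun n : ℕ => (n : ℝ≥0∞))).comp (hx i)
  · exact (Measure.measurable_coe hs).comp (Measure.measurable_dirac.comp (hψ i))

lemma measurable_obsOfCounts_left [Countable ι] (ψ : ι → Ψ) : Measurable (obsOfCounts ψ) :=
  measurable_obsOfCounts (ψ := fun i _ => ψ i) (x := fun i (x : ι → ℕ) => x i)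
    (fun _ => measurable_const) fun i => measurable_pi_apply i

instance [Countable ι] (w : ι → ℝ) (ψ : ι → Ψ) : IsProbabilityMeasure (likelihoodProcess w ψ) := by
  change IsProbabilityMeasure ((countLaw w).map (obsOfCounts ψ))
  exact Measure.isProbabilityMeasure_map (measurable_obsOfCounts_left ψ).aemeasurable

lemma measurable_likelihoodProcess [Countable ι] {w : ι → Ω → ℝ} {ψ : ι → Ω → Ψ}
    (hw : ∀ i, Measurable (w i)) (hψ : ∀ i, Measurable (ψ i)) :
    Measurable fun ω => likelihoodProcess (fun i => w i ω) fun i => ψ i ω := by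
  let κ : Kernel Ω (ι → ℕ) := ⟨fun ω => countLaw fun i => w i ω, measurable_countLaw hw⟩
  have : IsMarkovKernel κ := ⟨fun ω => inferInstanceAs (IsProbabilityMeasure (countLaw _))⟩
  -- Both the law of the counts and the map applied to them depend on `ω`; on the product space the
  -- value at `s` is the kernel measure of a section of one measurable set.
  let F : Ω × (ι → ℕ) → Measure Ψ := fun p => obsOfCounts (fun i => ψ i p.1) p.2
  have hF : Measurable F :=
    measurable_obsOfCounts (Ω := Ω × (ι → ℕ)) (ψ := fun i p => ψ i p.1) (x := fun i p => p.2 i)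
      (fun i => (hψ i).comp measurable_fst) fun i => (measurable_pi_apply i).comp measurable_snd
  refine Measure.measurable_of_measurable_coe _ fun s hs => ?_
  have h1 : ∀ ω, likelihoodProcess (fun i => w i ω) (fun i => ψ i ω) s =
      κ ω (Prod.mk ω ⁻¹' (F ⁻¹' s)) := fun ω =>
    Measure.map_apply (measurable_obsOfCounts_left _) hs
  rw [funext h1]
  exact Kernel.measurable_kernel_prodMk_left (hF hs)

/-- The counts that remain after the truncation to the first `K` rounds. -/
def truncateCounts (K : ℕ) (x : ℕ × ℕ → ℕ) (p : ℕ × ℕ) : ℕ := if p.1 < K then x p else 0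

lemma measurable_truncateCounts (K : ℕ) : Measurable (truncateCounts K) := by
  refine measurable_pi_lambda _ fun p => ?_
  unfold truncateCounts
  split_ifs <;> fun_prop

/-- A trait of weight `0` has count `0` almost surely, so truncating the weights has the same effect
in law as erasing counts. This is the coupling behind the total variation bound. -/
lemma countLaw_truncate (K : ℕ) (w : ℕ × ℕ → ℝ) :
    (countLaw fun p => if p.1 < K then w p else 0) = (countLaw w).map (truncateCounts K) := by
  have h := Measure.infinitePi_map_pi (μ := fun p : ℕ × ℕ => oddsBernoulli (w p).toNNReal)
    (f := fun p n => if p.1 < K then n else 0) fun p => Measurable.of_discrete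
  refine Eq.trans ?_ h.symm
  rw [countLaw]
  congr 1 with p : 1
  split_ifs
  · simp
  · simp [oddsBernoulli_zero, Measure.map_const]

lemma likelihoodProcess_bind [Countable ι] (w : ι → ℝ) (ψ : ι → Ψ) (f : Kernel (Measure Ψ) Y) :
    (likelihoodProcess w ψ).bind f =
      (countLaw w).bind (f.comap (obsOfCounts ψ) (measurable_obsOfCounts_left ψ)) := by
  ext s hs
  rw [Measure.bind_apply hs f.measurable.aemeasurable, Measure.bind_apply hs
    (Kernel.measurable _).aemeasurable]
  exact lintegral_map (f.measurable_coe hs) (measurable_obsOfCounts_left ψ)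

/-- The set of the counts that have a nonzero entry at a discarded atom. -/
def missSet (N K : ℕ) : Set (Fin N → ℕ × ℕ → ℕ) := {x | ∃ n p, K ≤ p.1 ∧ x n p ≠ 0}

/-- Missing nothing is a product event, so its probability under the product laws is a product over
observations and atoms. -/
lemma missSet_compl (N K : ℕ) : (missSet N K)ᶜ = Set.univ.pi fun _ : Fin N =>
    Set.univ.pi fun p : ℕ × ℕ => if K ≤ p.1 then {0} else Set.univ := by
  ext x
  simp only [missSet, Set.mem_compl_iff, Set.mem_ofPred_eq, Set.mem_pi, Set.mem_univ, true_imp_iff]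
  push Not
  refine forall_congr' fun n => forall_congr' fun p => ?_
  split_ifs with h <;> simp [h]

lemma measurableSet_missSet (N K : ℕ) : MeasurableSet (missSet N K) := by
  rw [← MeasurableSet.compl_iff, missSet_compl]
  exact MeasurableSet.univ_pi fun _ => MeasurableSet.univ_pi fun p => by measurability

/-- The probability that no count at a discarded atom is nonzero, given the weights. -/
lemma pi_countLaw_missSet_compl (N K : ℕ) (w : ℕ × ℕ → ℝ) :
    (Measure.pi fun _ : Fin N => countLaw w) (missSet N K)ᶜ = nexp (∑' p : ℕ × ℕ,
      if K ≤ p.1 then N * nlog (oddsBernoulliPMF (w p).toNNReal 0 : ℝ≥0∞) else 0) := by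
  have hle : ∀ p, (oddsBernoulliPMF (w p).toNNReal 0 : ℝ≥0∞) ≤ 1 := fun p => by
    rw [← oddsBernoulli_singleton_zero]
    exact prob_le_one
  have h1 : countLaw w (Set.univ.pi fun p : ℕ × ℕ => if K ≤ p.1 then {0} else Set.univ) =
      nexp (∑' p : ℕ × ℕ,
        if K ≤ p.1 then nlog (oddsBernoulliPMF (w p).toNNReal 0 : ℝ≥0∞) else 0) := by
    rw [countLaw, Measure.infinitePi_pi_univ _ fun p => by measurability]
    have h2 := (tendsto_prod_nexp fun p : ℕ × ℕ =>
      if K ≤ p.1 then nlog (oddsBernoulliPMF (w p).toNNReal 0 : ℝ≥0∞) else 0)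
    have h3 : HasProd (fun p : ℕ × ℕ => nexp
      (if K ≤ p.1 then nlog (oddsBernoulliPMF (w p).toNNReal 0 : ℝ≥0∞) else 0)) _ := h2
    rw [← h3.tprod_eq]
    refine tprod_congr fun p => ?_
    split_ifs
    · rw [nexp_nlog (hle p), oddsBernoulli_singleton_zero]
    · simp
  rw [missSet_compl, Measure.pi_pi]
  simp only [h1, Finset.prod_const, Finset.card_univ, Fintype.card_fin]
  rw [← nexp_nat_mul, ← ENNReal.tsum_mul_left]
  congr 2 with p
  split_ifs <;> simp

/-- The data laws with and without truncation, given the atoms, differ by at most the probability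
of a nonzero count at a discarded atom. -/
lemma pi_bind_le_add_missSet {N : ℕ} (K : ℕ) (w : ℕ × ℕ → ℝ) (ψ : ℕ × ℕ → Ψ)
    (f : Kernel (Measure Ψ) Y) [IsMarkovKernel f] {A : Set (Fin N → Y)} (hA : MeasurableSet A) :
    (Measure.pi fun _ : Fin N => (likelihoodProcess w ψ).bind f) A ≤
      (Measure.pi fun _ : Fin N =>
        (likelihoodProcess (fun p => if p.1 < K then w p else 0) ψ).bind f) A +
        (Measure.pi fun _ : Fin N => countLaw w) (missSet N K) ∧
    (Measure.pi fun _ : Fin N =>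
        (likelihoodProcess (fun p => if p.1 < K then w p else 0) ψ).bind f) A ≤
      (Measure.pi fun _ : Fin N => (likelihoodProcess w ψ).bind f) A +
        (Measure.pi fun _ : Fin N => countLaw w) (missSet N K) := by
  let κ : Kernel (ℕ × ℕ → ℕ) Y := f.comap (obsOfCounts ψ) (measurable_obsOfCounts_left ψ)
  let D : (Fin N → ℕ × ℕ → ℕ) → ℝ≥0∞ := fun x => (Measure.pi fun n => κ (x n)) A
  have hD' : Measurable fun x : Fin N → ℕ × ℕ → ℕ => Measure.pi fun n => κ (x n) := by
    simp_rw [← Measure.infinitePi_eq_pi]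
    exact measurable_infinitePi fun i => κ.measurable.comp (measurable_pi_apply i)
  have hD : Measurable D := (Measure.measurable_coe hA).comp hD'
  have hT : Measurable fun (x : Fin N → ℕ × ℕ → ℕ) n => truncateCounts K (x n) :=
    measurable_pi_lambda _ fun n => (measurable_truncateCounts K).comp (measurable_pi_apply n)
  have hD1 : ∀ x, D x ≤ 1 := fun x => prob_le_one
  have e1 : (Measure.pi fun _ : Fin N => (likelihoodProcess w ψ).bind f) A =
      ∫⁻ x, D x ∂(Measure.pi fun _ : Fin N => countLaw w) := by
    rw [likelihoodProcess_bind, Measure.pi_bind, Measure.bind_apply hA hD'.aemeasurable]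
  -- The truncated model is also written as an integral over the untruncated counts, so that the two
  -- integrands can be compared pointwise.
  have e2 : (Measure.pi fun _ : Fin N =>
      (likelihoodProcess (fun p => if p.1 < K then w p else 0) ψ).bind f) A =
      ∫⁻ x, D (fun n => truncateCounts K (x n)) ∂(Measure.pi fun _ : Fin N => countLaw w) := by
    have := Measure.isProbabilityMeasure_map (μ := countLaw w)
      (measurable_truncateCounts K).aemeasurable
    rw [likelihoodProcess_bind, countLaw_truncate, Measure.pi_bind,
      Measure.bind_apply hA hD'.aemeasurable,
      ← Measure.pi_map_pi fun _ => (measurable_truncateCounts K).aemeasurable,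
      lintegral_map hD hT]
  have hmiss : ∀ x : Fin N → ℕ × ℕ → ℕ, x ∉ missSet N K →
      (fun n => truncateCounts K (x n)) = x := by
    intro x hx
    ext n p
    by_cases hp : p.1 < K
    · simp [truncateCounts, hp]
    · have : x n p = 0 := by
        by_contra h
        exact hx ⟨n, p, not_lt.1 hp, h⟩
      simp [truncateCounts, hp, this]
  have hms := measurableSet_missSet N K
  rw [e1, e2, ← lintegral_indicator_one hms]
  constructor
  · have hDT : Measurable fun x : Fin N → ℕ × ℕ → ℕ => D fun n => truncateCounts K (x n) :=
      hD.comp hT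
    rw [← lintegral_add_left hDT]
    -- On `missSet` the indicator dominates because `D ≤ 1`; off it truncation leaves `x` unchanged.
    refine lintegral_mono fun x => ?_
    by_cases hx : x ∈ missSet N K
    · simpa [hx] using (hD1 x).trans le_add_self
    · simp [hx, hmiss x hx]
  · rw [← lintegral_add_left hD]
    refine lintegral_mono fun x => ?_
    by_cases hx : x ∈ missSet N K
    · simpa [hx] using (hD1 _).trans le_add_self
    · simp [hx, hmiss x hx]

variable {P : Measure Ω} [IsProbabilityMeasure P]

omit [IsProbabilityMeasure P] in
lemma missProbability_eq_lintegral {w : ℕ × ℕ → Ω → ℝ} (hw : ∀ p, Measurable (w p)) (N K : ℕ) :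
    missProbability P w N K =
      ∫⁻ ω, (Measure.pi fun _ : Fin N => countLaw fun p => w p ω) (missSet N K) ∂P :=
  Measure.bind_apply (measurableSet_missSet N K)
    (measurable_measure_pi (measurable_countLaw hw)).aemeasurable

/-- The total variation distance between the marginal laws of the data with and without truncation
is at most the probability of a nonzero count at a discarded atom. -/
theorem abs_dataLaw_sub_le {w : ℕ × ℕ → Ω → ℝ} {ψ : ℕ × ℕ → Ω → Ψ} (hw : ∀ p, Measurable (w p))
    (hψ : ∀ p, Measurable (ψ p)) (f : Kernel (Measure Ψ) Y) [IsMarkovKernel f] {N : ℕ} (K : ℕ)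
    {A : Set (Fin N → Y)} (hA : MeasurableSet A) :
    |(dataLaw P w ψ f N).real A - (dataLaw P (truncatedWeight K w) ψ f N).real A| ≤
      (missProbability P w N K).toReal := by
  have hwK : ∀ p, Measurable (truncatedWeight K w p) := fun p => by
    unfold truncatedWeight
    split_ifs
    · exact hw p
    · exact measurable_const
  have hdata : ∀ {w : ℕ × ℕ → Ω → ℝ}, (∀ p, Measurable (w p)) →
      Measurable fun ω => Measure.pi fun _ : Fin N =>
        (likelihoodProcess (fun p => w p ω) fun p => ψ p ω).bind f := fun hw =>
    measurable_measure_pi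
      ((Measure.measurable_bind' f.measurable).comp (measurable_likelihoodProcess hw hψ))
  have h1 := Measure.bind_apply (m := P) hA (hdata hw).aemeasurable
  have h2 := Measure.bind_apply (m := P) hA (hdata hwK).aemeasurable
  have hm1 : Measurable fun ω => (Measure.pi fun _ : Fin N =>
      (likelihoodProcess (fun p => w p ω) fun p => ψ p ω).bind f) A :=
    (Measure.measurable_coe hA).comp (hdata hw)
  have hm2 : Measurable fun ω => (Measure.pi fun _ : Fin N =>
      (likelihoodProcess (fun p => truncatedWeight K w p ω) fun p => ψ p ω).bind f) A :=
    (Measure.measurable_coe hA).comp (hdata hwK)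
  have h3 := missProbability_eq_lintegral (P := P) hw N K
  have hle1 : dataLaw P w ψ f N A ≤
      dataLaw P (truncatedWeight K w) ψ f N A + missProbability P w N K := by
    rw [dataLaw, dataLaw, h1, h2, h3, ← lintegral_add_left hm2]
    exact lintegral_mono fun ω => (pi_bind_le_add_missSet K (fun p => w p ω) _ f hA).1
  have hle2 : dataLaw P (truncatedWeight K w) ψ f N A ≤
      dataLaw P w ψ f N A + missProbability P w N K := by
    rw [dataLaw, dataLaw, h1, h2, h3, ← lintegral_add_left hm1]
    exact lintegral_mono fun ω => (pi_bind_le_add_missSet K (fun p => w p ω) _ f hA).2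
  have hf1 : dataLaw P w ψ f N A ≠ ∞ := by
    rw [dataLaw, h1]
    exact ((lintegral_mono fun ω => prob_le_one).trans_lt (by simp)).ne
  have hf2 : dataLaw P (truncatedWeight K w) ψ f N A ≠ ∞ := by
    rw [dataLaw, h2]
    exact ((lintegral_mono fun ω => prob_le_one).trans_lt (by simp)).ne
  have hf3 : missProbability P w N K ≠ ∞ := by
    rw [h3]
    exact ((lintegral_mono fun ω => prob_le_one).trans_lt (by simp)).ne
  rw [measureReal_def, measureReal_def, abs_sub_le_iff, sub_le_iff_le_add', sub_le_iff_le_add',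
    ← ENNReal.toReal_add hf2 hf3, ← ENNReal.toReal_add hf1 hf3]
  exact ⟨ENNReal.toReal_mono (by simp [hf2, hf3]) hle1,
    ENNReal.toReal_mono (by simp [hf1, hf3]) hle2⟩

variable {G : Measure Ψ} [IsProbabilityMeasure G] {C : ℕ → Ω → ℕ}
  {V : ℕ × ℕ → Ω → ℝ} {U : (ℕ × ℕ) × ℕ → Ω → ℝ} {ψ : ℕ × ℕ → Ω → Ψ} {c d : ℝ} {g : Measure ℝ}

namespace IsPowerLawRep

omit [IsProbabilityMeasure G] [IsProbabilityMeasure P] in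
lemma measurable_plWeight (h : IsPowerLawRep P C V U ψ c 1 d g G) (p : ℕ × ℕ) :
    Measurable (plWeight C V U p) := by
  have hC := h.measurable_C
  refine Measurable.ite ?_ (h.measurable_atomWeight p) measurable_const
  exact measurableSet_lt measurable_const (hC p.1)

omit [IsProbabilityMeasure G] in
/-- The probability of a nonzero count at a discarded atom. -/
theorem missProbability_eq (h : IsPowerLawRep P C V U ψ c 1 d g G) (N K : ℕ) :
    missProbability P (plWeight C V U) N K =
      1 - nexp (truncationB P C (plWeight C V U) N K) := by
  have hprob := h.isProbabilityMeasure_roundLaw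
  have hw := h.measurable_plWeight
  have hms := measurableSet_missSet N K
  -- Chosen so that `nexp (F k θ)` is `π(θ)^N` in a discarded round and `1` in a kept one; the
  -- Laplace functional of the rounds then has exactly `truncationB` in its exponent.
  let F : ℕ → ℝ → ℝ≥0∞ := fun k θ =>
    if K ≤ k then N * nlog (oddsBernoulliPMF θ.toNNReal 0 : ℝ≥0∞) else 0
  have hF : ∀ k, Measurable (F k) := fun k => by
    have h1 := ((measurable_oddsBernoulliPMF 0).comp measurable_real_toNNReal).coe_nnreal_ennreal
    have h2 : Measurable fun θ : ℝ => (N : ℝ≥0∞) * nlog (oddsBernoulliPMF θ.toNNReal 0 : ℝ≥0∞) :=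
      (measurable_nlog.comp h1).const_mul _
    by_cases hk : K ≤ k
    · simpa [F, hk] using h2
    · simp [F, hk]
  have hind : IndepFun (fun ω k => C k ω) (fun ω p => atomWeight V U p ω) P :=
    h.indepFun_C_atoms.comp (φ := id) (ψ := fun (z : ℕ × ℕ → ℝ × Ψ) p => (z p).1) measurable_id
      (by fun_prop)
  have hind2 : iIndepFun (atomWeight V U) P := h.iIndepFun_atoms.comp (fun _ => Prod.fst)
    fun _ => measurable_fst
  have h1 : ∀ ω, (Measure.pi fun _ : Fin N => countLaw fun p => plWeight C V U p ω)
      (missSet N K) = 1 - nexp (∑' p : ℕ × ℕ,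
        if p.2 < C p.1 ω then F p.1 (atomWeight V U p ω) else 0) := by
    intro ω
    rw [← compl_compl (missSet N K), prob_compl_eq_one_sub hms.compl, pi_countLaw_missSet_compl]
    congr 3 with p
    rw [plWeight_eq]
    by_cases h1 : K ≤ p.1 <;> by_cases h2 : p.2 < C p.1 ω <;>
      simp [h1, h2, F, oddsBernoulliPMF_zero]
  have hm : Measurable fun ω => nexp (∑' p : ℕ × ℕ,
      if p.2 < C p.1 ω then F p.1 (atomWeight V U p ω) else 0) := by
    refine measurable_nexp.comp (Measurable.tsum fun p => Measurable.ite ?_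
      ((hF p.1).comp (h.measurable_atomWeight p)) measurable_const)
    exact measurableSet_lt measurable_const (h.measurable_C p.1)
  rw [missProbability_eq_lintegral hw]
  simp_rw [h1]
  rw [lintegral_sub hm ((lintegral_mono fun _ => nexp_le_one _).trans_lt (by simp)).ne
    (ae_of_all _ fun _ => nexp_le_one _), lintegral_nexp_rounds h.measurable_C
    h.measurable_atomWeight h.law_C h.map_atomWeight h.indep_C hind2 hind hF, h.truncationB_eq]
  simp only [lintegral_const, measure_univ, mul_one]
  congr 3 with k
  congr 2 with θ
  by_cases hk : K ≤ k
  · have hle : (oddsBernoulliPMF θ.toNNReal 0 : ℝ≥0∞) ≤ 1 := by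
      rw [← oddsBernoulli_singleton_zero]
      exact prob_le_one
    simp only [F, hk, if_true, nexp_nat_mul, nexp_nlog hle, missRate]
  · simp [F, hk]

end IsPowerLawRep
end Observations

end

theorem mainTheorem7 {Ω Ψ : Type*} [MeasurableSpace Ω] [MeasurableSpace Ψ]
    (P : Measure Ω) [IsProbabilityMeasure P] (G : Measure Ψ) [IsProbabilityMeasure G]
    (γ α d : ℝ) (hγ : 0 < γ) (hα : 0 < α) (hd0 : 0 ≤ d) (hd1 : d < 1) :
    -- the kernel of the stochastic mapping, `κ(t, du) = Gam(t/u; α+d, 1) t/u² du`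
    (∀ t : ℝ, 0 < t → (gammaMeasure (α + d) 1).map (fun x => t / x) =
      volume.withDensity fun u =>
        ENNReal.ofReal (gammaPDFReal (α + d) 1 (t / u) * (t / u ^ 2))) ∧
    -- the stochastic mapping of the gamma process into the beta prime process
    (∀ (θ : ℕ → Ω → ℝ) (ψ : ℕ → Ω → Ψ) (S : ℕ → Ω → ℝ),
      (∀ k, Measurable (θ k)) → (∀ k, Measurable (ψ k)) → (∀ k, Measurable (S k)) →
      IsCRMAtoms P θ ψ (gammaProcessRate (γ * α) 1 d) G →
      (∀ k, P.map (S k) = gammaMeasure (α + d) 1) → iIndepFun S P →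
      IndepFun (fun ω k => (θ k ω, ψ k ω)) (fun ω k => S k ω) P →
      IsCRMAtoms P (fun k ω => θ k ω / S k ω) ψ (betaPrimeProcessRate γ α d) G ∧
      IsCRM P (fun ω => weightedAtoms (fun k => θ k ω / S k ω) (fun k => ψ k ω))
        (betaPrimeProcessRate γ α d) G) ∧
    -- the power-law representation and its truncation error
    (∀ (C : ℕ → Ω → ℕ) (V : ℕ × ℕ → Ω → ℝ) (U : (ℕ × ℕ) × ℕ → Ω → ℝ) (ψ : ℕ × ℕ → Ω → Ψ),
      IsPowerLawRep P C V U ψ (γ * α) 1 d (betaPrimeMeasure 1 (α + d)) G →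
      IsCRM P (fun ω => weightedAtoms (fun p => plWeight C V U p ω) (fun p => ψ p ω))
        (betaPrimeProcessRate γ α d) G ∧
      (1 < α → ∀ N K : ℕ,
        truncationB P C (plWeight C V U) N K ≤ ENNReal.ofReal (plTruncationBound γ α d N K) ∧
        (missProbability P (plWeight C V U) N K).toReal =
          1 - Real.exp (-(truncationB P C (plWeight C V U) N K).toReal) ∧
        (∀ (Y : Type*) [MeasurableSpace Y] (f : Kernel (Measure Ψ) Y) [IsMarkovKernel f]
          (A : Set (Fin N → Y)), MeasurableSet A →
          |(dataLaw P (plWeight C V U) ψ f N).real A -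
            (dataLaw P (truncatedWeight K (plWeight C V U)) ψ f N).real A| ≤
          (missProbability P (plWeight C V U) N K).toReal))) ∧
    -- the asymptotics of the truncation bound
    (1 < α → ∀ N : ℕ,
      (fun K : ℕ => plTruncationBound γ α d N K) ~[atTop] fun K : ℕ =>
        γ * N * α / (α - 1) *
          (if d = 0 then (2 : ℝ) ^ (-(K : ℝ))
           else Real.Gamma (2 / d) / Real.Gamma ((1 + d) / d) * (K : ℝ) ^ (1 - d⁻¹))) := by
  refine ⟨fun t ht => map_div_gammaMeasure ht, ?_, ?_,
    fun _ N => plTruncationBound_isEquivalent hd0 N⟩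
  · intro θ ψ S hθ hψ hS h hlaw hind hindep
    have h' := isCRMAtoms_div P G hγ hα hd0 hd1 hθ hψ hS h hlaw hind hindep
    exact ⟨h', h'.isCRM (fun k => (hθ k).div (hS k)) hψ⟩
  · intro C V U ψ h
    refine ⟨h.isCRM_betaPrime hγ hα hd0 hd1, fun hα1 N K => ?_⟩
    have hB := h.truncationB_le hγ hα1 hd0 hd1 N K
    refine ⟨hB, ?_, fun Y _ f _ A hA =>
      abs_dataLaw_sub_le h.measurable_plWeight h.measurable_ψ f K hA⟩
    -- The identity in `[0, ∞]` passes to real numbers because the explicit bound makes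
    -- `truncationB` finite.
    rw [h.missProbability_eq, ENNReal.toReal_sub_of_le (nexp_le_one _) ENNReal.one_ne_top,
      ENNReal.toReal_one, toReal_nexp (ne_top_of_le_ne_top ENNReal.ofReal_ne_top hB)]
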